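/- **Setting.** Let $\Omega=\mathbb R^3$ or $\Omega=\mathbb T^3=\mathbb R^3/\ell\mathbb Z^3$ ($\ell>0$), let $I\subset\mathbb R$ be open (e.g. $I=\mathbb R$ or $I=(0,\infty)$), $M(v)=(2\pi)^{-3/2}e^{-|v|^2/2}$, $\langle h,k\rangle_M=\int_{\mathbb R^3}hkM\,dv$, and $$Q(f,h)(v)=\int_{\mathbb R^3}\int_{\mathbb S^2}(f'h'_*-fh_*)\,b\,d\omega\,dv_*,\qquad v'=v-[(v-v_*)\cdot\omega]\omega,\quad v'_*=v_*+[(v-v_*)\cdot\omega]\omega .$$ Here $b=b(|v-v_*|,|(v-v_*)\cdot\omega|)\ge 0$ is a measurable cutoff collision kernel: it is positive when $0<|(v-v_*)\cdot\omega|<|v-v_*|$, and the collision frequency $a(v)=\iint b\,M(v_*)\,d\omega\,dv_*$ is finite and grows at most polynomially. Put $$Lh=-\tfrac1M\big(Q(M,hM)+Q(hM,M)\big),\qquad \Gamma(h,h)=\tfrac1M Q(hM,hM),$$ where $L$ acts on $L^2((1+a)M\,dv)$ and $\mathrm{Ker}^\perp L$ is taken in this space with respect to $\langle\cdot,\cdot\rangle_M$.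 Let $A_i=\frac12(|v|^2-5)v_i$, $B_{ij}=v_iv_j-\frac13|v|^2\delta_{ij}$, and let $\hat A_i,\hat B_{ij}\in\mathrm{Ker}^\perp L$ satisfy $L\hat A_i=A_i$, $L\hat B_{ij}=B_{ij}$ (they are unique). **Hypotheses.** Let $q,r>0$, let $\varepsilon$ run through a sequence of positive numbers tending to $0$, and let $f_\varepsilon=M+\varepsilon^r g_\varepsilon M\ge0$ be weak solutions on $I\times\Omega\times\mathbb R^3$ of $$\varepsilon\,\partial_tf_\varepsilon+v\cdot\nabla_xf_\varepsilon=\varepsilon^{-q}Q(f_\varepsilon,f_\varepsilon),$$ where, for each fixed $\varepsilon$ (with no uniformity in $\varepsilon$), $g_\varepsilon\in L^2_{loc}(I\times\Omega;L^2((1+|v|^2)^2(1+a)M\,dv))$, and $\langle\Gamma(g_\varepsilon,g_\varepsilon),\hat A\rangle_M$, $\langle\Gamma(g_\varepsilon,g_\varepsilon),\hat B\rangle_M$ are given by integrals that converge absolutely, locally in $(t,x)$. Let $g\in L^2_{loc}(I\times\Omega;L^2((1+a)M\,dv))$ and suppose that, as $\varepsilon\to0^+$: 1. $g_\varepsilon\to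 g$ in the sense of distributions on $I\times\Omega\times\mathbb R^3$, compatibly with the collision operator: $Lg_\varepsilon\to Lg$ and $\varepsilon^r\,\Gamma(g_\varepsilon,g_\varepsilon)\to0$ in the sense of distributions; 2. the moments $$\langle g_\varepsilon,1\rangle_M,\ \langle g_\varepsilon,v\rangle_M,\ \langle g_\varepsilon,v\otimes v\rangle_M,\ \langle g_\varepsilon,v|v|^2\rangle_M,\ \langle g_\varepsilon,\hat A\otimes v\rangle_M,\ \langle g_\varepsilon,\hat B\otimes v\rangle_M,\ \langle\Gamma(g_\varepsilon,g_\varepsilon),\hat A\rangle_M,\ \langle\Gamma(g_\varepsilon,g_\varepsilon),\hat B\rangle_M$$ converge in $\mathcal D'(I\times\Omega)$ to the corresponding moments of $g$ and $\Gamma(g,g)$, and $\varepsilon\langle g_\varepsilon,\hat A\rangle_M\to0$, $\varepsilon\langle g_\varepsilon,\hat B\rangle_M\to0$ in $\mathcal D'(I\times\Omega)$. **Conclusion.** There are constants $\kappa,\nu>0$ with $$\langle\hat A_i,A_j\rangle_M=\tfrac52\kappa\,\delta_{ij},\qquad \langle\hat B_{ij},B_{kl}\rangle_M=\nu\big(\delta_{ik}\delta_{jl}+\delta_{il}\delta_{jk}-\tfrac23\delta_{ij}\delta_{kl}\big),$$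 and there are $\rho,u,\theta\in L^2_{loc}(I\times\Omega)$ such that, almost everywhere, $$g=\rho+u\cdot v+\tfrac12(|v|^2-3)\theta ,$$ and, in the sense of distributions on $I\times\Omega$, $$\mathrm{div}_x u=0,\qquad \nabla_x(\rho+\theta)=0 .$$ Moreover, for some $p\in\mathcal D'(I\times\Omega)$, in the sense of distributions (with $u\cdot\nabla_xu=\mathrm{div}_x(u\otimes u)$ and $u\cdot\nabla_x\theta=\mathrm{div}_x(u\theta)$): - if $0<r=q<1$: $\ u\cdot\nabla_xu+\nabla_xp=\nu\Delta_xu,\quad u\cdot\nabla_x\theta=\kappa\Delta_x\theta$; - if $0<q<\min\{1,r\}$: $\ \nabla_xp=\nu\Delta_xu,\quad \kappa\Delta_x\theta=0$; - if $0<r<\min\{1,q\}$: $\ u\cdot\nabla_xu+\nabla_xp=0,\quad u\cdot\nabla_x\theta=0$. -/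

import Mathlib

open MeasureTheory TopologicalSpace Filter Topology
open scoped Distributions LineDeriv RealInnerProductSpace

noncomputable section

namespace StationaryLimit

/-- Velocities and positions live in three-dimensional Euclidean space. -/
abbrev V3 := EuclideanSpace ℝ (Fin 3)

/-- Points `(t, x)` of space-time. -/
abbrev SpaceTime := ℝ × V3

/-! ### The collision operator -/

/-- The absolute Maxwellian `M(v) = (2π)^{-3/2} exp(-|v|²/2)`. -/
def M (v : V3) : ℝ := (2 * Real.pi) ^ (-(3 / 2 : ℝ)) * Real.exp (-‖v‖ ^ 2 / 2)

/-- The unit sphere of directions. -/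
abbrev S2 := Metric.sphere (0 : V3) 1

/-- The surface measure `dω` of the unit sphere. -/
def sigma : Measure S2 := (volume : Measure V3).toSphere

/-- The post-collisional velocity `v' = v - [(v - v_*)·ω] ω`. -/
def post (v w : V3) (ω : S2) : V3 := v - (⟪v - w, (ω : V3)⟫) • (ω : V3)

/-- The post-collisional velocity `v'_* = v_* + [(v - v_*)·ω] ω`. -/
def postStar (v w : V3) (ω : S2) : V3 := w + (⟪v - w, (ω : V3)⟫) • (ω : V3)

/-- The value of the collision kernel at `(v, v_*, ω)`; as usual it is a function
of `|v - v_*|` and `|(v - v_*)·ω|` only. -/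
def kern (b : ℝ → ℝ → ℝ) (v w : V3) (ω : S2) : ℝ := b ‖v - w‖ |⟪v - w, (ω : V3)⟫|

/-- The collision frequency `a(v) = ∫∫ b M_* dω dv_*`. -/
def freq (b : ℝ → ℝ → ℝ) (v : V3) : ℝ :=
  ∫ p : V3 × S2, kern b v p.1 p.2 * M p.1 ∂(volume.prod sigma)

/-- Collision kernels with an angular cutoff: measurable, nonnegative, positive except for
grazing and head-on collisions, with a finite collision frequency of at most polynomial growth. -/
structure IsCutoffKernel (b : ℝ → ℝ → ℝ) : Prop where
  measurable : Measurable (Function.uncurry b)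
  nonneg : ∀ r s, 0 ≤ b r s
  pos : ∀ r s, 0 < s → s < r → 0 < b r s
  integrable : ∀ v : V3,
    Integrable (fun p : V3 × S2 => kern b v p.1 p.2 * M p.1) (volume.prod sigma)
  growth : ∃ (C : ℝ) (m : ℕ), ∀ v : V3, freq b v ≤ C * (1 + ‖v‖) ^ m

/-- The bilinear collision operator `Q(f,h) = ∫∫ (f' h'_* - f h_*) b dω dv_*`. -/
def Q (b : ℝ → ℝ → ℝ) (f h : V3 → ℝ) (v : V3) : ℝ :=
  ∫ p : V3 × S2, (f (post v p.1 p.2) * h (postStar v p.1 p.2) - f v * h p.1) * kern b v p.1 p.2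
    ∂(volume.prod sigma)

/-- The linearized operator `L h = -(1/M) (Q(M, hM) + Q(hM, M))`. -/
def L (b : ℝ → ℝ → ℝ) (h : V3 → ℝ) (v : V3) : ℝ :=
  -(1 / M v) * (Q b M (fun w => h w * M w) v + Q b (fun w => h w * M w) M v)

/-- The quadratic operator `Γ(h,h) = (1/M) Q(hM, hM)`. -/
def Gam (b : ℝ → ℝ → ℝ) (h : V3 → ℝ) (v : V3) : ℝ :=
  1 / M v * Q b (fun w => h w * M w) (fun w => h w * M w) v

/-- The inner product `⟨h, k⟩_M = ∫ h k M dv`. -/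
def pairM (h k : V3 → ℝ) : ℝ := ∫ v, h v * k v * M v

/-- The (form) domain `L²((1+a) M dv)` of `L`; it equals `L²(M dv)` if `a` is bounded. -/
def InDomain (b : ℝ → ℝ → ℝ) (h : V3 → ℝ) : Prop :=
  Measurable h ∧ Integrable (fun v => (1 + freq b v) * h v ^ 2 * M v)

/-- `h ∈ Ker L`. -/
def InKer (b : ℝ → ℝ → ℝ) (h : V3 → ℝ) : Prop :=
  InDomain b h ∧ L b h =ᵐ[volume] 0

/-- `h ∈ Ker^⊥ L`, the orthogonal complement being taken for `⟨·,·⟩_M`. -/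
def InKerPerp (b : ℝ → ℝ → ℝ) (h : V3 → ℝ) : Prop :=
  InDomain b h ∧ ∀ k, InKer b k → pairM h k = 0

/-- Kronecker's delta. -/
def delta (i j : Fin 3) : ℝ := if i = j then 1 else 0

/-- `A_i(v) = (|v|² - 5) v_i / 2`. -/
def A (i : Fin 3) (v : V3) : ℝ := 1 / 2 * (‖v‖ ^ 2 - 5) * v i

/-- `B_{ij}(v) = v_i v_j - |v|² δ_{ij} / 3`. -/
def B (i j : Fin 3) (v : V3) : ℝ := v i * v j - 1 / 3 * ‖v‖ ^ 2 * delta i j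

/-! ### Space-time, distributions -/

/-- The open set `I × ℝ³` of space-time. -/
def spaceTime (I : Opens ℝ) : Opens SpaceTime :=
  ⟨(I : Set ℝ) ×ˢ Set.univ, I.isOpen.prod isOpen_univ⟩

/-- The open set `I × ℝ³ × ℝ³` of phase space-time, with points `((t, x), v)`. -/
def phase (I : Opens ℝ) : Opens (SpaceTime × V3) :=
  ⟨(spaceTime I : Set SpaceTime) ×ˢ Set.univ, (spaceTime I).isOpen.prod isOpen_univ⟩

/-- The spatial domain is `Ω = ℝ³ / Λ`, where `Λ = {0}` (so that `Ω = ℝ³`) or `Λ = ℓ ℤ³` with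
`ℓ > 0` (so that `Ω` is a torus). Functions and distributions on `Ω` are the `Λ`-periodic
functions and distributions on `ℝ³`. -/
def IsPeriodLattice (Lam : Set V3) : Prop :=
  Lam = {0} ∨ ∃ l : ℝ, 0 < l ∧ Lam = {x | ∃ k : Fin 3 → ℤ, ∀ i, x i = l * k i}

/-- Periodicity in `x` of a function of `(t, x)`, for `t ∈ I`. -/
def IsPeriodic {Y : Type*} (I : Opens ℝ) (Lam : Set V3) (F : SpaceTime → Y) : Prop :=
  ∀ k ∈ Lam, ∀ t ∈ I, ∀ x, F (t, x + k) = F (t, x)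

/-- Periodicity in `x` of a distribution on `I × ℝ³`. -/
def IsPeriodicDist (I : Opens ℝ) (Lam : Set V3) (p : 𝓓'(spaceTime I, ℝ)) : Prop :=
  ∀ k ∈ Lam, ∀ φ ψ : 𝓓(spaceTime I, ℝ), (∀ t x, ψ (t, x) = φ (t, x + k)) → p ψ = p φ

/-- Convergence in the sense of distributions on `U` of locally integrable functions. -/
def TendstoDist {X : Type*} [NormedAddCommGroup X] [NormedSpace ℝ X] [MeasureSpace X]
    (U : Opens X) (F : ℕ → X → ℝ) (G : X → ℝ) : Prop :=
  (∀ n, LocallyIntegrableOn (F n) U) ∧ LocallyIntegrableOn G U ∧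
    ∀ φ : 𝓓(U, ℝ), Tendsto (fun n => ∫ y, F n y * φ y) atTop (𝓝 (∫ y, G y * φ y))

/-! ### The scaled Boltzmann equation -/

/-- Weak solutions on `I × ℝ³ × ℝ³` of `ε ∂_t f + v·∇_x f = ε^{-q} Q(f,f)`. -/
def IsWeakSolution (b : ℝ → ℝ → ℝ) (I : Opens ℝ) (ε q : ℝ) (f : SpaceTime → V3 → ℝ) : Prop :=
  LocallyIntegrableOn (fun z : SpaceTime × V3 => f z.1 z.2) (phase I) ∧
  LocallyIntegrableOn (fun z : SpaceTime × V3 => Q b (f z.1) (f z.1) z.2) (phase I) ∧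
  ∀ φ : 𝓓(phase I, ℝ),
    -∫ z : SpaceTime × V3, f z.1 z.2 * fderiv ℝ φ z ((ε, z.2), 0) =
      ε ^ (-q) * ∫ z : SpaceTime × V3, Q b (f z.1) (f z.1) z.2 * φ z

/-- `h` is measurable and locally square integrable in `(t,x)` with values in
`L²(wt (1+a) M dv)`. -/
def LocL2 (b : ℝ → ℝ → ℝ) (I : Opens ℝ) (wt : V3 → ℝ) (h : SpaceTime → V3 → ℝ) : Prop :=
  Measurable (Function.uncurry h) ∧
  ∀ K : Set SpaceTime, IsCompact K → K ⊆ spaceTime I →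
    IntegrableOn (fun z : SpaceTime × V3 =>
      wt z.2 * (1 + freq b z.2) * h z.1 z.2 ^ 2 * M z.2) (K ×ˢ Set.univ)

/-- The velocity moment `⟨h, ψ⟩_M` as a function of `(t,x)`. -/
def moment (h : SpaceTime → V3 → ℝ) (ψ : V3 → ℝ) (y : SpaceTime) : ℝ := pairM (h y) ψ

/-- The moment `⟨h, ψ⟩_M` is given by an integral that converges absolutely, locally in `(t,x)`. -/
def HasMoment (I : Opens ℝ) (h : SpaceTime → V3 → ℝ) (ψ : V3 → ℝ) : Prop :=
  ∀ K : Set SpaceTime, IsCompact K → K ⊆ spaceTime I →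
    IntegrableOn (fun z : SpaceTime × V3 => h z.1 z.2 * ψ z.2 * M z.2) (K ×ˢ Set.univ)

/-- `Γ(h,h)` as a function of `(t,x)` and `v`. -/
def GamF (b : ℝ → ℝ → ℝ) (h : SpaceTime → V3 → ℝ) (y : SpaceTime) : V3 → ℝ := Gam b (h y)

/-- The moments `⟨h n, ψ⟩_M` converge in `D'` to the corresponding moment of `h₀`. -/
def MomentTendsto (I : Opens ℝ) (h : ℕ → SpaceTime → V3 → ℝ) (h₀ : SpaceTime → V3 → ℝ)
    (ψ : V3 → ℝ) : Prop :=
  TendstoDist (spaceTime I) (fun n => moment (h n) ψ) (moment h₀ ψ)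

/-! ### The limiting equations, in the sense of distributions -/

/-- The direction of `∂_{x_i}` in space-time. -/
def dx (i : Fin 3) : SpaceTime := (0, EuclideanSpace.single i 1)

/-- The Laplacian in `x` of a test function. -/
def lap {I : Opens ℝ} (φ : 𝓓(spaceTime I, ℝ)) : 𝓓(spaceTime I, ℝ) :=
  ∑ j, ∂_{dx j} (∂_{dx j} φ)

/-- `F ∈ L²_loc(I × ℝ³)`. -/
def FieldL2 (I : Opens ℝ) (F : SpaceTime → ℝ) : Prop :=
  Measurable F ∧ ∀ K : Set SpaceTime, IsCompact K → K ⊆ spaceTime I →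
    IntegrableOn (fun y => F y ^ 2) K

/-- `div_x u = 0`. -/
def DivFree (I : Opens ℝ) (u : SpaceTime → V3) : Prop :=
  ∀ φ : 𝓓(spaceTime I, ℝ), -∫ y, ∑ j, u y j * (∂_{dx j} φ) y = 0

/-- `∇_x F = 0`. -/
def GradZero (I : Opens ℝ) (F : SpaceTime → ℝ) : Prop :=
  ∀ (i : Fin 3) (φ : 𝓓(spaceTime I, ℝ)), -∫ y, F y * (∂_{dx i} φ) y = 0

/-- `c (u·∇_x) u + ∇_x p = ν Δ_x u` for divergence-free `u`, where `(u·∇_x) u` is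
`div_x (u ⊗ u)`. -/
def MomentumEq (I : Opens ℝ) (c ν : ℝ) (u : SpaceTime → V3) (p : 𝓓'(spaceTime I, ℝ)) : Prop :=
  ∀ (i : Fin 3) (φ : 𝓓(spaceTime I, ℝ)),
    c * (-∫ y, ∑ j, u y i * u y j * (∂_{dx j} φ) y) + (∂_{dx i} p) φ = ν * ∫ y, u y i * lap φ y

/-- `c u·∇_x θ = κ Δ_x θ` for divergence-free `u`, where `u·∇_x θ` is `div_x (u θ)`. -/
def HeatEq (I : Opens ℝ) (c κ : ℝ) (u : SpaceTime → V3) (θ : SpaceTime → ℝ) : Prop :=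
  ∀ φ : 𝓓(spaceTime I, ℝ),
    c * (-∫ y, ∑ j, u y j * θ y * (∂_{dx j} φ) y) = κ * ∫ y, θ y * lap φ y

end StationaryLimit

end

open StationaryLimit

/-!
The argument is the moment method for hydrodynamic limits. In terms of the collision measure
`b M M_* dv dv_* dω`, which is invariant under the collision map and under the exchange of the two
particles, `L h` is the average of the defect `h + h_* - h' - h'_*`, and `⟨L h, k⟩_M` is a quarter
of the integral of the product of the defects of `h` and `k` (`InDomain.pairM_L`). So `L` is
symmetric, and its kernel consists of the functions with vanishing defect. Mollification reduces
these to continuous collision invariants, which are of the form `a + c·v + d|v|²`, as a continuous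
function that is additive on orthogonal pairs of vectors is the sum of a linear form and of a
multiple of `|v|²` (`InKer.exists_quadInv`). As `L` commutes with isometries, uniqueness in
`Ker^⊥ L` makes the tensors `⟨Â_i, A_j⟩` and `⟨B̂_ij, B_kl⟩` isotropic, which determines them up to
the constants `κ` and `ν` (`exists_conductivity`, `exists_viscosity`).

Multiplied by `ε^q`, the kinetic equation gives `L g = 0` in the limit, hence the form of `g`
(`ae_inKer_of_tendsto`, `FluidLimit.ae_eq_fluid`). Integrated against `1` and `v` it gives the
incompressibility and the Boussinesq relation. The equations of motion appear at the next order.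
The energy moment `(|v|² - 5)/2` has the flux `⟨g_ε, A⟩`, and the flux of the momentum `v_i` is
`⟨g_ε, B_ij⟩` up to a multiple of the identity. As `A = L Â` and `L` is symmetric, the moment of
the kinetic equation with weight `Â` expresses `⟨g_ε, A⟩` by
`-ε^q div ⟨g_ε, Â ⊗ v⟩ + ε^r ⟨Γ(g_ε, g_ε), Â⟩` up to a small term, and similarly for `B`
(`flux_fluctuation`). Divide by `ε^s`, `s = min q r`, and pass to the limit
(`FluidLimit.tendsto_flux`). For the limit `g`, a collision invariant, `Γ(g, g) = L(g²) / 2`, so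
that `⟨Γ(g, g), Â⟩ = ⟨g², A⟩ / 2` is a Gaussian moment, equal to `5 u θ / 2`, and similarly
`⟨Γ(g, g), B̂⟩` is the traceless part of `u ⊗ u`. The time derivatives disappear because `s < 1`.

The multiple of the identity in the momentum flux is of the order `1` before the division by `ε^s`,
so the pressure does not converge by itself, only its gradient does. That the limit is again a
gradient, and of a distribution with the same periods, is
`exists_distribution_of_tendsto_gradient`: a test function is a divergence in `x` plus a product
`χ(x) Ψ(t)` with a fixed `χ`, so the pressures converge on test functions once their `χ`-averages
have been subtracted, and a pointwise limit of distributions is a distribution by the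
Banach–Steinhaus theorem.
-/

noncomputable section

namespace StationaryLimit

/-! ### The Maxwellian and its moments -/

theorem M_pos (v : V3) : 0 < M v := by
  unfold M; positivity

theorem continuous_M : Continuous M := by
  unfold M; fun_prop

theorem measurable_M : Measurable M := continuous_M.measurable

theorem contDiff_M : ContDiff ℝ (⊤ : ℕ∞) M := by
  unfold M
  exact contDiff_const.mul (((contDiff_norm_sq ℝ).neg.div_const _).exp)

/-- Measurable functions of at most polynomial growth. -/
structure PolyGrowth (F : V3 → ℝ) : Prop where
  measurable : Measurable F
  bound : ∃ (C : ℝ) (n : ℕ), ∀ v, |F v| ≤ C * (1 + ‖v‖) ^ n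

namespace PolyGrowth

theorem const (c : ℝ) : PolyGrowth fun _ => c :=
  ⟨measurable_const, |c|, 0, fun v => by simp⟩

theorem coord (i : Fin 3) : PolyGrowth fun v => v i := by
  refine ⟨by fun_prop, 1, 1, fun v => ?_⟩
  have h2 : |v i| ≤ ‖v‖ := by simpa using PiLp.norm_apply_le v i
  linarith

theorem norm : PolyGrowth fun v => ‖v‖ := by
  refine ⟨by fun_prop, 1, 1, fun v => ?_⟩
  rw [abs_of_nonneg (norm_nonneg v)]; linarith

theorem mul {F G : V3 → ℝ} (hF : PolyGrowth F) (hG : PolyGrowth G) :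
    PolyGrowth fun v => F v * G v := by
  obtain ⟨C, n, h⟩ := hF.bound
  obtain ⟨D, m, h'⟩ := hG.bound
  refine ⟨hF.measurable.mul hG.measurable, C * D, n + m, fun v => ?_⟩
  rw [abs_mul, pow_add]
  calc |F v| * |G v| ≤ (C * (1 + ‖v‖) ^ n) * (D * (1 + ‖v‖) ^ m) :=
        mul_le_mul (h v) (h' v) (abs_nonneg _) ((abs_nonneg _).trans (h v))
    _ = _ := by ring

theorem add {F G : V3 → ℝ} (hF : PolyGrowth F) (hG : PolyGrowth G) :
    PolyGrowth fun v => F v + G v := by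
  obtain ⟨C, n, h⟩ := hF.bound
  obtain ⟨D, m, h'⟩ := hG.bound
  refine ⟨hF.measurable.add hG.measurable, |C| + |D|, n + m, fun v => ?_⟩
  have h1 : (1 : ℝ) ≤ 1 + ‖v‖ := by linarith [norm_nonneg v]
  have e1 : |F v| ≤ |C| * (1 + ‖v‖) ^ (n + m) := (h v).trans <|
    mul_le_mul (le_abs_self C) (pow_le_pow_right₀ h1 (by omega)) (by positivity) (abs_nonneg _)
  have e2 : |G v| ≤ |D| * (1 + ‖v‖) ^ (n + m) := (h' v).trans <|
    mul_le_mul (le_abs_self D) (pow_le_pow_right₀ h1 (by omega)) (by positivity) (abs_nonneg _)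
  calc |F v + G v| ≤ |F v| + |G v| := abs_add_le _ _
    _ ≤ _ := by linarith

theorem const_mul {F : V3 → ℝ} (c : ℝ) (hF : PolyGrowth F) : PolyGrowth fun v => c * F v :=
  (const c).mul hF

theorem sub {F G : V3 → ℝ} (hF : PolyGrowth F) (hG : PolyGrowth G) :
    PolyGrowth fun v => F v - G v := by
  simpa [sub_eq_add_neg] using hF.add (hG.const_mul (-1))

theorem pow {F : V3 → ℝ} (hF : PolyGrowth F) (n : ℕ) : PolyGrowth fun v => F v ^ n := by
  induction n with
  | zero => simpa using const 1
  | succ n ih => simpa [pow_succ] using ih.mul hF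

theorem sum {ι : Type*} (s : Finset ι) {F : ι → V3 → ℝ} (hF : ∀ i, PolyGrowth (F i)) :
    PolyGrowth fun v => ∑ i ∈ s, F i v := by
  classical
  induction s using Finset.induction_on with
  | empty => simpa using const 0
  | insert a s ha ih => simpa [Finset.sum_insert ha] using (hF a).add ih

theorem normSq : PolyGrowth fun v => ‖v‖ ^ 2 := norm.pow 2

end PolyGrowth

theorem integrable_exp_neg_mul_normSq {c : ℝ} (hc : 0 < c) :
    Integrable fun v : V3 => Real.exp (-c * ‖v‖ ^ 2) := by
  apply Integrable.of_integral_ne_zero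
  rw [GaussianFourier.integral_rexp_neg_mul_sq_norm hc]
  positivity

theorem integral_M : ∫ v, M v = 1 := by
  have h : ∀ v : V3, M v = (2 * Real.pi) ^ (-(3 / 2 : ℝ)) * Real.exp (-(1 / 2) * ‖v‖ ^ 2) := by
    intro v; unfold M; congr 2; ring
  simp_rw [h]
  rw [integral_const_mul, GaussianFourier.integral_rexp_neg_mul_sq_norm (by norm_num)]
  have : Real.pi / (1 / 2) = 2 * Real.pi := by ring
  rw [this]
  simp only [finrank_euclideanSpace, Fintype.card_fin, Nat.cast_ofNat]
  rw [← Real.rpow_add (by positivity)]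
  norm_num

/-- Functions of polynomial growth are integrable against the Maxwellian. -/
theorem PolyGrowth.integrable_mul_M {F : V3 → ℝ} (hF : PolyGrowth F) :
    Integrable fun v => F v * M v := by
  obtain ⟨C, n, h⟩ := hF.bound
  have hi := (integrable_exp_neg_mul_normSq (c := 1 / 4) (by norm_num)).const_mul
    (|C| * (n.factorial * Real.exp 3) * (2 * Real.pi) ^ (-(3 / 2 : ℝ)))
  refine hi.mono' (hF.measurable.mul measurable_M).aestronglyMeasurable (ae_of_all _ fun v => ?_)
  rw [Real.norm_eq_abs, abs_mul, abs_of_pos (M_pos v)]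
  have h0 : (0 : ℝ) ≤ 1 + ‖v‖ := by positivity
  have h1 : (1 + ‖v‖) ^ n ≤ n.factorial * Real.exp (1 + ‖v‖) := by
    have := Real.pow_div_factorial_le_exp (1 + ‖v‖) h0 n
    rwa [div_le_iff₀ (by positivity), mul_comm] at this
  have h2 : Real.exp (1 + ‖v‖) * Real.exp (-‖v‖ ^ 2 / 2)
      ≤ Real.exp 3 * Real.exp (-(1 / 4) * ‖v‖ ^ 2) := by
    rw [← Real.exp_add, ← Real.exp_add]
    apply Real.exp_le_exp.2
    nlinarith [sq_nonneg (‖v‖ - 2)]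
  have h3 : (0 : ℝ) ≤ (2 * Real.pi) ^ (-(3 / 2 : ℝ)) := by positivity
  have h4 : |F v| ≤ |C| * (n.factorial * Real.exp (1 + ‖v‖)) :=
    (h v).trans (mul_le_mul (le_abs_self C) h1 (by positivity) (abs_nonneg _))
  calc |F v| * M v ≤ |C| * (n.factorial * Real.exp (1 + ‖v‖)) * M v :=
        mul_le_mul_of_nonneg_right h4 (M_pos v).le
    _ = (|C| * n.factorial * (2 * Real.pi) ^ (-(3 / 2 : ℝ))) *
          (Real.exp (1 + ‖v‖) * Real.exp (-‖v‖ ^ 2 / 2)) := by unfold M; ring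
    _ ≤ (|C| * n.factorial * (2 * Real.pi) ^ (-(3 / 2 : ℝ))) *
          (Real.exp 3 * Real.exp (-(1 / 4) * ‖v‖ ^ 2)) :=
        mul_le_mul_of_nonneg_left h2 (by positivity)
    _ = _ := by ring

/-- The expectation of `F` for the Maxwellian. -/
def gaussMean (F : V3 → ℝ) : ℝ := ∫ v, F v * M v

theorem gaussMean_add {F G : V3 → ℝ} (hF : PolyGrowth F) (hG : PolyGrowth G) :
    gaussMean (fun v => F v + G v) = gaussMean F + gaussMean G := by
  unfold gaussMean
  rw [← integral_add hF.integrable_mul_M hG.integrable_mul_M]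
  simp_rw [add_mul]

theorem gaussMean_sub {F G : V3 → ℝ} (hF : PolyGrowth F) (hG : PolyGrowth G) :
    gaussMean (fun v => F v - G v) = gaussMean F - gaussMean G := by
  unfold gaussMean
  rw [← integral_sub hF.integrable_mul_M hG.integrable_mul_M]
  simp_rw [sub_mul]

theorem gaussMean_const_mul (c : ℝ) (F : V3 → ℝ) :
    gaussMean (fun v => c * F v) = c * gaussMean F := by
  unfold gaussMean
  rw [← integral_const_mul]
  simp_rw [mul_assoc]

theorem gaussMean_sum {ι : Type*} (s : Finset ι) {F : ι → V3 → ℝ} (hF : ∀ i, PolyGrowth (F i)) :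
    gaussMean (fun v => ∑ i ∈ s, F i v) = ∑ i ∈ s, gaussMean (F i) := by
  unfold gaussMean
  rw [← integral_finsetSum _ fun i _ => (hF i).integrable_mul_M]
  simp_rw [Finset.sum_mul]

theorem gaussMean_one : gaussMean (fun _ => 1) = 1 := by
  simp [gaussMean, integral_M]

theorem M_neg (v : V3) : M (-v) = M v := by simp [M]

/-- Odd functions have mean zero. -/
theorem gaussMean_odd {F : V3 → ℝ} (hF : ∀ v, F (-v) = -F v) : gaussMean F = 0 := by
  have h : gaussMean F = -gaussMean F := by
    unfold gaussMean
    conv_lhs => rw [← integral_neg_eq_self]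
    simp_rw [hF, M_neg, neg_mul, integral_neg]
  linarith

theorem normSq_eq_sum (v : V3) : ‖v‖ ^ 2 = ∑ k, v k * v k := by
  rw [EuclideanSpace.norm_sq_eq]; simp [sq]

theorem hasLineDerivAt_coord (i j : Fin 3) (v : V3) :
    HasLineDerivAt ℝ (fun w : V3 => w j) (delta i j) v (EuclideanSpace.single i 1) := by
  have h : HasDerivAt (fun t : ℝ => v j + t * delta i j) (delta i j) 0 := by
    simpa using ((hasDerivAt_id (0 : ℝ)).mul_const (delta i j)).const_add (v j)
  refine h.congr_of_eventuallyEq (Eventually.of_forall fun t => ?_)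
  simp [delta, eq_comm]

theorem hasLineDerivAt_mul {F G : V3 → ℝ} {F' G' : ℝ} {v e : V3}
    (hF : HasLineDerivAt ℝ F F' v e) (hG : HasLineDerivAt ℝ G G' v e) :
    HasLineDerivAt ℝ (fun w => F w * G w) (F' * G v + F v * G') v e := by
  have := HasDerivAt.fun_mul hF hG
  simpa [HasLineDerivAt] using this

theorem hasLineDerivAt_normSq (i : Fin 3) (v : V3) :
    HasLineDerivAt ℝ (fun w : V3 => ‖w‖ ^ 2) (2 * v i) v (EuclideanSpace.single i 1) := by
  have h : HasDerivAt (fun t : ℝ => ‖v‖ ^ 2 + 2 * v i * t + t ^ 2) (2 * v i) 0 := by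
    have h1 := ((hasDerivAt_id (0 : ℝ)).const_mul (2 * v i)).const_add (‖v‖ ^ 2)
    have h2 := h1.fun_add (hasDerivAt_pow 2 (0 : ℝ))
    simpa using h2
  refine h.congr_of_eventuallyEq (Eventually.of_forall fun t => ?_)
  simp only
  rw [norm_add_sq_real, inner_smul_right, EuclideanSpace.inner_single_right, norm_smul]
  simp; ring

theorem hasLineDerivAt_M (i : Fin 3) (v : V3) :
    HasLineDerivAt ℝ M (-(v i * M v)) v (EuclideanSpace.single i 1) := by
  have h := (((hasLineDerivAt_normSq i v).neg.div_const 2).exp).const_mul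
    ((2 * Real.pi) ^ (-(3 / 2 : ℝ)))
  unfold HasLineDerivAt M
  convert! h using 1
  simp; ring

/-- Integration by parts against the Maxwellian. -/
theorem gaussMean_coord_mul (i : Fin 3) {F F' : V3 → ℝ} (hF : PolyGrowth F) (hF' : PolyGrowth F')
    (h : ∀ v, HasLineDerivAt ℝ F (F' v) v (EuclideanSpace.single i 1)) :
    gaussMean (fun v => v i * F v) = gaussMean F' := by
  have key := integral_bilinear_hasLineDerivAt_right_eq_neg_left_of_integrable
    (μ := (volume : Measure V3)) (B := ContinuousLinearMap.mul ℝ ℝ) (f := F) (f' := F') (g := M)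
    (g' := fun v => -(v i * M v)) (v := EuclideanSpace.single i (1 : ℝ))
    hF'.integrable_mul_M
    (by
      have := (hF.mul (PolyGrowth.coord i)).integrable_mul_M.neg
      refine this.congr (ae_of_all _ fun v => ?_)
      simp; ring)
    hF.integrable_mul_M (fun v _ => h v) (fun v _ => hasLineDerivAt_M i v)
  simp only [ContinuousLinearMap.mul_apply'] at key
  unfold gaussMean
  rw [← neg_inj, ← key, ← integral_neg]
  congr 1; ext v; ring

theorem gaussMean_coord (i : Fin 3) : gaussMean (fun v => v i) = 0 :=
  gaussMean_odd fun v => by simp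

theorem gaussMean_coord_coord (i j : Fin 3) : gaussMean (fun v => v i * v j) = delta i j := by
  rw [gaussMean_coord_mul i (PolyGrowth.coord j) (PolyGrowth.const (delta i j))
    (hasLineDerivAt_coord i j)]
  have := gaussMean_const_mul (delta i j) (fun _ => 1)
  simpa [gaussMean_one] using this

theorem sum_delta_mul (F : Fin 3 → ℝ) (i : Fin 3) : ∑ k, delta i k * F k = F i := by
  simp [delta]

theorem delta_comm (i j : Fin 3) : delta i j = delta j i := by
  simp [delta, eq_comm]

theorem sum_delta_self : ∑ k, delta k k = 3 := by
  simp [delta]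

theorem gaussMean_normSq_mul {F : V3 → ℝ} (hF : PolyGrowth F) :
    gaussMean (fun v => ‖v‖ ^ 2 * F v) = ∑ k, gaussMean (fun v => v k * v k * F v) := by
  rw [← gaussMean_sum]
  · congr 1; ext v; rw [normSq_eq_sum, Finset.sum_mul]
  · exact fun k => ((PolyGrowth.coord k).mul (PolyGrowth.coord k)).mul hF

theorem gaussMean_normSq : gaussMean (fun v => ‖v‖ ^ 2) = 3 := by
  have := gaussMean_normSq_mul (PolyGrowth.const 1)
  simp only [mul_one, gaussMean_coord_coord] at this
  rw [this, sum_delta_self]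

theorem gaussMean_normSq_coord_coord (i j : Fin 3) :
    gaussMean (fun v => ‖v‖ ^ 2 * (v i * v j)) = 5 * delta i j := by
  have e : (fun v : V3 => ‖v‖ ^ 2 * (v i * v j)) = fun v => v i * (‖v‖ ^ 2 * v j) := by
    ext v; ring
  have hP : PolyGrowth fun v => delta i j * ‖v‖ ^ 2 := PolyGrowth.normSq.const_mul _
  have hQ : PolyGrowth fun v => 2 * (v i * v j) :=
    ((PolyGrowth.coord i).mul (PolyGrowth.coord j)).const_mul _
  rw [e, gaussMean_coord_mul i (PolyGrowth.normSq.mul (PolyGrowth.coord j)) (hP.add hQ),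
    gaussMean_add hP hQ, gaussMean_const_mul, gaussMean_const_mul, gaussMean_normSq,
    gaussMean_coord_coord]
  · ring
  · intro v
    convert hasLineDerivAt_mul (hasLineDerivAt_normSq i v) (hasLineDerivAt_coord i j v) using 1
    ring

theorem gaussMean_normSq_sq : gaussMean (fun v => ‖v‖ ^ 2 * ‖v‖ ^ 2) = 15 := by
  rw [gaussMean_normSq_mul PolyGrowth.normSq]
  have : ∀ k : Fin 3, gaussMean (fun v => v k * v k * ‖v‖ ^ 2) = 5 * delta k k := fun k => by
    rw [← gaussMean_normSq_coord_coord]; congr 1; ext v; ring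
  simp_rw [this, ← Finset.mul_sum, sum_delta_self]; norm_num

theorem gaussMean_normSq_sq_coord_coord (i j : Fin 3) :
    gaussMean (fun v => ‖v‖ ^ 2 * ‖v‖ ^ 2 * (v i * v j)) = 35 * delta i j := by
  have e : (fun v : V3 => ‖v‖ ^ 2 * ‖v‖ ^ 2 * (v i * v j)) =
      fun v => v i * (‖v‖ ^ 2 * ‖v‖ ^ 2 * v j) := by
    ext v; ring
  have hP : PolyGrowth fun v => delta i j * (‖v‖ ^ 2 * ‖v‖ ^ 2) :=
    (PolyGrowth.normSq.mul PolyGrowth.normSq).const_mul _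
  have hQ : PolyGrowth fun v => 4 * (‖v‖ ^ 2 * (v i * v j)) :=
    (PolyGrowth.normSq.mul ((PolyGrowth.coord i).mul (PolyGrowth.coord j))).const_mul _
  rw [e, gaussMean_coord_mul i
      ((PolyGrowth.normSq.mul PolyGrowth.normSq).mul (PolyGrowth.coord j)) (hP.add hQ),
    gaussMean_add hP hQ, gaussMean_const_mul, gaussMean_const_mul, gaussMean_normSq_sq,
    gaussMean_normSq_coord_coord]
  · ring
  · intro v
    convert hasLineDerivAt_mul (hasLineDerivAt_mul (hasLineDerivAt_normSq i v)
      (hasLineDerivAt_normSq i v)) (hasLineDerivAt_coord i j v) using 1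
    ring

/-- Wick's formula for the fourth moments. -/
theorem gaussMean_coord4 (i j k l : Fin 3) :
    gaussMean (fun v => v i * v j * (v k * v l)) =
      delta i j * delta k l + delta i k * delta j l + delta i l * delta j k := by
  have e : (fun v : V3 => v i * v j * (v k * v l)) = fun v => v i * (v j * (v k * v l)) := by
    ext v; ring
  have c := PolyGrowth.coord
  have h1 : PolyGrowth fun v => delta i j * (v k * v l) := ((c k).mul (c l)).const_mul _
  have h2 : PolyGrowth fun v => delta i k * (v j * v l) := ((c j).mul (c l)).const_mul _
  have h3 : PolyGrowth fun v => delta i l * (v j * v k) := ((c j).mul (c k)).const_mul _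
  rw [e, gaussMean_coord_mul i ((c j).mul ((c k).mul (c l))) ((h1.add h2).add h3),
    gaussMean_add (h1.add h2) h3, gaussMean_add h1 h2]
  · simp only [gaussMean_const_mul, gaussMean_coord_coord]
  · intro v
    convert hasLineDerivAt_mul (hasLineDerivAt_coord i j v) (hasLineDerivAt_mul
      (hasLineDerivAt_coord i k v) (hasLineDerivAt_coord i l v)) using 1
    ring

/-! ### The collision transformation and the collision measure -/

section

/-- Pairs of velocities together with a direction, `(v, v_*, ω)`. -/
abbrev Coll := V3 × (V3 × S2)

instance : IsFiniteMeasure sigma := by unfold sigma; infer_instance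

instance : sigma.IsOpenPosMeasure := by unfold sigma; infer_instance

/-- The measure `dv dv_* dω`. -/
def baseMeasure : Measure Coll := (volume : Measure V3).prod ((volume : Measure V3).prod sigma)

instance : SFinite baseMeasure := Measure.prod.instSFinite

/-- The measure `b M M_* dv dv_* dω`, in which the collision operators are bounded by
`L²`-norms. -/
def collMeasure (b : ℝ → ℝ → ℝ) : Measure Coll :=
  baseMeasure.withDensity fun p => ENNReal.ofReal (kern b p.1 p.2.1 p.2.2 * (M p.1 * M p.2.1))

/-- The collision `(v, v_*, ω) ↦ (v', v'_*, ω)`. -/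
def coll (p : Coll) : Coll := (post p.1 p.2.1 p.2.2, postStar p.1 p.2.1 p.2.2, p.2.2)

/-- The exchange `(v, v_*, ω) ↦ (v_*, v, ω)` of the two particles. -/
def exch (p : Coll) : Coll := (p.2.1, p.1, p.2.2)

theorem continuous_coll : Continuous coll := by
  unfold coll post postStar; fun_prop

theorem continuous_exch : Continuous exch := by
  unfold exch; fun_prop

theorem inner_S2_self (ω : S2) : ⟪(ω : V3), (ω : V3)⟫ = 1 := by
  rw [real_inner_self_eq_norm_sq]; simp

theorem post_sub_postStar (v w : V3) (ω : S2) :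
    post v w ω - postStar v w ω = (v - w) - (2 * ⟪v - w, (ω : V3)⟫) • (ω : V3) := by
  unfold post postStar; module

theorem inner_post_sub_postStar (v w : V3) (ω : S2) :
    ⟪post v w ω - postStar v w ω, (ω : V3)⟫ = -⟪v - w, (ω : V3)⟫ := by
  rw [post_sub_postStar, inner_sub_left, inner_smul_left, inner_S2_self]
  simp; ring

theorem norm_post_sub_postStar (v w : V3) (ω : S2) :
    ‖post v w ω - postStar v w ω‖ = ‖v - w‖ := by
  have : ‖post v w ω - postStar v w ω‖ ^ 2 = ‖v - w‖ ^ 2 := by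
    rw [post_sub_postStar, norm_sub_sq_real, inner_smul_right, norm_smul]
    simp [mul_pow]; ring
  exact (sq_eq_sq₀ (norm_nonneg _) (norm_nonneg _)).1 this

theorem kern_coll (b : ℝ → ℝ → ℝ) (v w : V3) (ω : S2) :
    kern b (post v w ω) (postStar v w ω) ω = kern b v w ω := by
  unfold kern
  rw [norm_post_sub_postStar, inner_post_sub_postStar, abs_neg]

theorem kern_exch (b : ℝ → ℝ → ℝ) (v w : V3) (ω : S2) : kern b w v ω = kern b v w ω := by
  unfold kern
  rw [norm_sub_rev, ← neg_sub v w, inner_neg_left, abs_neg]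

/-- Conservation of momentum. -/
theorem post_add_postStar (v w : V3) (ω : S2) : post v w ω + postStar v w ω = v + w := by
  unfold post postStar; abel

/-- Conservation of energy. -/
theorem normSq_post_add_normSq_postStar (v w : V3) (ω : S2) :
    ‖post v w ω‖ ^ 2 + ‖postStar v w ω‖ ^ 2 = ‖v‖ ^ 2 + ‖w‖ ^ 2 := by
  unfold post postStar
  rw [norm_sub_sq_real, norm_add_sq_real, inner_smul_right, inner_smul_right, norm_smul]
  rw [inner_sub_left]
  simp; ring

/-- Conservation of energy makes the Maxwellian an equilibrium. -/
theorem M_post_mul_M_postStar (v w : V3) (ω : S2) :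
    M (post v w ω) * M (postStar v w ω) = M v * M w := by
  have key : -‖post v w ω‖ ^ 2 / 2 + -‖postStar v w ω‖ ^ 2 / 2 = -‖v‖ ^ 2 / 2 + -‖w‖ ^ 2 / 2 := by
    linarith [normSq_post_add_normSq_postStar v w ω]
  unfold M
  rw [mul_mul_mul_comm, ← Real.exp_add, mul_mul_mul_comm, ← Real.exp_add, key]

theorem coll_coll (p : Coll) : coll (coll p) = p := by
  obtain ⟨v, w, ω⟩ := p
  have h := inner_post_sub_postStar v w ω
  unfold coll
  ext1
  · change post v w ω - ⟪post v w ω - postStar v w ω, (ω : V3)⟫ • (ω : V3) = v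
    rw [h]; unfold post; module
  · ext1
    · change postStar v w ω + ⟪post v w ω - postStar v w ω, (ω : V3)⟫ • (ω : V3) = w
      rw [h]; unfold postStar; module
    · rfl

theorem exch_exch (p : Coll) : exch (exch p) = p := rfl

theorem coll_exch (p : Coll) : coll (exch p) = exch (coll p) := by
  obtain ⟨v, w, ω⟩ := p
  have h : ⟪w - v, (ω : V3)⟫ = -⟪v - w, (ω : V3)⟫ := by rw [← inner_neg_left, neg_sub]
  unfold coll exch post postStar
  simp only [h]
  ext1
  · simp only; module
  · ext1
    · simp only; module
    · rfl

/-- For a fixed direction, a collision is a linear map of the pair of velocities. -/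
def collLin (ω : S2) : V3 × V3 →ₗ[ℝ] V3 × V3 where
  toFun p := (post p.1 p.2 ω, postStar p.1 p.2 ω)
  map_add' p q := by
    have : p.1 + q.1 - (p.2 + q.2) = (p.1 - p.2) + (q.1 - q.2) := by abel
    ext1 <;> simp only [post, postStar, Prod.fst_add, Prod.snd_add, this, inner_add_left] <;>
      module
  map_smul' c p := by
    have : c • p.1 - c • p.2 = c • (p.1 - p.2) := by rw [smul_sub]
    ext1 <;> simp only [post, postStar, Prod.smul_fst, Prod.smul_snd, this, inner_smul_left,
      RingHom.id_apply] <;> simp <;> module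

theorem collLin_comp_self (ω : S2) : collLin ω ∘ₗ collLin ω = LinearMap.id := by
  ext1 <;> ext1 x
  all_goals
    exact congrArg (fun q : Coll => (q.1, q.2.1)) (coll_coll (_, _, ω))

/-- A linear involution has determinant `±1`, so collisions preserve the Lebesgue measure. -/
theorem measurePreserving_collLin (ω : S2) :
    MeasurePreserving (collLin ω) ((volume : Measure V3).prod volume)
      ((volume : Measure V3).prod volume) := by
  have hdet : LinearMap.det (collLin ω) * LinearMap.det (collLin ω) = 1 := by
    rw [← LinearMap.det_comp, collLin_comp_self, LinearMap.det_id]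
  have hne : LinearMap.det (collLin ω) ≠ 0 := fun h => by simp [h] at hdet
  have habs : |LinearMap.det (collLin ω)| = 1 := by
    rcases mul_self_eq_one_iff.1 hdet with h | h <;> simp [h]
  refine ⟨(collLin ω).continuous_of_finiteDimensional.measurable, ?_⟩
  rw [Measure.map_linearMap_addHaar_eq_smul_addHaar _ hne, abs_inv, habs]
  simp

theorem measurePreserving_coll : MeasurePreserving coll baseMeasure baseMeasure := by
  have hsk : MeasurePreserving
      (fun p : S2 × (V3 × V3) => (id p.1, collLin p.1 p.2))
      (sigma.prod ((volume : Measure V3).prod volume))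
      (sigma.prod ((volume : Measure V3).prod volume)) := by
    refine MeasurePreserving.skew_product (g := fun ω p => collLin ω p) (MeasurePreserving.id sigma)
      ?_ (ae_of_all _ fun ω => (measurePreserving_collLin ω).map_eq)
    have : Continuous (fun p : S2 × (V3 × V3) => collLin p.1 p.2) := by
      change Continuous fun p : S2 × (V3 × V3) => (post p.2.1 p.2.2 p.1, postStar p.2.1 p.2.2 p.1)
      unfold post postStar; fun_prop
    exact this.measurable
  have e1 : MeasurePreserving (Prod.swap : S2 × (V3 × V3) → (V3 × V3) × S2)
      (sigma.prod ((volume : Measure V3).prod volume))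
      (((volume : Measure V3).prod volume).prod sigma) := Measure.measurePreserving_swap
  have e1' : MeasurePreserving (Prod.swap : (V3 × V3) × S2 → S2 × (V3 × V3))
      (((volume : Measure V3).prod volume).prod sigma)
      (sigma.prod ((volume : Measure V3).prod volume)) := Measure.measurePreserving_swap
  have e2 := measurePreserving_prodAssoc (volume : Measure V3) (volume : Measure V3) sigma
  exact (e2.comp e1).comp (hsk.comp (e1'.comp e2.symm))

theorem measurePreserving_exch : MeasurePreserving exch baseMeasure baseMeasure := by
  have e2 := measurePreserving_prodAssoc (volume : Measure V3) (volume : Measure V3) sigma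
  have e : MeasurePreserving (Prod.map (Prod.swap : V3 × V3 → V3 × V3) (id : S2 → S2))
      (((volume : Measure V3).prod volume).prod sigma)
      (((volume : Measure V3).prod volume).prod sigma) :=
    Measure.measurePreserving_swap.prod (MeasurePreserving.id sigma)
  exact e2.comp (e.comp e2.symm)

variable {b : ℝ → ℝ → ℝ}

theorem measurable_kern (hb : IsCutoffKernel b) :
    Measurable fun p : Coll => kern b p.1 p.2.1 p.2.2 := by
  have h : Measurable fun p : Coll => (‖p.1 - p.2.1‖, |⟪p.1 - p.2.1, (p.2.2 : V3)⟫|) := by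
    apply Continuous.measurable; fun_prop
  exact hb.measurable.comp h

theorem kern_nonneg (hb : IsCutoffKernel b) (v w : V3) (ω : S2) : 0 ≤ kern b v w ω :=
  hb.nonneg _ _

theorem measurable_collDensity (hb : IsCutoffKernel b) :
    Measurable fun p : Coll => kern b p.1 p.2.1 p.2.2 * (M p.1 * M p.2.1) :=
  (measurable_kern hb).mul ((measurable_M.comp measurable_fst).mul
    (measurable_M.comp (measurable_fst.comp measurable_snd)))

theorem collDensity_nonneg (hb : IsCutoffKernel b) (p : Coll) :
    0 ≤ kern b p.1 p.2.1 p.2.2 * (M p.1 * M p.2.1) :=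
  mul_nonneg (kern_nonneg hb _ _ _) (mul_nonneg (M_pos _).le (M_pos _).le)

/-- A measure-preserving map that leaves a density invariant preserves the measure with
that density. -/
theorem measurePreserving_withDensity {X : Type*} [MeasurableSpace X] {μ : Measure X} {T : X → X}
    (hT : MeasurePreserving T μ μ) {d : X → ENNReal} (hd : Measurable d) (h : ∀ x, d (T x) = d x) :
    MeasurePreserving T (μ.withDensity d) (μ.withDensity d) := by
  refine ⟨hT.measurable, Measure.ext fun s hs => ?_⟩
  rw [Measure.map_apply hT.measurable hs, withDensity_apply _ (hT.measurable hs),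
    withDensity_apply _ hs, ← hT.setLIntegral_comp_preimage hs hd]
  simp_rw [h]

theorem measurePreserving_coll_collMeasure (hb : IsCutoffKernel b) :
    MeasurePreserving coll (collMeasure b) (collMeasure b) := by
  refine measurePreserving_withDensity measurePreserving_coll
    (measurable_collDensity hb).ennreal_ofReal fun p => ?_
  simp only [coll, kern_coll, M_post_mul_M_postStar]

theorem measurePreserving_exch_collMeasure (hb : IsCutoffKernel b) :
    MeasurePreserving exch (collMeasure b) (collMeasure b) := by
  refine measurePreserving_withDensity measurePreserving_exch
    (measurable_collDensity hb).ennreal_ofReal fun p => ?_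
  simp only [exch]
  rw [kern_exch, mul_comm (M p.2.1)]

/-- The integral over `v_*` and `ω` against `b M_* dω dv_*`. -/
def collAvg (b : ℝ → ℝ → ℝ) (F : Coll → ℝ) (v : V3) : ℝ :=
  ∫ p : V3 × S2, F (v, p) * (kern b v p.1 p.2 * M p.1) ∂(volume.prod sigma)

theorem integrable_collMeasure_iff (hb : IsCutoffKernel b) {F : Coll → ℝ} :
    Integrable F (collMeasure b) ↔
      Integrable (fun p : Coll => F p * (kern b p.1 p.2.1 p.2.2 * (M p.1 * M p.2.1)))
        baseMeasure := by
  unfold collMeasure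
  rw [integrable_withDensity_iff (measurable_collDensity hb).ennreal_ofReal (ae_of_all _ fun _ =>
    ENNReal.ofReal_lt_top)]
  simp_rw [ENNReal.toReal_ofReal (collDensity_nonneg hb _)]

theorem integral_collMeasure_eq (hb : IsCutoffKernel b) (F : Coll → ℝ) :
    ∫ p, F p ∂(collMeasure b) =
      ∫ p, F p * (kern b p.1 p.2.1 p.2.2 * (M p.1 * M p.2.1)) ∂baseMeasure := by
  unfold collMeasure
  rw [integral_withDensity_eq_integral_toReal_smul (measurable_collDensity hb).ennreal_ofReal
    (ae_of_all _ fun _ => ENNReal.ofReal_lt_top)]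
  congr 1; ext p
  rw [ENNReal.toReal_ofReal (collDensity_nonneg hb _), smul_eq_mul, mul_comm]

theorem collAvg_mul_M (F : Coll → ℝ) (v : V3) :
    ∫ p : V3 × S2, F (v, p) * (kern b v p.1 p.2 * (M v * M p.1)) ∂(volume.prod sigma) =
      collAvg b F v * M v := by
  unfold collAvg
  rw [← integral_mul_const]
  congr 1; ext p; ring

theorem integral_collMeasure (hb : IsCutoffKernel b) {F : Coll → ℝ}
    (hF : Integrable F (collMeasure b)) :
    ∫ p, F p ∂(collMeasure b) = ∫ v, collAvg b F v * M v := by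
  rw [integral_collMeasure_eq hb]
  unfold baseMeasure
  rw [integral_prod _ ((integrable_collMeasure_iff hb).1 hF)]
  simp_rw [← collAvg_mul_M]

theorem integrable_collAvg (hb : IsCutoffKernel b) {F : Coll → ℝ}
    (hF : Integrable F (collMeasure b)) : Integrable fun v => collAvg b F v * M v := by
  have := Integrable.integral_prod_left ((integrable_collMeasure_iff hb).1 hF)
  refine this.congr (ae_of_all _ fun v => ?_)
  exact collAvg_mul_M F v

theorem ae_integrable_collAvg (hb : IsCutoffKernel b) {F : Coll → ℝ}
    (hF : Integrable F (collMeasure b)) :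
    ∀ᵐ v : V3, Integrable (fun p : V3 × S2 => F (v, p) * (kern b v p.1 p.2 * M p.1))
      (volume.prod sigma) := by
  filter_upwards [((integrable_collMeasure_iff hb).1 hF).prod_right_ae] with v hv
  refine (hv.mul_const (M v)⁻¹).congr (ae_of_all _ fun p => ?_)
  have := (M_pos v).ne'
  field_simp

theorem integral_abs_collAvg_le (hb : IsCutoffKernel b) {F : Coll → ℝ}
    (hF : Integrable F (collMeasure b)) :
    ∫ v, |collAvg b F v * M v| ≤ ∫ p, |F p| ∂(collMeasure b) := by
  rw [integral_collMeasure hb hF.abs]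
  refine integral_mono (integrable_collAvg hb hF).abs (integrable_collAvg hb hF.abs) fun v => ?_
  simp only
  rw [abs_mul, abs_of_pos (M_pos v)]
  refine mul_le_mul_of_nonneg_right ?_ (M_pos v).le
  unfold collAvg
  refine abs_integral_le_integral_abs.trans_eq ?_
  congr 1; ext p
  rw [abs_mul, abs_of_nonneg (mul_nonneg (kern_nonneg hb _ _ _) (M_pos _).le)]

theorem measurable_freq (hb : IsCutoffKernel b) : Measurable (freq b) := by
  have h : StronglyMeasurable fun p : V3 × (V3 × S2) => kern b p.1 p.2.1 p.2.2 * M p.2.1 :=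
    ((measurable_kern hb).mul (measurable_M.comp (measurable_fst.comp
      measurable_snd))).stronglyMeasurable
  exact (StronglyMeasurable.integral_prod_right' h).measurable

theorem freq_nonneg (hb : IsCutoffKernel b) (v : V3) : 0 ≤ freq b v :=
  integral_nonneg fun _ => mul_nonneg (kern_nonneg hb _ _ _) (M_pos _).le

theorem polyGrowth_freq (hb : IsCutoffKernel b) : PolyGrowth (freq b) := by
  obtain ⟨C, m, h⟩ := hb.growth
  exact ⟨measurable_freq hb, C, m, fun v => by rw [abs_of_nonneg (freq_nonneg hb v)]; exact h v⟩

theorem PolyGrowth.inDomain (hb : IsCutoffKernel b) {F : V3 → ℝ} (hF : PolyGrowth F) :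
    InDomain b F :=
  ⟨hF.measurable, ((((PolyGrowth.const 1).add (polyGrowth_freq hb)).mul (hF.pow 2))).integrable_mul_M⟩

theorem collAvg_fst (F : V3 → ℝ) (v : V3) : collAvg b (fun p => F p.1) v = freq b v * F v := by
  unfold collAvg freq
  simp only
  rw [integral_const_mul, mul_comm]

/-- A function of `v` alone is integrable for the collision measure as soon as it is integrable
against `a M dv`. -/
theorem integrable_collMeasure_fst (hb : IsCutoffKernel b) {F : V3 → ℝ} (hFm : Measurable F)
    (hF : Integrable fun v => freq b v * F v * M v) :
    Integrable (fun p : Coll => F p.1) (collMeasure b) := by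
  rw [integrable_collMeasure_iff hb]
  unfold baseMeasure
  have hm : AEStronglyMeasurable
      (fun p : Coll => F p.1 * (kern b p.1 p.2.1 p.2.2 * (M p.1 * M p.2.1)))
      ((volume : Measure V3).prod ((volume : Measure V3).prod sigma)) :=
    ((hFm.comp measurable_fst).mul (measurable_collDensity hb)).aestronglyMeasurable
  rw [integrable_prod_iff hm]
  constructor
  · refine ae_of_all _ fun v => ?_
    refine ((hb.integrable v).mul_const (F v * M v)).congr (ae_of_all _ fun p => ?_)
    simp only; ring
  · refine hF.abs.congr (ae_of_all _ fun v => ?_)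
    simp only
    rw [mul_assoc, abs_mul, abs_of_nonneg (freq_nonneg hb v)]
    unfold freq
    rw [← integral_mul_const]
    congr 1; ext p
    rw [Real.norm_eq_abs, abs_mul, abs_mul (F v), abs_of_nonneg (collDensity_nonneg hb (v, p)),
      abs_of_pos (M_pos v)]
    simp only; ring

theorem integral_collMeasure_fst (hb : IsCutoffKernel b) {F : V3 → ℝ} (hFm : Measurable F)
    (hF : Integrable fun v => freq b v * F v * M v) :
    ∫ p : Coll, F p.1 ∂(collMeasure b) = ∫ v, freq b v * F v * M v := by
  rw [integral_collMeasure hb (integrable_collMeasure_fst hb hFm hF)]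
  simp_rw [collAvg_fst]

/-! ### Square integrability with respect to the collision measure -/

theorem InDomain.integrable_freq (hb : IsCutoffKernel b) {h : V3 → ℝ} (hh : InDomain b h) :
    Integrable fun v => freq b v * h v ^ 2 * M v := by
  refine hh.2.mono' (((measurable_freq hb).mul (hh.1.pow_const 2)).mul
    measurable_M).aestronglyMeasurable (ae_of_all _ fun v => ?_)
  have h1 := freq_nonneg hb v
  have h2 := (M_pos v).le
  rw [Real.norm_eq_abs, abs_of_nonneg (by positivity)]
  have : 0 ≤ h v ^ 2 * M v := by positivity
  nlinarith

theorem InDomain.integrable_sq (hb : IsCutoffKernel b) {h : V3 → ℝ} (hh : InDomain b h) :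
    Integrable fun v => h v ^ 2 * M v := by
  refine (hh.2.sub (hh.integrable_freq hb)).congr (ae_of_all _ fun v => ?_)
  simp only [Pi.sub_apply]; ring

theorem InDomain.memLp (hb : IsCutoffKernel b) {h : V3 → ℝ} (hh : InDomain b h) :
    MemLp (fun p : Coll => h p.1) 2 (collMeasure b) := by
  have hm : AEStronglyMeasurable (fun p : Coll => h p.1) (collMeasure b) :=
    (hh.1.comp measurable_fst).aestronglyMeasurable
  rw [memLp_two_iff_integrable_sq hm]
  exact integrable_collMeasure_fst hb (F := fun v => h v ^ 2) (hh.1.pow_const 2)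
    (hh.integrable_freq hb)

theorem memLp_comp_exch (hb : IsCutoffKernel b) {F : Coll → ℝ} {q : ENNReal}
    (hF : MemLp F q (collMeasure b)) : MemLp (fun p => F (exch p)) q (collMeasure b) :=
  hF.comp_measurePreserving (measurePreserving_exch_collMeasure hb)

theorem memLp_comp_coll (hb : IsCutoffKernel b) {F : Coll → ℝ} {q : ENNReal}
    (hF : MemLp F q (collMeasure b)) : MemLp (fun p => F (coll p)) q (collMeasure b) :=
  hF.comp_measurePreserving (measurePreserving_coll_collMeasure hb)

theorem measurableEmbedding_coll : MeasurableEmbedding coll :=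
  (MeasurableEquiv.ofInvolutive coll coll_coll continuous_coll.measurable).measurableEmbedding

theorem measurableEmbedding_exch : MeasurableEmbedding exch :=
  (MeasurableEquiv.ofInvolutive exch exch_exch continuous_exch.measurable).measurableEmbedding

theorem integral_comp_coll (hb : IsCutoffKernel b) (F : Coll → ℝ) :
    ∫ p, F (coll p) ∂(collMeasure b) = ∫ p, F p ∂(collMeasure b) :=
  (measurePreserving_coll_collMeasure hb).integral_comp measurableEmbedding_coll F

theorem integral_comp_exch (hb : IsCutoffKernel b) (F : Coll → ℝ) :
    ∫ p, F (exch p) ∂(collMeasure b) = ∫ p, F p ∂(collMeasure b) :=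
  (measurePreserving_exch_collMeasure hb).integral_comp measurableEmbedding_exch F

theorem integrable_comp_coll (hb : IsCutoffKernel b) {F : Coll → ℝ}
    (hF : Integrable F (collMeasure b)) : Integrable (fun p => F (coll p)) (collMeasure b) :=
  (measurePreserving_coll_collMeasure hb).integrable_comp_of_integrable hF

theorem integrable_comp_exch (hb : IsCutoffKernel b) {F : Coll → ℝ}
    (hF : Integrable F (collMeasure b)) : Integrable (fun p => F (exch p)) (collMeasure b) :=
  (measurePreserving_exch_collMeasure hb).integrable_comp_of_integrable hF

end

/-! ### The linearized and the quadratic collision operators -/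

section

variable {b : ℝ → ℝ → ℝ}

theorem isFiniteMeasure_collMeasure (hb : IsCutoffKernel b) : IsFiniteMeasure (collMeasure b) := by
  have h := integrable_collMeasure_fst hb (F := fun _ => 1) measurable_const
    (((polyGrowth_freq hb).mul (PolyGrowth.const 1)).integrable_mul_M)
  exact (integrable_const_iff_isFiniteMeasure one_ne_zero).1 h

/-- The collision defect `h + h_* - h' - h'_*`. -/
def defect (h : V3 → ℝ) (p : Coll) : ℝ :=
  h p.1 + h (exch p).1 - h (coll p).1 - h (coll (exch p)).1

/-- The quadratic collision defect `h' h'_* - h h_*`. -/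
def quadDefect (h : V3 → ℝ) (p : Coll) : ℝ :=
  h (coll p).1 * h (coll (exch p)).1 - h p.1 * h (exch p).1

theorem coll_exch_fst (p : Coll) : (coll (exch p)).1 = postStar p.1 p.2.1 p.2.2 := by
  rw [coll_exch]; rfl

theorem defect_exch (h : V3 → ℝ) (p : Coll) : defect h (exch p) = defect h p := by
  unfold defect; rw [exch_exch]; ring

theorem defect_coll (h : V3 → ℝ) (p : Coll) : defect h (coll p) = -defect h p := by
  unfold defect; rw [← coll_exch, coll_coll, coll_coll]; ring

theorem defect_add (h k : V3 → ℝ) : defect (fun v => h v + k v) = defect h + defect k := by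
  ext p; simp only [defect, Pi.add_apply]; ring

theorem defect_const_mul (c : ℝ) (h : V3 → ℝ) : defect (fun v => c * h v) = c • defect h := by
  ext p; simp only [defect, Pi.smul_apply, smul_eq_mul]; ring

/-- If `k` is a collision invariant then `k' k'_* - k k_*` is half the defect of `k²`. -/
theorem quadDefect_of_defect_eq_zero {k : V3 → ℝ} (hk : ∀ p, defect k p = 0) (p : Coll) :
    quadDefect k p = 1 / 2 * defect (fun v => k v ^ 2) p := by
  have h := hk p
  unfold defect at h ⊢
  unfold quadDefect
  linear_combination (-(1 / 2)) *
    (k p.1 + k (exch p).1 + k (coll p).1 + k (coll (exch p)).1) * h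

theorem InDomain.memLp_defect (hb : IsCutoffKernel b) {h : V3 → ℝ} (hh : InDomain b h) :
    MemLp (defect h) 2 (collMeasure b) := by
  have h0 := hh.memLp hb
  have h1 := memLp_comp_exch hb h0
  have h2 := memLp_comp_coll hb h0
  have h3 := memLp_comp_exch hb h2
  exact ((h0.add h1).sub h2).sub h3

theorem integrable_mul_of_memLp {X : Type*} [MeasurableSpace X] {μ : Measure X} {F G : X → ℝ}
    (hF : MemLp F 2 μ) (hG : MemLp G 2 μ) : Integrable (fun x => F x * G x) μ :=
  hF.integrable_mul hG

theorem InDomain.integrable_fst (hb : IsCutoffKernel b) {h : V3 → ℝ} (hh : InDomain b h) :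
    Integrable (fun p : Coll => h p.1) (collMeasure b) := by
  have := isFiniteMeasure_collMeasure hb
  exact (hh.memLp hb).integrable (by norm_num)

/-- `L h = ∫∫ (h + h_* - h' - h'_*) b M_* dω dv_*`. -/
theorem InDomain.L_eq (hb : IsCutoffKernel b) {h : V3 → ℝ} (hh : InDomain b h) :
    L b h =ᵐ[volume] collAvg b (defect h) := by
  have h0 := hh.integrable_fst hb
  have h1 := integrable_comp_exch hb h0
  have h2 := integrable_comp_coll hb h0
  have h3 := integrable_comp_exch hb h2
  filter_upwards [ae_integrable_collAvg hb h0, ae_integrable_collAvg hb h1,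
    ae_integrable_collAvg hb h2, ae_integrable_collAvg hb h3] with v i0 i1 i2 i3
  have hM := (M_pos v).ne'
  have e1 : Q b M (fun w => h w * M w) v = M v * ∫ p : V3 × S2,
      (h (coll (exch (v, p))).1 * (kern b v p.1 p.2 * M p.1) -
        h (exch (v, p)).1 * (kern b v p.1 p.2 * M p.1)) ∂(volume.prod sigma) := by
    unfold Q
    rw [← integral_const_mul]
    congr 1; ext p
    have := M_post_mul_M_postStar v p.1 p.2
    simp only [coll_exch_fst]
    simp only [exch]
    linear_combination h (postStar v p.1 p.2) * kern b v p.1 p.2 * this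
  have e2 : Q b (fun w => h w * M w) M v = M v * ∫ p : V3 × S2,
      (h (coll (v, p)).1 * (kern b v p.1 p.2 * M p.1) -
        h (v, p).1 * (kern b v p.1 p.2 * M p.1)) ∂(volume.prod sigma) := by
    unfold Q
    rw [← integral_const_mul]
    congr 1; ext p
    have := M_post_mul_M_postStar v p.1 p.2
    simp only [coll]
    linear_combination h (post v p.1 p.2) * kern b v p.1 p.2 * this
  have i31 : Integrable (fun p : V3 × S2 =>
      h (coll (exch (v, p))).1 * (kern b v p.1 p.2 * M p.1) -
        h (exch (v, p)).1 * (kern b v p.1 p.2 * M p.1)) (volume.prod sigma) := i3.sub i1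
  have i20 : Integrable (fun p : V3 × S2 => h (coll (v, p)).1 * (kern b v p.1 p.2 * M p.1) -
      h (v, p).1 * (kern b v p.1 p.2 * M p.1)) (volume.prod sigma) := i2.sub i0
  unfold L
  rw [e1, e2, ← mul_add, ← integral_add i31 i20, ← mul_assoc, neg_mul,
    one_div_mul_cancel hM, neg_one_mul, ← integral_neg]
  unfold collAvg
  congr 1; ext p
  simp only [defect]; ring

/-- `Γ(h,h) = ∫∫ (h' h'_* - h h_*) b M_* dω dv_*`. -/
theorem Gam_eq (h : V3 → ℝ) (v : V3) : Gam b h v = collAvg b (quadDefect h) v := by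
  have hM := (M_pos v).ne'
  unfold Gam Q collAvg
  rw [← integral_const_mul]
  congr 1; ext p
  have := M_post_mul_M_postStar v p.1 p.2
  simp only [quadDefect, coll_exch_fst]
  simp only [coll, exch]
  field_simp
  linear_combination h (post v p.1 p.2) * h (postStar v p.1 p.2) * kern b v p.1 p.2 * this

theorem InDomain.integrable_quadDefect (hb : IsCutoffKernel b) {h : V3 → ℝ} (hh : InDomain b h) :
    Integrable (quadDefect h) (collMeasure b) := by
  have h0 := hh.memLp hb
  have h2 := memLp_comp_coll hb h0
  have i1 := integrable_mul_of_memLp h2 (memLp_comp_exch hb h2)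
  have i2 := integrable_mul_of_memLp h0 (memLp_comp_exch hb h0)
  exact i1.sub i2

/-- The collision operator at `M + e h M`. -/
theorem InDomain.Q_eq (hb : IsCutoffKernel b) {h f : V3 → ℝ} (hh : InDomain b h) {e : ℝ}
    (hf : ∀ v, f v = M v + e * h v * M v) :
    ∀ᵐ v, Q b f f v = e * (M v * (-L b h v + e * Gam b h v)) := by
  have hd : Integrable (defect h) (collMeasure b) := by
    have := isFiniteMeasure_collMeasure hb
    exact (hh.memLp_defect hb).integrable (by norm_num)
  filter_upwards [hh.L_eq hb, ae_integrable_collAvg hb hd,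
    ae_integrable_collAvg hb (hh.integrable_quadDefect hb)] with v hL i1 i2
  rw [hL, Gam_eq]
  unfold collAvg Q
  rw [← integral_neg, ← integral_const_mul, ← integral_add i1.fun_neg (i2.const_mul e),
    ← integral_const_mul, ← integral_const_mul]
  congr 1; ext p
  have := M_post_mul_M_postStar v p.1 p.2
  simp only [hf, defect, quadDefect, coll_exch_fst]
  simp only [coll, exch]
  linear_combination (1 + e * h (post v p.1 p.2)) * (1 + e * h (postStar v p.1 p.2)) *
    kern b v p.1 p.2 * this

theorem InDomain.integrable_defect_mul (hb : IsCutoffKernel b) {h k : V3 → ℝ}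
    (hh : InDomain b h) (hk : InDomain b k) :
    Integrable (fun p => defect h p * k p.1) (collMeasure b) :=
  integrable_mul_of_memLp (hh.memLp_defect hb) (hk.memLp hb)

theorem collAvg_mul_fst (F : Coll → ℝ) (k : V3 → ℝ) (v : V3) :
    collAvg b (fun p => F p * k p.1) v = collAvg b F v * k v := by
  unfold collAvg
  rw [← integral_mul_const]
  congr 1; ext p; simp only; ring

theorem InDomain.integrable_L_mul (hb : IsCutoffKernel b) {h k : V3 → ℝ}
    (hh : InDomain b h) (hk : InDomain b k) : Integrable fun v => L b h v * k v * M v := by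
  refine (integrable_collAvg hb (hh.integrable_defect_mul hb hk)).congr ?_
  filter_upwards [hh.L_eq hb] with v hv
  rw [collAvg_mul_fst, hv]

theorem InDomain.pairM_L_eq (hb : IsCutoffKernel b) {h k : V3 → ℝ}
    (hh : InDomain b h) (hk : InDomain b k) :
    pairM (L b h) k = ∫ p, defect h p * k p.1 ∂(collMeasure b) := by
  rw [integral_collMeasure hb (hh.integrable_defect_mul hb hk)]
  unfold pairM
  refine integral_congr_ae ?_
  filter_upwards [hh.L_eq hb] with v hv
  rw [collAvg_mul_fst, hv]

theorem integral_add_four {X : Type*} [MeasurableSpace X] {μ : Measure X} {f₀ f₁ f₂ f₃ : X → ℝ}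
    (h₀ : Integrable f₀ μ) (h₁ : Integrable f₁ μ) (h₂ : Integrable f₂ μ) (h₃ : Integrable f₃ μ) :
    ∫ x, f₀ x + f₁ x + f₂ x + f₃ x ∂μ =
      ∫ x, f₀ x ∂μ + ∫ x, f₁ x ∂μ + ∫ x, f₂ x ∂μ + ∫ x, f₃ x ∂μ := by
  rw [integral_add ((h₀.fun_add h₁).fun_add h₂) h₃, integral_add (h₀.fun_add h₁) h₂,
    integral_add h₀ h₁]

/-- The symmetric form of `⟨L h, k⟩`. -/
theorem InDomain.pairM_L (hb : IsCutoffKernel b) {h k : V3 → ℝ}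
    (hh : InDomain b h) (hk : InDomain b k) :
    pairM (L b h) k = 1 / 4 * ∫ p, defect h p * defect k p ∂(collMeasure b) := by
  have i0 := hh.integrable_defect_mul hb hk
  have i1 := integrable_comp_exch hb i0
  have i2 := integrable_comp_coll hb i0
  have i3 := integrable_comp_exch hb i2
  have e1 := integral_comp_exch hb fun p => defect h p * k p.1
  have e2 := integral_comp_coll hb fun p => defect h p * k p.1
  have e3 := integral_comp_exch hb fun p => defect h (coll p) * k (coll p).1
  rw [e2] at e3
  have : ∫ p, defect h p * defect k p ∂(collMeasure b) =
      4 * ∫ p, defect h p * k p.1 ∂(collMeasure b) := by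
    have : ∀ p, defect h p * defect k p = defect h p * k p.1 + defect h (exch p) * k (exch p).1 +
        defect h (coll p) * k (coll p).1 + defect h (coll (exch p)) * k (coll (exch p)).1 := by
      intro p
      simp only [defect_exch, defect_coll]
      rw [show defect k p = k p.1 + k (exch p).1 - k (coll p).1 - k (coll (exch p)).1 from rfl]
      ring
    simp_rw [this]
    rw [integral_add_four i0 i1 i2 i3, e1, e2, e3]
    ring
  rw [this, hh.pairM_L_eq hb hk]; ring

theorem pairM_comm (h k : V3 → ℝ) : pairM h k = pairM k h := by
  unfold pairM; congr 1; ext v; ring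

/-- `L` is symmetric. -/
theorem InDomain.pairM_L_comm (hb : IsCutoffKernel b) {h k : V3 → ℝ}
    (hh : InDomain b h) (hk : InDomain b k) : pairM (L b h) k = pairM h (L b k) := by
  rw [hh.pairM_L hb hk, pairM_comm h, hk.pairM_L hb hh]
  congr 2; ext p; ring

theorem pairM_congr_left {h h' : V3 → ℝ} (e : h =ᵐ[volume] h') (k : V3 → ℝ) :
    pairM h k = pairM h' k := by
  unfold pairM
  refine integral_congr_ae ?_
  filter_upwards [e] with v hv
  rw [hv]

theorem pairM_congr_right {k k' : V3 → ℝ} (e : k =ᵐ[volume] k') (h : V3 → ℝ) :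
    pairM h k = pairM h k' := by
  rw [pairM_comm, pairM_congr_left e, pairM_comm]

/-- Functions in the kernel of `L` are collision invariants, almost everywhere with respect to
the collision measure. -/
theorem InKer.defect_eq_zero (hb : IsCutoffKernel b) {h : V3 → ℝ} (hh : InKer b h) :
    defect h =ᵐ[collMeasure b] 0 := by
  have h1 : pairM (L b h) h = 0 := by
    rw [pairM_congr_left hh.2]; simp [pairM]
  rw [hh.1.pairM_L hb hh.1] at h1
  have h2 : ∫ p, defect h p * defect h p ∂(collMeasure b) = 0 := by linarith
  have h3 := (integral_eq_zero_iff_of_nonneg (fun p => mul_self_nonneg (defect h p))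
    (integrable_mul_of_memLp (hh.1.memLp_defect hb) (hh.1.memLp_defect hb))).1 h2
  filter_upwards [h3] with p hp
  exact mul_self_eq_zero.1 hp

theorem InDomain.pairM_L_eq_zero (hb : IsCutoffKernel b) {h k : V3 → ℝ}
    (hh : InDomain b h) (hk : InDomain b k) (hk0 : ∀ p, defect k p = 0) :
    pairM (L b h) k = 0 := by
  rw [hh.pairM_L hb hk]; simp [hk0]

theorem InDomain.inKer (hb : IsCutoffKernel b) {k : V3 → ℝ}
    (hk : InDomain b k) (hk0 : ∀ p, defect k p = 0) : InKer b k := by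
  refine ⟨hk, ?_⟩
  filter_upwards [hk.L_eq hb] with v hv
  rw [hv]; simp [collAvg, hk0]

theorem InDomain.add (hb : IsCutoffKernel b) {h k : V3 → ℝ} (hh : InDomain b h)
    (hk : InDomain b k) : InDomain b fun v => h v + k v := by
  refine ⟨hh.1.add hk.1, ?_⟩
  refine ((hh.2.const_mul 2).add (hk.2.const_mul 2)).mono'
    (((measurable_const.add (measurable_freq hb)).mul
      ((hh.1.add hk.1).pow_const 2)).mul measurable_M).aestronglyMeasurable
    (ae_of_all _ fun v => ?_)
  have h1 := freq_nonneg hb v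
  have h2 := (M_pos v).le
  rw [Real.norm_eq_abs, abs_of_nonneg (by positivity)]
  have : 0 ≤ (1 + freq b v) * M v * (h v - k v) ^ 2 := by positivity
  simp only [Pi.add_apply]
  nlinarith

theorem InDomain.const_mul (c : ℝ) {h : V3 → ℝ} (hh : InDomain b h) :
    InDomain b fun v => c * h v := by
  refine ⟨hh.1.const_mul c, (hh.2.const_mul (c ^ 2)).congr (ae_of_all _ fun v => ?_)⟩
  simp only; ring

theorem InDomain.L_add (hb : IsCutoffKernel b) {h k : V3 → ℝ} (hh : InDomain b h)
    (hk : InDomain b k) :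
    L b (fun v => h v + k v) =ᵐ[volume] fun v => L b h v + L b k v := by
  have := isFiniteMeasure_collMeasure hb
  filter_upwards [(hh.add hb hk).L_eq hb, hh.L_eq hb, hk.L_eq hb,
    ae_integrable_collAvg hb ((hh.memLp_defect hb).integrable (by norm_num)),
    ae_integrable_collAvg hb ((hk.memLp_defect hb).integrable (by norm_num))] with v e e1 e2 i1 i2
  rw [e, e1, e2]
  unfold collAvg
  rw [← integral_add i1 i2, defect_add]
  congr 1; ext p; simp only [Pi.add_apply]; ring

theorem InDomain.L_const_mul (hb : IsCutoffKernel b) (c : ℝ) {h : V3 → ℝ} (hh : InDomain b h) :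
    L b (fun v => c * h v) =ᵐ[volume] fun v => c * L b h v := by
  filter_upwards [(hh.const_mul c).L_eq hb, hh.L_eq hb] with v e e1
  rw [e, e1]
  unfold collAvg
  rw [← integral_const_mul, defect_const_mul]
  congr 1; ext p; simp only [Pi.smul_apply, smul_eq_mul]; ring

theorem integrable_mul_of_sq {h k : V3 → ℝ} (hhm : Measurable h) (hkm : Measurable k)
    (hh : Integrable fun v => h v ^ 2 * M v) (hk : Integrable fun v => k v ^ 2 * M v) :
    Integrable fun v => h v * k v * M v := by
  refine (hh.add hk).mono' ((hhm.mul hkm).mul measurable_M).aestronglyMeasurable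
    (ae_of_all _ fun v => ?_)
  have h2 := (M_pos v).le
  rw [Real.norm_eq_abs, abs_mul, abs_of_pos (M_pos v)]
  simp only [Pi.add_apply]
  rw [← add_mul]
  refine mul_le_mul_of_nonneg_right ?_ h2
  rw [abs_mul]
  nlinarith [sq_nonneg (|h v| - |k v|), sq_abs (h v), sq_abs (k v), sq_nonneg (|h v| + |k v|)]

theorem InDomain.integrable_mul (hb : IsCutoffKernel b) {h k : V3 → ℝ} (hh : InDomain b h)
    (hk : InDomain b k) : Integrable fun v => h v * k v * M v :=
  integrable_mul_of_sq hh.1 hk.1 (hh.integrable_sq hb) (hk.integrable_sq hb)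

theorem InDomain.pairM_add_left (hb : IsCutoffKernel b) {h h' k : V3 → ℝ} (hh : InDomain b h)
    (hh' : InDomain b h') (hk : InDomain b k) :
    pairM (fun v => h v + h' v) k = pairM h k + pairM h' k := by
  unfold pairM
  rw [← integral_add (hh.integrable_mul hb hk) (hh'.integrable_mul hb hk)]
  simp_rw [add_mul]

theorem InDomain.pairM_add_right (hb : IsCutoffKernel b) {h k k' : V3 → ℝ} (hh : InDomain b h)
    (hk : InDomain b k) (hk' : InDomain b k') :
    pairM h (fun v => k v + k' v) = pairM h k + pairM h k' := by
  rw [pairM_comm, hk.pairM_add_left hb hk' hh, pairM_comm k, pairM_comm k']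

theorem pairM_const_mul_left (c : ℝ) (h k : V3 → ℝ) :
    pairM (fun v => c * h v) k = c * pairM h k := by
  unfold pairM
  rw [← integral_const_mul]
  simp_rw [mul_assoc]

theorem pairM_const_mul_right (c : ℝ) (h k : V3 → ℝ) :
    pairM h (fun v => c * k v) = c * pairM h k := by
  rw [pairM_comm, pairM_const_mul_left, pairM_comm]

/-- Solutions of `L h = f` in `Ker^⊥ L` are unique. -/
theorem InKerPerp.eq_of_L_eq (hb : IsCutoffKernel b) {h k : V3 → ℝ} (hh : InKerPerp b h)
    (hk : InKerPerp b k) (e : L b h =ᵐ[volume] L b k) : h =ᵐ[volume] k := by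
  have hd : InDomain b fun v => h v + -1 * k v := hh.1.add hb (hk.1.const_mul (-1))
  have hker : InKer b fun v => h v + -1 * k v := by
    refine ⟨hd, ?_⟩
    filter_upwards [hh.1.L_add hb (hk.1.const_mul (-1)), hk.1.L_const_mul hb (-1), e] with v e1 e2 e3
    rw [e1, e2, e3]; simp
  have h0 : pairM (fun v => h v + -1 * k v) (fun v => h v + -1 * k v) = 0 := by
    rw [hh.1.pairM_add_left hb (hk.1.const_mul (-1)) hd, pairM_const_mul_left, hh.2 _ hker,
      hk.2 _ hker]
    ring
  have h1 := (integral_eq_zero_iff_of_nonneg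
    (fun v => mul_nonneg (mul_self_nonneg (h v + -1 * k v)) (M_pos v).le)
    (hd.integrable_mul hb hd)).1 h0
  filter_upwards [h1] with v hv
  have := (mul_eq_zero.1 hv).resolve_right (M_pos v).ne'
  have := mul_self_eq_zero.1 this
  linarith

theorem collAvg_congr (hb : IsCutoffKernel b) {F G : Coll → ℝ} (e : F =ᵐ[collMeasure b] G) :
    collAvg b F =ᵐ[volume] collAvg b G := by
  have h1 : ∀ᵐ p ∂baseMeasure,
      ENNReal.ofReal (kern b p.1 p.2.1 p.2.2 * (M p.1 * M p.2.1)) ≠ 0 → F p = G p :=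
    (ae_withDensity_iff (measurable_collDensity hb).ennreal_ofReal).1 e
  filter_upwards [Measure.ae_ae_of_ae_prod h1] with v hv
  refine integral_congr_ae ?_
  filter_upwards [hv] with p hp
  by_cases hk : kern b v p.1 p.2 = 0
  · simp [hk]
  · rw [hp]
    rw [Ne, ENNReal.ofReal_eq_zero, not_le]
    exact mul_pos (lt_of_le_of_ne (kern_nonneg hb _ _ _) (Ne.symm hk))
      (mul_pos (M_pos _) (M_pos _))

theorem ae_collMeasure_fst {P : V3 → Prop} (h : ∀ᵐ v, P v) : ∀ᵐ p ∂(collMeasure b), P p.1 := by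
  have h1 : ∀ᵐ p ∂baseMeasure, P p.1 := Measure.quasiMeasurePreserving_fst.ae h
  exact (withDensity_absolutelyContinuous _ _).ae_le h1

theorem quadDefect_congr (hb : IsCutoffKernel b) {h k : V3 → ℝ} (e : h =ᵐ[volume] k) :
    quadDefect h =ᵐ[collMeasure b] quadDefect k := by
  have h0 : ∀ᵐ p ∂(collMeasure b), h p.1 = k p.1 := ae_collMeasure_fst e
  have hc := (measurePreserving_coll_collMeasure hb).quasiMeasurePreserving
  have hx := (measurePreserving_exch_collMeasure hb).quasiMeasurePreserving
  filter_upwards [h0, hx.ae h0, hc.ae h0, hx.ae (hc.ae h0)] with p e0 e1 e2 e3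
  unfold quadDefect
  rw [e0, e1, e2, e3]

/-- If `h` agrees almost everywhere with a collision invariant `k`, then
`Γ(h,h) = L(k²) / 2`. -/
theorem Gam_of_collisionInvariant (hb : IsCutoffKernel b) {h k : V3 → ℝ} (e : h =ᵐ[volume] k)
    (hk : PolyGrowth k) (hk0 : ∀ p, defect k p = 0) :
    Gam b h =ᵐ[volume] fun v => 1 / 2 * L b (fun w => k w ^ 2) v := by
  have hd : InDomain b (fun w => k w ^ 2) := (hk.pow 2).inDomain hb
  filter_upwards [collAvg_congr hb (quadDefect_congr hb e), hd.L_eq hb] with v e1 e2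
  rw [Gam_eq, e1, e2]
  unfold collAvg
  rw [← integral_const_mul]
  congr 1; ext p
  rw [quadDefect_of_defect_eq_zero hk0]; ring

/-! ### Collision invariants -/

theorem defect_one (p : Coll) : defect (fun _ => 1) p = 0 := by simp [defect]

theorem defect_coord (i : Fin 3) (p : Coll) : defect (fun v => v i) p = 0 := by
  have := congrArg (fun v : V3 => v i) (post_add_postStar p.1 p.2.1 p.2.2)
  simp only [PiLp.add_apply] at this
  simp only [defect, coll_exch_fst]
  simp only [coll, exch]
  linarith

theorem defect_normSq (p : Coll) : defect (fun v => ‖v‖ ^ 2) p = 0 := by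
  have := normSq_post_add_normSq_postStar p.1 p.2.1 p.2.2
  simp only [defect, coll_exch_fst]
  simp only [coll, exch]
  linarith

/-! ### Quantitative bounds -/

theorem defect_mul_le (h k : V3 → ℝ) (p : Coll) :
    |defect h p * k p.1| ≤ 2 * (h p.1 ^ 2 + h (exch p).1 ^ 2 + h (coll p).1 ^ 2 +
      h (coll (exch p)).1 ^ 2) + 1 / 2 * k p.1 ^ 2 := by
  have h1 : (defect h p) ^ 2 ≤ 4 * (h p.1 ^ 2 + h (exch p).1 ^ 2 + h (coll p).1 ^ 2 +
      h (coll (exch p)).1 ^ 2) := by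
    unfold defect
    nlinarith [sq_nonneg (h p.1 - h (exch p).1), sq_nonneg (h p.1 + h (coll p).1),
      sq_nonneg (h p.1 + h (coll (exch p)).1), sq_nonneg (h (exch p).1 + h (coll p).1),
      sq_nonneg (h (exch p).1 + h (coll (exch p)).1),
      sq_nonneg (h (coll p).1 - h (coll (exch p)).1)]
  have h2 : |defect h p * k p.1| ≤ 1 / 2 * (defect h p) ^ 2 + 1 / 2 * k p.1 ^ 2 := by
    rw [abs_mul]
    nlinarith [sq_nonneg (|defect h p| - |k p.1|), sq_abs (defect h p), sq_abs (k p.1)]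
  linarith

/-- `∫ |L h| |k| M dv` is controlled by the norms of `h` and `k` in the domain of `L`. -/
theorem InDomain.integral_abs_L_mul_le (hb : IsCutoffKernel b) {h k : V3 → ℝ}
    (hh : InDomain b h) (hk : InDomain b k) :
    ∫ v, |L b h v * k v * M v| ≤
      8 * (∫ v, freq b v * h v ^ 2 * M v) + 1 / 2 * ∫ v, freq b v * k v ^ 2 * M v := by
  have i := hh.integrable_defect_mul hb hk
  have e : ∫ v, |L b h v * k v * M v| = ∫ v, |collAvg b (fun p => defect h p * k p.1) v * M v| := by
    refine integral_congr_ae ?_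
    filter_upwards [hh.L_eq hb] with v hv
    rw [collAvg_mul_fst, hv]
  rw [e]
  refine (integral_abs_collAvg_le hb i).trans ?_
  have j0 := integrable_collMeasure_fst hb (hh.1.pow_const 2) (hh.integrable_freq hb)
  have jk := integrable_collMeasure_fst hb (hk.1.pow_const 2) (hk.integrable_freq hb)
  have j1 := integrable_comp_exch hb j0
  have j2 := integrable_comp_coll hb j0
  have j3 := integrable_comp_exch hb j2
  have e0 := integral_collMeasure_fst hb (hh.1.pow_const 2) (hh.integrable_freq hb)
  have ek := integral_collMeasure_fst hb (hk.1.pow_const 2) (hk.integrable_freq hb)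
  have e1 := integral_comp_exch hb fun p => h p.1 ^ 2
  have e2 := integral_comp_coll hb fun p => h p.1 ^ 2
  have e3 := integral_comp_exch hb fun p => h (coll p).1 ^ 2
  have j4 := (((j0.fun_add j1).fun_add j2).fun_add j3).const_mul 2
  refine (integral_mono i.abs (j4.fun_add (jk.const_mul (1 / 2))) (defect_mul_le h k)).trans_eq ?_
  rw [integral_add j4 (jk.const_mul (1 / 2)), integral_const_mul, integral_const_mul,
    integral_add_four j0 j1 j2 j3, e1, e3, e2, e0, ek]
  ring

end

/-! ### Continuous collision invariants -/

section

/-- Cauchy's functional equation for odd continuous functions, assumed on `[0, ∞)` only. -/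
theorem eq_mul_of_odd_additive {F : ℝ → ℝ} (hc : Continuous F) (hodd : ∀ a, F (-a) = -F a)
    (hadd : ∀ a b, 0 ≤ a → 0 ≤ b → F (a + b) = F a + F b) (a : ℝ) : F a = a * F 1 := by
  have hsub : ∀ a b, 0 ≤ a → 0 ≤ b → F (a - b) = F a - F b := by
    intro a b ha hb
    rcases le_total b a with h | h
    · have := hadd (a - b) b (by linarith) hb
      rw [sub_add_cancel] at this; linarith
    · have := hadd (b - a) a (by linarith) ha
      have h2 := hodd (a - b)
      rw [neg_sub] at h2
      rw [sub_add_cancel] at this; linarith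
  have hall : ∀ a b, F (a + b) = F a + F b := by
    intro a b
    rcases le_total 0 a with ha | ha <;> rcases le_total 0 b with hb | hb
    · exact hadd a b ha hb
    · have := hsub a (-b) ha (by linarith)
      rw [hodd, sub_neg_eq_add] at this; linarith
    · have := hsub b (-a) hb (by linarith)
      rw [hodd, sub_neg_eq_add, add_comm] at this; linarith
    · have := hadd (-a) (-b) (by linarith) (by linarith)
      rw [← neg_add, hodd, hodd, hodd] at this; linarith
  have := map_real_smul (AddMonoidHom.mk' F hall) hc a 1
  simpa using this

/-- Coordinate vectors. -/
def coordVec (i : Fin 3) (a : ℝ) : V3 := a • EuclideanSpace.single i (1 : ℝ)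

theorem coordVec_apply (i j : Fin 3) (a : ℝ) : coordVec i a j = if j = i then a else 0 := by
  simp [coordVec]

theorem coordVec_neg (i : Fin 3) (a : ℝ) : coordVec i (-a) = -coordVec i a := by
  simp [coordVec]

theorem coordVec_zero (i : Fin 3) : coordVec i 0 = 0 := by simp [coordVec]

theorem norm_coordVec (i : Fin 3) (a : ℝ) : ‖coordVec i a‖ = |a| := by
  simp [coordVec, norm_smul]

theorem continuous_coordVec (i : Fin 3) : Continuous (coordVec i) := by
  unfold coordVec; fun_prop

theorem eq_sum_coordVec (x : V3) :
    x = coordVec 0 (x 0) + coordVec 1 (x 1) + coordVec 2 (x 2) := by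
  ext i; fin_cases i <;> simp [coordVec_apply]

theorem inner_coordVec (i : Fin 3) (a : ℝ) (x : V3) : ⟪coordVec i a, x⟫ = a * x i := by
  simp [coordVec, inner_smul_left, EuclideanSpace.inner_single_left]

/-- A function that is additive on orthogonal pairs is a sum of functions of the coordinates. -/
theorem eq_sum_of_orthogonally_additive {g : V3 → ℝ}
    (hg : ∀ x y : V3, ⟪x, y⟫ = 0 → g (x + y) = g x + g y) (x : V3) :
    g x = ∑ i, g (coordVec i (x i)) := by
  conv_lhs => rw [eq_sum_coordVec x]
  rw [hg, hg, Fin.sum_univ_three]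
  · rw [inner_coordVec]; simp [coordVec_apply]
  · rw [inner_add_left, inner_coordVec, inner_coordVec]; simp [coordVec_apply]

/-- Odd continuous functions that are additive on orthogonal pairs are linear. -/
theorem odd_orthogonally_additive {g : V3 → ℝ} (hc : Continuous g)
    (hg : ∀ x y : V3, ⟪x, y⟫ = 0 → g (x + y) = g x + g y) (hodd : ∀ x, g (-x) = -g x) (x : V3) :
    g x = ∑ i, x i * g (coordVec i 1) := by
  rw [eq_sum_of_orthogonally_additive hg]
  refine Finset.sum_congr rfl fun i _ => ?_
  refine eq_mul_of_odd_additive (F := fun a => g (coordVec i a)) ?_ ?_ ?_ (x i)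
  · exact hc.comp (continuous_coordVec i)
  · intro a
    simp only [coordVec_neg, hodd]
  · intro a b ha hb
    obtain ⟨j, hj⟩ : ∃ j : Fin 3, j ≠ i := exists_ne i
    -- `a e_i + √(ab) e_j` and `b e_i - √(ab) e_j` are orthogonal
    set s := √(a * b) with hs
    have hs2 : s * s = a * b := Real.mul_self_sqrt (mul_nonneg ha hb)
    have e1 : coordVec i (a + b) = (coordVec i a + coordVec j s) + (coordVec i b + coordVec j (-s)) := by
      ext k; simp only [PiLp.add_apply, coordVec_apply]
      split_ifs <;> ring
    have e2 : coordVec j (-s) = -coordVec j s := coordVec_neg j s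
    have o1 : ⟪coordVec i a, coordVec j s⟫ = 0 := by
      rw [inner_coordVec]; simp [coordVec_apply, hj.symm]
    have o2 : ⟪coordVec i b, coordVec j (-s)⟫ = 0 := by
      rw [inner_coordVec]; simp [coordVec_apply, hj.symm]
    have o3 : ⟪coordVec i a + coordVec j s, coordVec i b + coordVec j (-s)⟫ = 0 := by
      rw [inner_add_left, inner_coordVec, inner_coordVec]
      simp [coordVec_apply, hj, hj.symm]; linarith
    rw [e1, hg _ _ o3, hg _ _ o1, hg _ _ o2, e2, hodd]; ring

/-- Even continuous functions that are additive on orthogonal pairs are multiples of `|x|²`. -/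
theorem even_orthogonally_additive {g : V3 → ℝ} (hc : Continuous g)
    (hg : ∀ x y : V3, ⟪x, y⟫ = 0 → g (x + y) = g x + g y) (heven : ∀ x, g (-x) = g x) (x : V3) :
    g x = ‖x‖ ^ 2 * g (coordVec 0 1) := by
  have h0 : g 0 = 0 := by have := hg 0 0 (by simp); simp at this; exact this
  -- if `|x| = |y|` then `(x + y) / 2` and `(x - y) / 2` are orthogonal, so `g` is radial
  have hnorm : ∀ x y : V3, ‖x‖ = ‖y‖ → g x = g y := by
    intro x y hxy
    set u : V3 := (1 / 2 : ℝ) • (x + y)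
    set w : V3 := (1 / 2 : ℝ) • (x - y)
    have hx : x = u + w := by simp only [u, w]; module
    have hy : y = u + -w := by simp only [u, w]; module
    have ho : ⟪u, w⟫ = 0 := by
      simp only [u, w, inner_smul_left, inner_smul_right, inner_add_left, inner_sub_right,
        real_inner_self_eq_norm_sq, hxy, real_inner_comm y x]
      simp; ring
    rw [hx, hy, hg _ _ ho, hg _ _ (by rw [inner_neg_right, ho, neg_zero]), heven]
  have hcoord : ∀ (i : Fin 3) (a : ℝ), g (coordVec i a) = a ^ 2 * g (coordVec 0 1) := by
    intro i a
    have hG : Continuous fun a : ℝ => g (coordVec 0 √a) :=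
      hc.comp ((continuous_coordVec 0).comp Real.continuous_sqrt)
    have hneg : ∀ a : ℝ, a ≤ 0 → g (coordVec 0 √a) = 0 := by
      intro a ha
      rw [Real.sqrt_eq_zero_of_nonpos ha]
      rw [coordVec_zero, h0]
    -- `a ↦ g (√a e)` is additive for `a ≥ 0` by the theorem of Pythagoras; extend it to an odd
    -- function (`√` vanishes on negative numbers)
    have key := eq_mul_of_odd_additive
      (F := fun a => g (coordVec 0 √a) - g (coordVec 0 √(-a)))
      (hG.sub (hG.comp continuous_neg)) (fun a => by simp) (fun a b ha hb => by
        rw [hneg (-(a + b)) (by linarith), hneg (-a) (by linarith), hneg (-b) (by linarith)]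
        have e : g (coordVec 0 √(a + b)) = g (coordVec 0 √a + coordVec 1 √b) := by
          apply hnorm
          rw [← sq_eq_sq₀ (norm_nonneg _) (norm_nonneg _), norm_add_sq_real, inner_coordVec]
          simp [coordVec_apply, norm_coordVec, Real.sq_sqrt, ha, hb, add_nonneg]
        have e2 : g (coordVec 0 √b) = g (coordVec 1 √b) := by
          apply hnorm; simp [norm_coordVec]
        rw [e, hg _ _ (by rw [inner_coordVec]; simp [coordVec_apply]), e2]; ring) (a ^ 2)
    rw [hneg (-a ^ 2) (by nlinarith [sq_nonneg a]), hneg (-1) (by norm_num)] at key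
    simp only [sub_zero, Real.sqrt_one] at key
    rw [← key]
    apply hnorm
    simp [norm_coordVec, Real.sqrt_sq_eq_abs]
  rw [eq_sum_of_orthogonally_additive hg]
  rw [normSq_eq_sum, Finset.sum_mul]
  exact Finset.sum_congr rfl fun i _ => by rw [hcoord, sq]

/-- The collision invariants `a + c·v + d |v|²`. -/
def quadInv (a : ℝ) (c : Fin 3 → ℝ) (d : ℝ) (v : V3) : ℝ := a + ∑ i, c i * v i + d * ‖v‖ ^ 2

/-- A pair of orthogonal velocities `x, y` is a possible outcome of the collision of `x + y`
with a particle at rest. -/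
theorem orthogonally_additive_of_defect {k : V3 → ℝ} (hk : ∀ p, defect k p = 0) (x y : V3)
    (hxy : ⟪x, y⟫ = 0) : k (x + y) - k 0 = (k x - k 0) + (k y - k 0) := by
  by_cases hy : y = 0
  · simp [hy]
  have hn : ‖y‖ ≠ 0 := norm_ne_zero_iff.2 hy
  let ω : S2 := ⟨‖y‖⁻¹ • y, by simp [norm_smul, hn]⟩
  have hin : ⟪x + y - 0, (ω : V3)⟫ = ‖y‖ := by
    simp only [ω, sub_zero, inner_smul_right, inner_add_left, hxy, real_inner_self_eq_norm_sq]
    field_simp; ring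
  have hω : ‖y‖ • (ω : V3) = y := by simp only [ω, smul_smul]; simp [hn]
  have h := hk (x + y, 0, ω)
  simp only [defect, coll_exch_fst] at h
  simp only [coll, exch, post, postStar, hin, hω] at h
  simp only [add_sub_cancel_right, zero_add] at h
  linarith

/-- The Boltzmann–Gronwall theorem: split `k - k 0` into its odd and even parts, each of which is
additive on orthogonal pairs. -/
theorem continuous_collisionInvariant {k : V3 → ℝ} (hc : Continuous k) (hk : ∀ p, defect k p = 0) :
    ∃ a c d, k = quadInv a c d := by
  have hadd := orthogonally_additive_of_defect hk
  set o : V3 → ℝ := fun x => ((k x - k 0) - (k (-x) - k 0)) / 2 with ho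
  set e : V3 → ℝ := fun x => ((k x - k 0) + (k (-x) - k 0)) / 2 with he
  have hneg : ∀ x y : V3, ⟪x, y⟫ = 0 →
      k (-(x + y)) - k 0 = (k (-x) - k 0) + (k (-y) - k 0) := by
    intro x y hxy
    rw [neg_add]
    exact hadd (-x) (-y) (by simpa using hxy)
  have h1 := odd_orthogonally_additive (g := o) (by simp only [ho]; fun_prop)
    (fun x y hxy => by simp only [ho]; rw [hadd x y hxy, hneg x y hxy]; ring)
    (fun x => by simp only [ho, neg_neg]; ring)
  have h2 := even_orthogonally_additive (g := e) (by simp only [he]; fun_prop)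
    (fun x y hxy => by simp only [he]; rw [hadd x y hxy, hneg x y hxy]; ring)
    (fun x => by simp only [he, neg_neg]; ring)
  refine ⟨k 0, fun i => o (coordVec i 1), e (coordVec 0 1), ?_⟩
  ext x
  have e1 : k x = k 0 + o x + e x := by simp only [ho, he]; ring
  rw [e1, h1 x, h2 x, quadInv]
  simp_rw [mul_comm]

/-! ### The kernel of the linearized operator -/

theorem ae_ne_zero_inner (v : V3) (ω : S2) : ∀ᵐ w : V3, ⟪v - w, (ω : V3)⟫ ≠ 0 := by
  have hne : LinearMap.ker (innerₛₗ ℝ (ω : V3)) ≠ ⊤ := by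
    intro h
    have : (ω : V3) ∈ LinearMap.ker (innerₛₗ ℝ (ω : V3)) := h ▸ Submodule.mem_top
    simp at this
  have h0 : ∀ᵐ x : V3, ⟪x, (ω : V3)⟫ ≠ 0 := by
    rw [ae_iff]
    convert Measure.addHaar_submodule volume _ hne using 2
    ext x; simp [real_inner_comm]
  exact (Measure.measurePreserving_sub_left volume v).quasiMeasurePreserving.ae h0

theorem ae_abs_inner_lt (v : V3) (ω : S2) :
    ∀ᵐ w : V3, |⟪v - w, (ω : V3)⟫| < ‖v - w‖ := by
  have hne : Submodule.span ℝ {(ω : V3)} ≠ ⊤ := by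
    intro h
    have h1 := finrank_span_singleton (K := ℝ) (v := (ω : V3))
      (fun h => by have := inner_S2_self ω; simp [h] at this)
    rw [h, finrank_top] at h1
    simp at h1
  have h0 : ∀ᵐ x : V3, |⟪x, (ω : V3)⟫| < ‖x‖ := by
    rw [ae_iff]
    refine measure_mono_null ?_ (Measure.addHaar_submodule volume _ hne)
    intro x hx
    simp only [Set.mem_ofPred_eq, not_lt] at hx
    have h2 : ‖x - ⟪x, (ω : V3)⟫ • (ω : V3)‖ ^ 2 ≤ 0 := by
      rw [norm_sub_sq_real, inner_smul_right, norm_smul]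
      simp only [Real.norm_eq_abs, norm_eq_of_mem_sphere, mul_one, sq_abs]
      nlinarith [sq_abs ⟪x, (ω : V3)⟫, norm_nonneg x]
    have h3 : x - ⟪x, (ω : V3)⟫ • (ω : V3) = 0 := by
      rw [← norm_eq_zero]
      exact pow_eq_zero_iff (two_ne_zero) |>.1 (le_antisymm h2 (sq_nonneg _))
    exact Submodule.mem_span_singleton.2 ⟨_, (sub_eq_zero.1 h3).symm⟩
  exact (Measure.measurePreserving_sub_left volume v).quasiMeasurePreserving.ae h0

variable {b : ℝ → ℝ → ℝ}

/-- The collision kernel is positive for almost all collisions. -/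
theorem ae_kern_pos (hb : IsCutoffKernel b) : ∀ᵐ p ∂baseMeasure, 0 < kern b p.1 p.2.1 p.2.2 := by
  have hS : MeasurableSet {p : Coll | 0 < kern b p.1 p.2.1 p.2.2} :=
    measurableSet_lt measurable_const (measurable_kern hb)
  unfold baseMeasure
  rw [Measure.ae_prod_iff_ae_ae (p := fun p : Coll => 0 < kern b p.1 p.2.1 p.2.2) hS]
  refine ae_of_all _ fun v => ?_
  have h : ∀ᵐ q ∂(sigma.prod (volume : Measure V3)), 0 < kern b v q.2 q.1 := by
    have hpair : Measurable fun q : S2 × V3 => ((v, q.2, q.1) : Coll) := by fun_prop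
    have hmk := (measurable_kern hb).comp hpair
    have hS' : MeasurableSet {q : S2 × V3 | 0 < kern b v q.2 q.1} :=
      measurableSet_lt measurable_const hmk
    rw [Measure.ae_prod_iff_ae_ae (p := fun q : S2 × V3 => 0 < kern b v q.2 q.1) hS']
    refine ae_of_all _ fun ω => ?_
    filter_upwards [ae_ne_zero_inner v ω, ae_abs_inner_lt v ω] with w h1 h2
    exact hb.pos _ _ (abs_pos.2 h1) h2
  exact Measure.measurePreserving_swap.quasiMeasurePreserving.ae h

theorem ae_baseMeasure_of_ae_collMeasure (hb : IsCutoffKernel b) {P : Coll → Prop}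
    (h : ∀ᵐ p ∂(collMeasure b), P p) : ∀ᵐ p ∂baseMeasure, P p := by
  have h1 := (ae_withDensity_iff (measurable_collDensity hb).ennreal_ofReal).1 h
  filter_upwards [h1, ae_kern_pos hb] with p hp hk
  refine hp ?_
  rw [Ne, ENNReal.ofReal_eq_zero, not_le]
  exact mul_pos hk (mul_pos (M_pos _) (M_pos _))

/-- The simultaneous translation of both velocities. -/
def shift (t : V3) (p : Coll) : Coll := (p.1 - t, p.2.1 - t, p.2.2)

theorem measurePreserving_shift (t : V3) :
    MeasurePreserving (shift t) baseMeasure baseMeasure :=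
  (measurePreserving_sub_right volume t).prod
    ((measurePreserving_sub_right volume t).prod (MeasurePreserving.id sigma))

theorem coll_shift (t : V3) (p : Coll) : coll (shift t p) = shift t (coll p) := by
  unfold coll shift post postStar
  simp only [sub_sub_sub_cancel_right]
  ext1
  · simp only; abel
  · ext1
    · simp only; abel
    · rfl

theorem measurable_defect {h : V3 → ℝ} (hh : Measurable h) : Measurable (defect h) := by
  have e := continuous_exch.measurable
  have c := continuous_coll.measurable
  exact (((hh.comp measurable_fst).add (hh.comp (measurable_fst.comp e))).sub
    (hh.comp (measurable_fst.comp c))).sub (hh.comp (measurable_fst.comp (c.comp e)))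

instance : baseMeasure.IsOpenPosMeasure := by
  unfold baseMeasure; exact Measure.prod.instIsOpenPosMeasure

/-- Mollification preserves collision invariants, and makes them continuous. -/
theorem defect_convolution_eq_zero {h : V3 → ℝ} (hm : Measurable h) (hl : LocallyIntegrable h)
    (hd : ∀ᵐ p ∂baseMeasure, defect h p = 0) (φ : ContDiffBump (0 : V3)) (p : Coll) :
    defect (convolution (φ.normed volume) h (ContinuousLinearMap.lsmul ℝ ℝ) volume) p = 0 := by
  set k := convolution (φ.normed volume) h (ContinuousLinearMap.lsmul ℝ ℝ) volume with hk
  have hkc : Continuous k := φ.hasCompactSupport_normed.continuous_convolution_left _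
    φ.continuous_normed hl
  have hex : ConvolutionExists (φ.normed volume) h (ContinuousLinearMap.lsmul ℝ ℝ) volume :=
    φ.hasCompactSupport_normed.convolutionExists_left _ φ.continuous_normed hl
  have hkv : ∀ v, k v = ∫ t, φ.normed volume t * h (v - t) := fun v => rfl
  have hi : ∀ v, Integrable fun t => φ.normed volume t * h (v - t) := fun v => hex v
  have hms : MeasurableSet {q : V3 × Coll | defect h (shift q.1 q.2) = 0} := by
    have : Continuous fun q : V3 × Coll => shift q.1 q.2 := by unfold shift; fun_prop
    exact ((measurable_defect hm).comp this.measurable) (measurableSet_singleton 0)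
  -- collisions commute with translations of the velocities
  have h1 : ∀ᵐ t : V3, ∀ᵐ p ∂baseMeasure, defect h (shift t p) = 0 :=
    ae_of_all _ fun t => (measurePreserving_shift t).quasiMeasurePreserving.ae hd
  have h2 : ∀ᵐ p ∂baseMeasure, ∀ᵐ t : V3, defect h (shift t p) = 0 :=
    (Measure.ae_ae_comm hms).1 h1
  have h3 : ∀ᵐ p ∂baseMeasure, defect k p = 0 := by
    filter_upwards [h2] with p hp
    simp only [defect, hkv]
    rw [← integral_add (hi _) (hi _), ← integral_sub ((hi _).fun_add (hi _)) (hi _)]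
    have i3 := ((hi p.1).fun_add (hi (exch p).1)).sub (hi (coll p).1)
    have i3' : Integrable (fun t => φ.normed volume t * h (p.1 - t) +
        φ.normed volume t * h ((exch p).1 - t) - φ.normed volume t * h ((coll p).1 - t)) := i3
    rw [← integral_sub i3' (hi _)]
    refine integral_eq_zero_of_ae ?_
    filter_upwards [hp] with t ht
    have e : defect h (shift t p) = h (p.1 - t) + h ((exch p).1 - t) - h ((coll p).1 - t) -
        h ((coll (exch p)).1 - t) := by
      have e1 : exch (shift t p) = shift t (exch p) := rfl
      unfold defect
      rw [e1, coll_shift, coll_shift]; rfl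
    rw [e] at ht
    simp only [Pi.zero_apply]
    linear_combination φ.normed volume t * ht
  -- the defect is continuous and the base measure charges all open sets
  have hc : Continuous (defect k) := by
    have e := continuous_exch
    have c := continuous_coll
    exact (((hkc.comp continuous_fst).add (hkc.comp (continuous_fst.comp e))).sub
      (hkc.comp (continuous_fst.comp c))).sub (hkc.comp (continuous_fst.comp (c.comp e)))
  exact congrFun ((Continuous.ae_eq_iff_eq baseMeasure hc continuous_const).1 h3) p

theorem InDomain.locallyIntegrable (hb : IsCutoffKernel b) {h : V3 → ℝ} (hh : InDomain b h) :
    LocallyIntegrable h := by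
  have h1 : Integrable fun v => h v * M v := by
    have := hh.integrable_mul hb ((PolyGrowth.const 1).inDomain hb)
    simpa using this
  have h2 : LocallyIntegrable fun v => (h v * M v) * (M v)⁻¹ := by
    intro v
    obtain ⟨s, hs, hi⟩ := h1.locallyIntegrable v
    obtain ⟨K, hK, hKs, hKc⟩ := local_compact_nhds hs
    refine ⟨K, hK, ?_⟩
    exact (hi.mono_set hKs).mul_continuousOn
      (continuous_M.inv₀ fun v => (M_pos v).ne').continuousOn hKc
  refine h2.congr (ae_of_all _ fun v => ?_)
  have := (M_pos v).ne'
  field_simp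

/-- A pointwise limit, on any set, of functions `a + c·v + d|v|²` is of this form: a
finite-dimensional space of functions is closed under pointwise convergence. -/
theorem quadInv_of_tendsto {G : Set V3} {k : ℕ → V3 → ℝ} {h : V3 → ℝ}
    (hk : ∀ n, ∃ a c d, k n = quadInv a c d)
    (hlim : ∀ v ∈ G, Tendsto (fun n => k n v) atTop (𝓝 (h v))) :
    ∃ a c d, ∀ v ∈ G, h v = quadInv a c d v := by
  let T : (ℝ × (Fin 3 → ℝ) × ℝ) →ₗ[ℝ] (G → ℝ) :=
    { toFun := fun x v => quadInv x.1 x.2.1 x.2.2 v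
      map_add' := fun x y => by
        ext v
        simp only [quadInv, Prod.fst_add, Prod.snd_add, Pi.add_apply, add_mul,
          Finset.sum_add_distrib]
        ring
      map_smul' := fun r x => by
        ext v
        simp only [quadInv, Prod.smul_fst, Prod.smul_snd, Pi.smul_apply, smul_eq_mul, mul_assoc,
          ← Finset.mul_sum, RingHom.id_apply]
        ring }
  have hcl : IsClosed (LinearMap.range T : Set (G → ℝ)) :=
    Submodule.closed_of_finiteDimensional _
  have hmem : (fun v : G => h v) ∈ (LinearMap.range T : Set (G → ℝ)) := by
    refine hcl.mem_of_tendsto (f := fun n => fun v : G => k n v) (b := atTop)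
      (tendsto_pi_nhds.2 fun v => hlim v v.2) (Eventually.of_forall fun n => ?_)
    obtain ⟨a, c, d, e⟩ := hk n
    exact ⟨(a, c, d), by ext v; simp [T, e]⟩
  obtain ⟨⟨a, c, d⟩, e⟩ := hmem
  exact ⟨a, c, d, fun v hv => (congrFun e ⟨v, hv⟩).symm⟩

/-- The kernel of `L` consists of the functions `a + c·v + d|v|²`: mollify, use the result on
continuous invariants, and pass to the limit at the Lebesgue points. -/
theorem InKer.exists_quadInv (hb : IsCutoffKernel b) {h : V3 → ℝ} (hh : InKer b h) :
    ∃ a c d, h =ᵐ[volume] quadInv a c d := by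
  have hd := ae_baseMeasure_of_ae_collMeasure hb (hh.defect_eq_zero hb)
  have hl := hh.1.locallyIntegrable hb
  let φ : ℕ → ContDiffBump (0 : V3) := fun n =>
    ⟨1 / ((n : ℝ) + 1), 2 * (1 / ((n : ℝ) + 1)), by positivity, by
      have : 0 < 1 / ((n : ℝ) + 1) := by positivity
      linarith⟩
  have hφ : Tendsto (fun n => (φ n).rOut) atTop (𝓝 0) := by
    have := (tendsto_one_div_add_atTop_nhds_zero_nat (𝕜 := ℝ)).const_mul 2
    simpa [φ] using this
  have hae := ContDiffBump.ae_convolution_tendsto_right_of_locallyIntegrable (μ := volume)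
    (φ := φ) (l := atTop) (K := 2) hφ (Eventually.of_forall fun n => le_rfl) hl
  obtain ⟨a, c, d, e⟩ := quadInv_of_tendsto
    (G := {v | Tendsto (fun n => (convolution ((φ n).normed volume) h
      (ContinuousLinearMap.lsmul ℝ ℝ) volume) v) atTop (𝓝 (h v))})
    (k := fun n => convolution ((φ n).normed volume) h (ContinuousLinearMap.lsmul ℝ ℝ) volume)
    (fun n => continuous_collisionInvariant
      ((φ n).hasCompactSupport_normed.continuous_convolution_left _ (φ n).continuous_normed hl)
      (defect_convolution_eq_zero hh.1.1 hl hd (φ n)))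
    (fun v hv => hv)
  refine ⟨a, c, d, ?_⟩
  filter_upwards [hae] with v hv
  exact e v hv

theorem polyGrowth_quadInv (a : ℝ) (c : Fin 3 → ℝ) (d : ℝ) : PolyGrowth (quadInv a c d) :=
  ((PolyGrowth.const a).add (PolyGrowth.sum _ fun i => (PolyGrowth.coord i).const_mul (c i))).add
    (PolyGrowth.normSq.const_mul d)

theorem defect_quadInv (a : ℝ) (c : Fin 3 → ℝ) (d : ℝ) (p : Coll) :
    defect (quadInv a c d) p = 0 := by
  have h1 := fun i => defect_coord i p
  have h2 := defect_normSq p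
  unfold defect at *
  have h3 : ∑ i, c i * (p.1 i + (exch p).1 i - (coll p).1 i - (coll (exch p)).1 i) = 0 :=
    Finset.sum_eq_zero fun i _ => by rw [h1 i, mul_zero]
  simp only [mul_sub, mul_add, Finset.sum_sub_distrib, Finset.sum_add_distrib] at h3
  unfold quadInv
  linear_combination h3 + d * h2

end

/-! ### Rotation invariance of the collision operator -/

section

open scoped Pointwise

variable {b : ℝ → ℝ → ℝ}

/-- The action of an isometry on directions. -/
def rotS2 (R : V3 ≃ₗᵢ[ℝ] V3) (ω : S2) : S2 := ⟨R ω, by simp⟩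

theorem continuous_rotS2 (R : V3 ≃ₗᵢ[ℝ] V3) : Continuous (rotS2 R) := by
  unfold rotS2; fun_prop

theorem measurePreserving_rotS2 (R : V3 ≃ₗᵢ[ℝ] V3) : MeasurePreserving (rotS2 R) sigma sigma := by
  refine ⟨(continuous_rotS2 R).measurable, Measure.ext fun s hs => ?_⟩
  rw [Measure.map_apply (continuous_rotS2 R).measurable hs]
  unfold sigma
  rw [Measure.toSphere_apply' _ hs,
    Measure.toSphere_apply' _ ((continuous_rotS2 R).measurable hs)]
  congr 1
  rw [← R.measurePreserving.measure_preimage_equiv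
    (f := R.toHomeomorph.toMeasurableEquiv) (Set.Ioo (0 : ℝ) 1 • (Subtype.val '' s))]
  congr 1
  ext x
  simp only [Set.mem_smul, Set.mem_image, Set.mem_preimage]
  constructor
  · rintro ⟨c, hc, y, ⟨ω, hω, rfl⟩, rfl⟩
    exact ⟨c, hc, R ω, ⟨rotS2 R ω, hω, rfl⟩, by simp⟩
  · rintro ⟨c, hc, y, ⟨ω, hω, rfl⟩, h⟩
    refine ⟨c, hc, R.symm ω, ⟨rotS2 R.symm ω, ?_, rfl⟩, ?_⟩
    · have : rotS2 R (rotS2 R.symm ω) = ω := Subtype.ext (by simp [rotS2])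
      rw [this]; exact hω
    · rw [← map_smul]
      change R.symm (c • (ω : V3)) = x
      rw [h]
      exact R.symm_apply_apply x

theorem post_rot (R : V3 ≃ₗᵢ[ℝ] V3) (v w : V3) (ω : S2) :
    post (R v) (R w) (rotS2 R ω) = R (post v w ω) := by
  unfold post rotS2
  simp only
  rw [← map_sub R v w, LinearIsometryEquiv.inner_map_map]
  simp only [map_sub, map_smul]

theorem postStar_rot (R : V3 ≃ₗᵢ[ℝ] V3) (v w : V3) (ω : S2) :
    postStar (R v) (R w) (rotS2 R ω) = R (postStar v w ω) := by
  unfold postStar rotS2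
  simp only
  rw [← map_sub R v w, LinearIsometryEquiv.inner_map_map]
  simp only [map_add, map_smul]

theorem kern_rot (R : V3 ≃ₗᵢ[ℝ] V3) (v w : V3) (ω : S2) :
    kern b (R v) (R w) (rotS2 R ω) = kern b v w ω := by
  simp only [kern, rotS2, ← map_sub, LinearIsometryEquiv.inner_map_map,
    LinearIsometryEquiv.norm_map]

theorem M_rot (R : V3 ≃ₗᵢ[ℝ] V3) (v : V3) : M (R v) = M v := by simp [M]

theorem integral_rot (R : V3 ≃ₗᵢ[ℝ] V3) (F : V3 × S2 → ℝ) :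
    ∫ p, F (R p.1, rotS2 R p.2) ∂((volume : Measure V3).prod sigma) =
      ∫ p, F p ∂((volume : Measure V3).prod sigma) := by
  have h := R.measurePreserving.prod (measurePreserving_rotS2 R)
  have hinj : Function.Injective (Prod.map R (rotS2 R)) :=
    Function.Injective.prodMap R.injective fun x y hxy =>
      Subtype.ext (R.injective (congrArg Subtype.val hxy))
  have hcont : Continuous (Prod.map R (rotS2 R)) := R.continuous.prodMap (continuous_rotS2 R)
  exact h.integral_comp (hcont.measurableEmbedding hinj) F

theorem Q_rot (R : V3 ≃ₗᵢ[ℝ] V3) (f h : V3 → ℝ) (v : V3) :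
    Q b (fun w => f (R w)) (fun w => h (R w)) v = Q b f h (R v) := by
  unfold Q
  rw [← integral_rot R fun p => (f (post (R v) p.1 p.2) * h (postStar (R v) p.1 p.2) -
    f (R v) * h p.1) * kern b (R v) p.1 p.2]
  simp only [post_rot, postStar_rot, kern_rot]

theorem L_rot (R : V3 ≃ₗᵢ[ℝ] V3) (h : V3 → ℝ) (v : V3) :
    L b (fun w => h (R w)) v = L b h (R v) := by
  have e : M = fun w => M (R w) := by ext w; rw [M_rot]
  unfold L
  rw [M_rot, ← Q_rot R M, ← Q_rot R _ M, ← e]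
  simp only [M_rot]

theorem freq_rot (R : V3 ≃ₗᵢ[ℝ] V3) (v : V3) : freq b (R v) = freq b v := by
  unfold freq
  rw [← integral_rot R fun p => kern b (R v) p.1 p.2 * M p.1]
  simp only [kern_rot, M_rot]

theorem pairM_rot (R : V3 ≃ₗᵢ[ℝ] V3) (h k : V3 → ℝ) :
    pairM (fun w => h (R w)) (fun w => k (R w)) = pairM h k := by
  unfold pairM
  rw [← R.measurePreserving.integral_comp R.toHomeomorph.measurableEmbedding
    (fun v => h v * k v * M v)]
  simp only [M_rot]

theorem InDomain.rot (R : V3 ≃ₗᵢ[ℝ] V3) {h : V3 → ℝ} (hh : InDomain b h) :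
    InDomain b fun w => h (R w) := by
  refine ⟨hh.1.comp R.continuous.measurable, ?_⟩
  have := (R.measurePreserving.integrable_comp_emb R.toHomeomorph.measurableEmbedding).2 hh.2
  simpa only [Function.comp_def, freq_rot, M_rot] using this

theorem InKer.rot (R : V3 ≃ₗᵢ[ℝ] V3) {h : V3 → ℝ} (hh : InKer b h) :
    InKer b fun w => h (R w) := by
  refine ⟨hh.1.rot R, ?_⟩
  filter_upwards [R.measurePreserving.quasiMeasurePreserving.ae hh.2] with v hv
  rw [L_rot, hv]; rfl

theorem InKerPerp.rot (R : V3 ≃ₗᵢ[ℝ] V3) {h : V3 → ℝ} (hh : InKerPerp b h) :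
    InKerPerp b fun w => h (R w) := by
  refine ⟨hh.1.rot R, fun k hk => ?_⟩
  have := pairM_rot R h (fun w => k (R.symm w))
  simp only [LinearIsometryEquiv.symm_apply_apply] at this
  rw [this]
  exact hh.2 _ (hk.rot R.symm)

/-! ### Linear combinations -/

theorem InDomain.sum (hb : IsCutoffKernel b) {ι : Type*} (s : Finset ι) (c : ι → ℝ)
    {h : ι → V3 → ℝ} (hh : ∀ i, InDomain b (h i)) :
    InDomain b fun v => ∑ i ∈ s, c i * h i v := by
  classical
  induction s using Finset.induction_on with
  | empty => simpa using (PolyGrowth.const 0).inDomain hb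
  | insert a s ha ih =>
    simp only [Finset.sum_insert ha]
    exact ((hh a).const_mul (c a)).add hb ih

theorem InDomain.L_sum (hb : IsCutoffKernel b) {ι : Type*} (s : Finset ι) (c : ι → ℝ)
    {h : ι → V3 → ℝ} (hh : ∀ i, InDomain b (h i)) :
    L b (fun v => ∑ i ∈ s, c i * h i v) =ᵐ[volume] fun v => ∑ i ∈ s, c i * L b (h i) v := by
  classical
  induction s using Finset.induction_on with
  | empty =>
    simp only [Finset.sum_empty]
    refine ae_of_all _ fun v => ?_
    simp [L, Q]
  | insert a s ha ih =>
    simp only [Finset.sum_insert ha]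
    filter_upwards [((hh a).const_mul (c a)).L_add hb (InDomain.sum hb s c hh),
      (hh a).L_const_mul hb (c a), ih] with v e1 e2 e3
    rw [e1, e2, e3]

theorem InDomain.pairM_sum (hb : IsCutoffKernel b) {ι : Type*} (s : Finset ι) (c : ι → ℝ)
    {h : ι → V3 → ℝ} (hh : ∀ i, InDomain b (h i)) {k : V3 → ℝ} (hk : InDomain b k) :
    pairM (fun v => ∑ i ∈ s, c i * h i v) k = ∑ i ∈ s, c i * pairM (h i) k := by
  classical
  induction s using Finset.induction_on with
  | empty => simp [pairM]
  | insert a s ha ih =>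
    simp only [Finset.sum_insert ha]
    rw [((hh a).const_mul (c a)).pairM_add_left hb (InDomain.sum hb s c hh) hk,
      pairM_const_mul_left, ih]

theorem InKerPerp.sum (hb : IsCutoffKernel b) {ι : Type*} (s : Finset ι) (c : ι → ℝ)
    {h : ι → V3 → ℝ} (hh : ∀ i, InKerPerp b (h i)) :
    InKerPerp b fun v => ∑ i ∈ s, c i * h i v := by
  refine ⟨InDomain.sum hb s c fun i => (hh i).1, fun k hk => ?_⟩
  rw [InDomain.pairM_sum hb s c (fun i => (hh i).1) hk.1]
  exact Finset.sum_eq_zero fun i _ => by rw [(hh i).2 k hk, mul_zero]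

/-- If `L X̂_p = X_p` and an isometry acts on the family `X` by the matrix `c`, then it acts
on `X̂` by the same matrix. -/
theorem InKerPerp.rot_eq_sum (hb : IsCutoffKernel b) {ι : Type*} [Fintype ι]
    {X Xhat : ι → V3 → ℝ} (hX : ∀ p, InKerPerp b (Xhat p) ∧ L b (Xhat p) =ᵐ[volume] X p)
    (R : V3 ≃ₗᵢ[ℝ] V3) (c : ι → ι → ℝ) (hc : ∀ p v, X p (R v) = ∑ q, c p q * X q v) (p : ι) :
    (fun v => Xhat p (R v)) =ᵐ[volume] fun v => ∑ q, c p q * Xhat q v := by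
  refine InKerPerp.eq_of_L_eq hb ((hX p).1.rot R)
    (InKerPerp.sum hb _ (c p) fun q => (hX q).1) ?_
  have h2 := R.measurePreserving.quasiMeasurePreserving.ae (hX p).2
  have h3 : ∀ᵐ v : V3, ∀ q, L b (Xhat q) v = X q v := ae_all_iff.2 fun q => (hX q).2
  filter_upwards [InDomain.L_sum hb Finset.univ (c p) fun q => (hX q).1.1, h2, h3] with v e1 e2 e3
  rw [e1, L_rot, e2, hc]
  simp only [e3]

/-- The matrix `⟨X̂_p, X_q⟩` is invariant under isometries. -/
theorem InKerPerp.pairM_invariant (hb : IsCutoffKernel b) {ι : Type*} [Fintype ι]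
    {X Xhat : ι → V3 → ℝ} (hX : ∀ p, InKerPerp b (Xhat p) ∧ L b (Xhat p) =ᵐ[volume] X p)
    (hXd : ∀ p, InDomain b (X p))
    (R : V3 ≃ₗᵢ[ℝ] V3) (c : ι → ι → ℝ) (hc : ∀ p v, X p (R v) = ∑ q, c p q * X q v) (p q : ι) :
    pairM (Xhat p) (X q) = ∑ p', ∑ q', c p p' * c q q' * pairM (Xhat p') (X q') := by
  rw [← pairM_rot R, pairM_congr_left (InKerPerp.rot_eq_sum hb hX R c hc p),
    InDomain.pairM_sum hb _ _ (fun p' => (hX p').1.1) ((hXd q).rot R)]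
  refine Finset.sum_congr rfl fun p' _ => ?_
  have : (fun w => X q (R w)) = fun w => ∑ q', c q q' * X q' w := by ext w; exact hc q w
  rw [this, pairM_comm, InDomain.pairM_sum hb _ _ hXd (hX p').1.1, Finset.mul_sum]
  refine Finset.sum_congr rfl fun q' _ => ?_
  rw [pairM_comm]; ring

/-! ### Isotropic tensors -/

/-- The matrix of the rotation by `π` about the axis `u`. -/
def axisMat (u : V3) (i j : Fin 3) : ℝ := 2 * u i * u j / ‖u‖ ^ 2 - delta i j

/-- The rotation by `π` about the axis `u`. -/
def axisRot (u : V3) : V3 ≃ₗᵢ[ℝ] V3 := (Submodule.span ℝ {u}).reflection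

theorem axisRot_apply (u v : V3) (i : Fin 3) : axisRot u v i = ∑ j, axisMat u i j * v j := by
  have h : axisRot u v = (2 : ℝ) • ((⟪u, v⟫ / ‖u‖ ^ 2) • u) - v := by
    unfold axisRot
    rw [Submodule.reflection_singleton_apply]
    simp [two_smul]
  rw [h]
  simp only [axisMat, sub_mul, Finset.sum_sub_distrib, sum_delta_mul]
  simp only [PiLp.sub_apply, PiLp.smul_apply, smul_eq_mul, PiLp.inner_apply]
  congr 1
  rw [Finset.sum_div, Finset.sum_mul, Finset.mul_sum]
  refine Finset.sum_congr rfl fun j _ => ?_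
  simp; ring

theorem axisMat_orthogonal {u : V3} (hu : u ≠ 0) (i j : Fin 3) :
    ∑ k, axisMat u i k * axisMat u j k = delta i j := by
  have hn : ‖u‖ ^ 2 ≠ 0 := pow_ne_zero 2 (norm_ne_zero_iff.2 hu)
  have e : ∀ k, axisMat u i k * axisMat u j k =
      (4 * u i * u j / (‖u‖ ^ 2) ^ 2) * (u k * u k) - (2 * u i / ‖u‖ ^ 2) * (delta j k * u k)
        - (2 * u j / ‖u‖ ^ 2) * (delta i k * u k) + delta i k * delta j k := by
    intro k; unfold axisMat; field_simp; ring
  simp_rw [e]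
  rw [Finset.sum_add_distrib, Finset.sum_sub_distrib, Finset.sum_sub_distrib, ← Finset.mul_sum,
    ← Finset.mul_sum, ← Finset.mul_sum, ← normSq_eq_sum, sum_delta_mul, sum_delta_mul,
    sum_delta_mul, delta_comm j i]
  field_simp; ring

theorem A_rot (u v : V3) (i : Fin 3) : A i (axisRot u v) = ∑ j, axisMat u i j * A j v := by
  unfold A
  rw [LinearIsometryEquiv.norm_map, axisRot_apply, Finset.mul_sum]
  exact Finset.sum_congr rfl fun j _ => by ring

theorem B_rot {u : V3} (hu : u ≠ 0) (v : V3) (p : Fin 3 × Fin 3) :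
    B p.1 p.2 (axisRot u v) =
      ∑ q : Fin 3 × Fin 3, axisMat u p.1 q.1 * axisMat u p.2 q.2 * B q.1 q.2 v := by
  unfold B
  rw [LinearIsometryEquiv.norm_map, axisRot_apply, axisRot_apply, Fintype.sum_prod_type,
    Finset.sum_mul_sum, ← axisMat_orthogonal hu p.1 p.2, Finset.mul_sum, ← Finset.sum_sub_distrib]
  refine Finset.sum_congr rfl fun k _ => ?_
  have : ∀ l, axisMat u p.1 k * axisMat u p.2 l * (v k * v l - 1 / 3 * ‖v‖ ^ 2 * delta k l) =
      axisMat u p.1 k * v k * (axisMat u p.2 l * v l) -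
        delta k l * (1 / 3 * ‖v‖ ^ 2 * axisMat u p.1 k * axisMat u p.2 l) := by
    intro l; ring
  simp only [this, Finset.sum_sub_distrib, sum_delta_mul]
  ring

/-- The rotation by `π` about the first coordinate axis. -/
theorem axisMat_flip_zero (i j : Fin 3) :
    axisMat (EuclideanSpace.single 0 1) i j = ![1, -1, -1] i * delta i j := by
  fin_cases i <;> fin_cases j <;> norm_num [axisMat, delta]

/-- The rotation by `π` about the second coordinate axis. -/
theorem axisMat_flip_one (i j : Fin 3) :
    axisMat (EuclideanSpace.single 1 1) i j = ![-1, 1, -1] i * delta i j := by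
  fin_cases i <;> fin_cases j <;> norm_num [axisMat, delta]

/-- The rotation by `π` about `(1,1,0)` exchanges the first two axes. -/
theorem axisMat_swap_zero_one (i j : Fin 3) :
    axisMat !₂[1, 1, 0] i j = ![1, 1, -1] i * delta (![1, 0, 2] i) j := by
  have : ‖(!₂[1, 1, 0] : V3)‖ ^ 2 = 2 := by
    rw [EuclideanSpace.norm_sq_eq]; simp [Fin.sum_univ_three]; norm_num
  unfold axisMat
  rw [this]
  fin_cases i <;> fin_cases j <;> simp [delta]

/-- The rotation by `π` about `(0,1,1)` exchanges the last two axes. -/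
theorem axisMat_swap_one_two (i j : Fin 3) :
    axisMat !₂[0, 1, 1] i j = ![-1, 1, 1] i * delta (![0, 2, 1] i) j := by
  have : ‖(!₂[0, 1, 1] : V3)‖ ^ 2 = 2 := by
    rw [EuclideanSpace.norm_sq_eq]; simp [Fin.sum_univ_three]; norm_num
  unfold axisMat
  rw [this]
  fin_cases i <;> fin_cases j <;> simp [delta]

/-- The rotation by `π` about `(2,1,0)`, with the Pythagorean triple `3, 4, 5`. -/
theorem axisMat_oblique (j : Fin 3) :
    axisMat !₂[2, 1, 0] 0 j = ![3 / 5, 4 / 5, 0] j := by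
  have : ‖(!₂[2, 1, 0] : V3)‖ ^ 2 = 5 := by
    rw [EuclideanSpace.norm_sq_eq]; simp [Fin.sum_univ_three]; norm_num
  unfold axisMat
  rw [this]
  fin_cases j <;> norm_num [delta]

theorem ne_zero_of_coord {u : V3} (i : Fin 3) (h : u i ≠ 0) : u ≠ 0 := by
  rintro rfl
  simp at h

/-- A tensor of rank two that is invariant under the rotations by `π` is a multiple of the
identity. -/
theorem isotropic_two {T : Fin 3 → Fin 3 → ℝ}
    (hT : ∀ u : V3, u ≠ 0 → ∀ i j, T i j = ∑ i', ∑ j', axisMat u i i' * axisMat u j j' * T i' j')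
    (i j : Fin 3) : T i j = T 0 0 * delta i j := by
  -- invariance under a signed permutation of the axes
  have key : ∀ (u : V3) (s : Fin 3 → ℝ) (p : Fin 3 → Fin 3), u ≠ 0 →
      (∀ i j, axisMat u i j = s i * delta (p i) j) → ∀ i j, T i j = s i * s j * T (p i) (p j) := by
    intro u s p hu h i j
    rw [hT u hu i j]
    simp only [h]
    have : ∀ i' j', s i * delta (p i) i' * (s j * delta (p j) j') * T i' j' =
      delta (p i) i' * (delta (p j) j' * (s i * s j * T i' j')) := by intros; ring
    simp only [this, ← Finset.mul_sum, sum_delta_mul]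
  have f0 := key _ _ id (ne_zero_of_coord 0 (by simp)) axisMat_flip_zero
  have f1 := key _ _ id (ne_zero_of_coord 1 (by simp)) axisMat_flip_one
  have s0 := key _ _ _ (ne_zero_of_coord 0 (by simp)) axisMat_swap_zero_one
  have s1 := key _ _ _ (ne_zero_of_coord 1 (by simp)) axisMat_swap_one_two
  have a0 := f0 i j
  have a1 := f1 i j
  have b0 := s0 0 0
  have b1 := s1 1 1
  fin_cases i <;> fin_cases j <;> simp [delta] at * <;> linarith

/-- A tensor of rank four that is invariant under the rotations by `π` and has the symmetries and
the vanishing traces of `⟨B̂_ij, B_kl⟩` is a multiple of the symmetric traceless identity. -/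
theorem isotropic_four {T : Fin 3 → Fin 3 → Fin 3 → Fin 3 → ℝ}
    (hT : ∀ u : V3, u ≠ 0 → ∀ i j k l, T i j k l = ∑ i', ∑ j', ∑ k', ∑ l',
      axisMat u i i' * axisMat u j j' * (axisMat u k k' * axisMat u l l') * T i' j' k' l')
    (h12 : ∀ i j k l, T i j k l = T j i k l) (h34 : ∀ i j k l, T i j k l = T i j l k)
    (htr : ∀ i j, ∑ k, T i j k k = 0) (htr' : ∀ k l, ∑ i, T i i k l = 0) (i j k l : Fin 3) :
    T i j k l = T 0 1 0 1 *
      (delta i k * delta j l + delta i l * delta j k - 2 / 3 * delta i j * delta k l) := by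
  -- invariance under a signed permutation of the axes
  have key : ∀ (u : V3) (s : Fin 3 → ℝ) (p : Fin 3 → Fin 3), u ≠ 0 →
      (∀ i j, axisMat u i j = s i * delta (p i) j) → ∀ i j k l,
        T i j k l = s i * s j * (s k * s l) * T (p i) (p j) (p k) (p l) := by
    intro u s p hu h i j k l
    rw [hT u hu i j k l]
    simp only [h]
    have : ∀ i' j' k' l', s i * delta (p i) i' * (s j * delta (p j) j') *
        (s k * delta (p k) k' * (s l * delta (p l) l')) * T i' j' k' l' =
      delta (p i) i' * (delta (p j) j' * (delta (p k) k' * (delta (p l) l' *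
        (s i * s j * (s k * s l) * T i' j' k' l')))) := by intros; ring
    simp only [this, ← Finset.mul_sum, sum_delta_mul]
  have f0 := key _ _ id (ne_zero_of_coord 0 (by simp)) axisMat_flip_zero
  have f1 := key _ _ id (ne_zero_of_coord 1 (by simp)) axisMat_flip_one
  have s0 := key _ _ _ (ne_zero_of_coord 0 (by simp)) axisMat_swap_zero_one
  have s1 := key _ _ _ (ne_zero_of_coord 1 (by simp)) axisMat_swap_one_two
  -- the values on the diagonal
  have d1 : T 1 1 1 1 = T 0 0 0 0 := by simpa using s0 1 1 1 1
  have d2 : T 2 2 2 2 = T 0 0 0 0 := by rw [← d1]; simpa using s1 2 2 2 2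
  -- the values with two pairs of equal indices
  have p01 : T 0 0 1 1 = T 1 1 0 0 := by simpa using s0 0 0 1 1
  have p02 : T 0 0 2 2 = T 0 0 1 1 := by simpa using s1 0 0 2 2
  have p20 : T 2 2 0 0 = T 1 1 0 0 := by simpa using s1 2 2 0 0
  have p12 : T 1 1 2 2 = T 0 0 2 2 := by simpa using s0 1 1 2 2
  have p21 : T 2 2 1 1 = T 1 1 2 2 := by simpa using s1 2 2 1 1
  have m02 : T 0 2 0 2 = T 0 1 0 1 := by simpa using s1 0 2 0 2
  have m12 : T 1 2 1 2 = T 0 2 0 2 := by simpa using s0 1 2 1 2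
  have t0 := htr 0 0
  rw [Fin.sum_univ_three] at t0
  -- the oblique rotation relates the three constants
  have ob := hT !₂[2, 1, 0] (ne_zero_of_coord 0 (by simp)) 0 0 0 0
  simp only [axisMat_oblique, Fin.sum_univ_three] at ob
  -- entries in which some axis occurs an odd number of times vanish
  have odd : ∀ i j k l : Fin 3,
      (![1, -1, -1] i * ![1, -1, -1] j * (![1, -1, -1] k * ![1, -1, -1] l) = (-1 : ℝ) ∨
      ![-1, 1, -1] i * ![-1, 1, -1] j * (![-1, 1, -1] k * ![-1, 1, -1] l) = (-1 : ℝ)) →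
      T i j k l = 0 := by
    rintro i j k l (h | h)
    · have : T i j k l = -1 * T i j k l := (f0 i j k l).trans (congrArg (· * T i j k l) h)
      linarith
    · have : T i j k l = -1 * T i j k l := (f1 i j k l).trans (congrArg (· * T i j k l) h)
      linarith
  have u02 : T 2 0 2 0 = T 0 1 0 1 := by rw [h12, h34, m02]
  have q10 : T 1 0 0 1 = T 0 1 0 1 := h12 _ _ _ _
  have q01 : T 0 1 1 0 = T 0 1 0 1 := h34 _ _ _ _
  have q11 : T 1 0 1 0 = T 0 1 0 1 := by rw [h12, h34]
  have q20 : T 2 0 0 2 = T 0 1 0 1 := by rw [h12, m02]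
  have q02 : T 0 2 2 0 = T 0 1 0 1 := by rw [h34, m02]
  have q21 : T 2 1 1 2 = T 0 1 0 1 := by rw [h12, m12, m02]
  have q12 : T 1 2 2 1 = T 0 1 0 1 := by rw [h34, m12, m02]
  have q22 : T 2 1 2 1 = T 0 1 0 1 := by rw [h12, h34, m12, m02]
  have t1 := htr' 0 0
  rw [Fin.sum_univ_three] at t1
  simp [odd 0 0 0 1 (by simp), odd 0 0 1 0 (by simp), odd 0 1 0 0 (by simp),
    odd 1 0 0 0 (by simp), odd 1 1 1 0 (by simp), odd 1 1 0 1 (by simp), odd 1 0 1 1 (by simp),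
    odd 0 1 1 1 (by simp), q10, q01, q11, d1] at ob
  have v0 : T 0 0 0 0 = T 0 1 0 1 * (4 / 3) := by linarith
  have v1 : T 0 0 1 1 = T 0 1 0 1 * (-(2 / 3)) := by linarith
  have w0 : T 1 1 0 0 = T 0 1 0 1 * (-(2 / 3)) := by linarith
  clear hT key f0 f1 s0 s1 h12 h34 htr htr' t0 t1 ob
  have c3 : ∀ m : Fin 3, m = 0 ∨ m = 1 ∨ m = 2 := by decide
  rcases c3 i with rfl | rfl | rfl <;> rcases c3 j with rfl | rfl | rfl <;>
    rcases c3 k with rfl | rfl | rfl <;> rcases c3 l with rfl | rfl | rfl <;>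
    first
    | (simp [delta, d1, d2, p02, p20, p12, p21, m02, m12, u02, q10, q01, q11, q20, q02, q21,
        q12, q22, v0, v1, w0]; done)
    | (simp [delta, d1, d2, p02, p20, p12, p21, m02, m12, u02, q10, q01, q11, q20, q02, q21,
        q12, q22, v0, v1, w0]; norm_num; done)
    | (refine (odd _ _ _ _ (by simp)).trans ?_; simp [delta]; done)

end

/-! ### Heat conductivity and viscosity -/

section

variable {b : ℝ → ℝ → ℝ}

theorem polyGrowth_A (i : Fin 3) : PolyGrowth (A i) :=
  ((PolyGrowth.normSq.sub (PolyGrowth.const 5)).const_mul (1 / 2)).mul (PolyGrowth.coord i)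

theorem polyGrowth_B (i j : Fin 3) : PolyGrowth (B i j) :=
  ((PolyGrowth.coord i).mul (PolyGrowth.coord j)).sub
    ((PolyGrowth.normSq.const_mul (1 / 3)).mul (PolyGrowth.const (delta i j)))

/-- `⟨h, L h⟩` is a quarter of the integral of the squared defect of `h`, so it is positive unless
`L h` vanishes. -/
theorem InKerPerp.pairM_pos (hb : IsCutoffKernel b) {h X : V3 → ℝ} (hh : InKerPerp b h)
    (hX : L b h =ᵐ[volume] X) (hpos : gaussMean (fun v => X v * X v) ≠ 0) : 0 < pairM h X := by
  have e : pairM h X = 1 / 4 * ∫ p, defect h p * defect h p ∂(collMeasure b) := by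
    rw [← hh.1.pairM_L hb hh.1, pairM_congr_left hX, pairM_comm]
  rw [e]
  have hnn : 0 ≤ᵐ[collMeasure b] fun p => defect h p * defect h p :=
    ae_of_all _ fun p => mul_self_nonneg _
  rcases (integral_nonneg_of_ae hnn).lt_or_eq with h0 | h0
  · positivity
  · exfalso
    have hint := integrable_mul_of_memLp (hh.1.memLp_defect hb) (hh.1.memLp_defect hb)
    have hz : defect h =ᵐ[collMeasure b] 0 := by
      filter_upwards [(integral_eq_zero_iff_of_nonneg_ae hnn hint).1 h0.symm] with p hp
      exact mul_self_eq_zero.1 hp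
    have hX0 : X =ᵐ[volume] 0 := by
      filter_upwards [hX, hh.1.L_eq hb, collAvg_congr hb hz] with v e1 e2 e3
      rw [← e1, e2, e3]
      simp [collAvg]
    apply hpos
    unfold gaussMean
    rw [← integral_zero V3 ℝ (μ := volume)]
    refine integral_congr_ae ?_
    filter_upwards [hX0] with v hv
    rw [hv]; simp

theorem gaussMean_A_self : gaussMean (fun v => A 0 v * A 0 v) = 5 / 2 := by
  have e : (fun v => A 0 v * A 0 v) = fun v => 1 / 4 * (‖v‖ ^ 2 * ‖v‖ ^ 2 * (v 0 * v 0)) -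
      5 / 2 * (‖v‖ ^ 2 * (v 0 * v 0)) + 25 / 4 * (v 0 * v 0) := by
    ext v; unfold A; ring
  have c := (PolyGrowth.coord 0).mul (PolyGrowth.coord 0)
  rw [e, gaussMean_add ((((PolyGrowth.normSq.mul PolyGrowth.normSq).mul c).const_mul _).sub
    ((PolyGrowth.normSq.mul c).const_mul _)) (c.const_mul _),
    gaussMean_sub (((PolyGrowth.normSq.mul PolyGrowth.normSq).mul c).const_mul _)
      ((PolyGrowth.normSq.mul c).const_mul _), gaussMean_const_mul, gaussMean_const_mul,
    gaussMean_const_mul, gaussMean_normSq_sq_coord_coord, gaussMean_normSq_coord_coord,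
    gaussMean_coord_coord]
  norm_num [delta]

theorem gaussMean_B_self : gaussMean (fun v => B 0 1 v * B 0 1 v) = 1 := by
  have e : (fun v => B 0 1 v * B 0 1 v) = fun v => v 0 * v 1 * (v 0 * v 1) := by
    ext v; simp [B, delta]
  rw [e, gaussMean_coord4]
  norm_num [delta]

/-- The matrix `⟨Â_i, A_j⟩` is isotropic. -/
theorem exists_conductivity (hb : IsCutoffKernel b) {Ahat : Fin 3 → V3 → ℝ}
    (hA : ∀ i, InKerPerp b (Ahat i) ∧ L b (Ahat i) =ᵐ[volume] A i) :
    ∃ κ : ℝ, 0 < κ ∧ ∀ i j, pairM (Ahat i) (A j) = 5 / 2 * κ * delta i j := by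
  refine ⟨2 / 5 * pairM (Ahat 0) (A 0), ?_, fun i j => ?_⟩
  · have := (hA 0).1.pairM_pos hb (hA 0).2 (by rw [gaussMean_A_self]; norm_num)
    positivity
  · rw [isotropic_two (T := fun i j => pairM (Ahat i) (A j)) (fun u _ i j =>
      InKerPerp.pairM_invariant hb hA (fun p => (polyGrowth_A p).inDomain hb) (axisRot u)
        (axisMat u) (fun p v => A_rot u v p) i j) i j]
    ring

theorem B_symm (i j : Fin 3) : B i j = B j i := by
  ext v; unfold B; rw [delta_comm]; ring

theorem sum_B (v : V3) : ∑ i, B i i v = 0 := by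
  unfold B
  rw [Finset.sum_sub_distrib, ← normSq_eq_sum, ← Finset.mul_sum, sum_delta_self]
  ring

/-- The tensor `⟨B̂_ij, B_kl⟩` is isotropic, symmetric and traceless in each pair of indices. -/
theorem exists_viscosity (hb : IsCutoffKernel b) {Bhat : Fin 3 → Fin 3 → V3 → ℝ}
    (hB : ∀ i j, InKerPerp b (Bhat i j) ∧ L b (Bhat i j) =ᵐ[volume] B i j) :
    ∃ ν : ℝ, 0 < ν ∧ ∀ i j k l, pairM (Bhat i j) (B k l) =
      ν * (delta i k * delta j l + delta i l * delta j k - 2 / 3 * delta i j * delta k l) := by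
  have hsymm : ∀ i j k l, pairM (Bhat i j) (B k l) = pairM (Bhat k l) (B i j) := by
    intro i j k l
    rw [← pairM_congr_right (hB k l).2, ← (hB i j).1.1.pairM_L_comm hb (hB k l).1.1,
      pairM_congr_left (hB i j).2, pairM_comm]
  have htr : ∀ i j, ∑ k, pairM (Bhat i j) (B k k) = 0 := by
    intro i j
    have := InDomain.pairM_sum hb Finset.univ (fun _ => 1) (h := fun k => B k k)
      (fun k => (polyGrowth_B k k).inDomain hb) (hB i j).1.1
    simp only [one_mul, sum_B] at this
    simp only [pairM_comm (Bhat i j), ← this]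
    simp [pairM]
  refine ⟨pairM (Bhat 0 1) (B 0 1), (hB 0 1).1.pairM_pos hb (hB 0 1).2
    (by rw [gaussMean_B_self]; norm_num), fun i j k l => ?_⟩
  refine isotropic_four (T := fun i j k l => pairM (Bhat i j) (B k l)) ?_ ?_ ?_ htr ?_ i j k l
  · intro u hu i j k l
    have := InKerPerp.pairM_invariant hb (ι := Fin 3 × Fin 3) (X := fun p => B p.1 p.2)
      (Xhat := fun p => Bhat p.1 p.2) (fun p => hB p.1 p.2)
      (fun p => (polyGrowth_B _ _).inDomain hb) (axisRot u)
      (fun p q => axisMat u p.1 q.1 * axisMat u p.2 q.2) (fun p v => B_rot hu v p) (i, j) (k, l)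
    simpa only [Fintype.sum_prod_type] using this
  · intro i j k l
    rw [hsymm, B_symm, ← hsymm]
  · intro i j k l
    rw [B_symm]
  · intro k l
    simp only [hsymm _ _ k l]
    exact htr k l

/-- By parity: `Â` is odd and `B` is even. -/
theorem pairM_Ahat_B (hb : IsCutoffKernel b) {Ahat : Fin 3 → V3 → ℝ}
    (hA : ∀ i, InKerPerp b (Ahat i) ∧ L b (Ahat i) =ᵐ[volume] A i) (i j k : Fin 3) :
    pairM (Ahat i) (B j k) = 0 := by
  have h1 := InKerPerp.rot_eq_sum hb hA (LinearIsometryEquiv.neg ℝ) (fun p q => -delta p q)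
    (fun p v => by
      simp only [neg_mul, Finset.sum_neg_distrib, sum_delta_mul]
      simp [A]) i
  have h2 := pairM_rot (LinearIsometryEquiv.neg ℝ) (Ahat i) (B j k)
  have h3 : (fun w => B j k (LinearIsometryEquiv.neg ℝ w)) = B j k := by
    ext v; simp [B]
  rw [h3, pairM_congr_left h1] at h2
  simp only [neg_mul, Finset.sum_neg_distrib, sum_delta_mul] at h2
  have h4 := pairM_const_mul_left (-1) (Ahat i) (B j k)
  simp only [neg_mul, one_mul] at h4
  linarith

theorem pairM_Bhat_A (hb : IsCutoffKernel b) {Ahat : Fin 3 → V3 → ℝ} {Bhat : Fin 3 → Fin 3 → V3 → ℝ}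
    (hA : ∀ i, InKerPerp b (Ahat i) ∧ L b (Ahat i) =ᵐ[volume] A i)
    (hB : ∀ i j, InKerPerp b (Bhat i j) ∧ L b (Bhat i j) =ᵐ[volume] B i j) (i j k : Fin 3) :
    pairM (Bhat i j) (A k) = 0 := by
  rw [← pairM_congr_right (hA k).2, ← (hB i j).1.1.pairM_L_comm hb (hA k).1.1,
    pairM_congr_left (hB i j).2, pairM_comm, pairM_Ahat_B hb hA]

end

/-! ### Moments of infinitesimal Maxwellians -/

section

variable {b : ℝ → ℝ → ℝ}

theorem pairM_quadInv (a : ℝ) (c : Fin 3 → ℝ) (d : ℝ) {F : V3 → ℝ} (hF : PolyGrowth F) :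
    pairM (quadInv a c d) F = a * gaussMean F + ∑ i, c i * gaussMean (fun v => v i * F v) +
      d * gaussMean (fun v => ‖v‖ ^ 2 * F v) := by
  have e : pairM (quadInv a c d) F = gaussMean fun v =>
      a * F v + ∑ i, c i * (v i * F v) + d * (‖v‖ ^ 2 * F v) := by
    unfold pairM gaussMean quadInv
    congr 1; ext v
    simp only [add_mul, Finset.sum_mul, mul_assoc]
  have h1 := hF.const_mul a
  have h2 := fun i => ((PolyGrowth.coord i).mul hF).const_mul (c i)
  have h3 := (PolyGrowth.normSq.mul hF).const_mul d
  rw [e, gaussMean_add (h1.add (PolyGrowth.sum _ h2)) h3, gaussMean_add h1 (PolyGrowth.sum _ h2),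
    gaussMean_sum _ h2]
  simp only [gaussMean_const_mul]

theorem pairM_quadInv_sq (a : ℝ) (c : Fin 3 → ℝ) (d : ℝ) {F : V3 → ℝ} (hF : PolyGrowth F) :
    pairM (fun v => quadInv a c d v ^ 2) F = a ^ 2 * gaussMean F +
      2 * a * ∑ i, c i * gaussMean (fun v => v i * F v) +
      2 * a * d * gaussMean (fun v => ‖v‖ ^ 2 * F v) +
      ∑ i, ∑ j, c i * c j * gaussMean (fun v => v j * (v i * F v)) +
      2 * d * ∑ i, c i * gaussMean (fun v => v i * (‖v‖ ^ 2 * F v)) +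
      d ^ 2 * gaussMean (fun v => ‖v‖ ^ 2 * (‖v‖ ^ 2 * F v)) := by
  have key : ∀ {G : V3 → ℝ}, PolyGrowth G → gaussMean (fun v => quadInv a c d v * G v) =
      a * gaussMean G + ∑ i, c i * gaussMean (fun v => v i * G v) +
        d * gaussMean (fun v => ‖v‖ ^ 2 * G v) := fun hG => pairM_quadInv a c d hG
  have e : pairM (fun v => quadInv a c d v ^ 2) F =
      gaussMean fun v => quadInv a c d v * (quadInv a c d v * F v) := by
    unfold pairM gaussMean
    congr 1; ext v; ring
  have sw1 : ∀ i, gaussMean (fun v => v i * (quadInv a c d v * F v)) =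
      gaussMean fun v => quadInv a c d v * (v i * F v) := fun i => by
    congr 1; ext v; ring
  have sw2 : gaussMean (fun v => ‖v‖ ^ 2 * (quadInv a c d v * F v)) =
      gaussMean fun v => quadInv a c d v * (‖v‖ ^ 2 * F v) := by
    congr 1; ext v; ring
  have sw3 : ∀ i, gaussMean (fun v => ‖v‖ ^ 2 * (v i * F v)) =
      gaussMean fun v => v i * (‖v‖ ^ 2 * F v) := fun i => by
    congr 1; ext v; ring
  rw [e, key ((polyGrowth_quadInv a c d).mul hF), key hF, sw2,
    key (PolyGrowth.normSq.mul hF)]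
  simp only [sw1, key ((PolyGrowth.coord _).mul hF), sw3]
  simp only [mul_add, Finset.sum_add_distrib, Finset.mul_sum]
  have e1 : ∀ i, c i * (a * gaussMean fun v => v i * F v) =
      a * (c i * gaussMean fun v => v i * F v) := fun i => by ring
  have e2 : ∀ i, c i * (d * gaussMean fun v => v i * (‖v‖ ^ 2 * F v)) =
      d * (c i * gaussMean fun v => v i * (‖v‖ ^ 2 * F v)) := fun i => by ring
  simp only [e1, e2, ← Finset.mul_sum, mul_assoc]
  ring

theorem gaussMean_A_mul_coord (i j : Fin 3) : gaussMean (fun v => v j * A i v) = 0 := by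
  have e : (fun v : V3 => v j * A i v) = fun v => 1 / 2 * (‖v‖ ^ 2 * (v j * v i)) -
      5 / 2 * (v j * v i) := by
    ext v; unfold A; ring
  have c := (PolyGrowth.coord j).mul (PolyGrowth.coord i)
  rw [e, gaussMean_sub ((PolyGrowth.normSq.mul c).const_mul _) (c.const_mul _),
    gaussMean_const_mul, gaussMean_const_mul, gaussMean_normSq_coord_coord, gaussMean_coord_coord]
  ring

theorem gaussMean_A_mul_coord_normSq (i j : Fin 3) :
    gaussMean (fun v => v j * (‖v‖ ^ 2 * A i v)) = 5 * delta j i := by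
  have e : (fun v : V3 => v j * (‖v‖ ^ 2 * A i v)) = fun v =>
      1 / 2 * (‖v‖ ^ 2 * ‖v‖ ^ 2 * (v j * v i)) - 5 / 2 * (‖v‖ ^ 2 * (v j * v i)) := by
    ext v; unfold A; ring
  have c := (PolyGrowth.coord j).mul (PolyGrowth.coord i)
  rw [e, gaussMean_sub (((PolyGrowth.normSq.mul PolyGrowth.normSq).mul c).const_mul _)
    ((PolyGrowth.normSq.mul c).const_mul _),
    gaussMean_const_mul, gaussMean_const_mul, gaussMean_normSq_sq_coord_coord,
    gaussMean_normSq_coord_coord]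
  ring

theorem A_neg (i : Fin 3) (v : V3) : A i (-v) = -A i v := by simp [A]

theorem pairM_quadInv_sq_A (a : ℝ) (c : Fin 3 → ℝ) (d : ℝ) (i : Fin 3) :
    pairM (fun v => quadInv a c d v ^ 2) (A i) = 10 * d * c i := by
  have o0 : gaussMean (A i) = 0 := gaussMean_odd fun v => A_neg i v
  have o1 : gaussMean (fun v => ‖v‖ ^ 2 * A i v) = 0 :=
    gaussMean_odd fun v => by simp [A_neg]
  have o2 : ∀ k l : Fin 3, gaussMean (fun v => v l * (v k * A i v)) = 0 := fun k l =>
    gaussMean_odd fun v => by simp [A_neg]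
  have o3 : gaussMean (fun v => ‖v‖ ^ 2 * (‖v‖ ^ 2 * A i v)) = 0 :=
    gaussMean_odd fun v => by simp [A_neg]
  rw [pairM_quadInv_sq a c d (polyGrowth_A i)]
  simp only [o0, o1, o2, o3, gaussMean_A_mul_coord, gaussMean_A_mul_coord_normSq]
  have : ∀ k, c k * (5 * delta k i) = delta i k * (5 * c k) := fun k => by
    rw [delta_comm]; ring
  simp only [this, sum_delta_mul]
  simp; ring

theorem gaussMean_normSq_pow_three : gaussMean (fun v => ‖v‖ ^ 2 * (‖v‖ ^ 2 * ‖v‖ ^ 2)) = 105 := by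
  rw [gaussMean_normSq_mul (PolyGrowth.normSq.mul PolyGrowth.normSq)]
  have : ∀ k : Fin 3, gaussMean (fun v => v k * v k * (‖v‖ ^ 2 * ‖v‖ ^ 2)) = 35 * delta k k := by
    intro k
    rw [← gaussMean_normSq_sq_coord_coord]
    congr 1; ext v; ring
  simp only [this, ← Finset.mul_sum, sum_delta_self]
  norm_num

theorem gaussMean_B (i j : Fin 3) : gaussMean (B i j) = 0 := by
  have e : B i j = fun v => v i * v j - 1 / 3 * delta i j * ‖v‖ ^ 2 := by
    ext v; unfold B; ring
  rw [e, gaussMean_sub ((PolyGrowth.coord i).mul (PolyGrowth.coord j))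
    (PolyGrowth.normSq.const_mul _), gaussMean_const_mul, gaussMean_coord_coord, gaussMean_normSq]
  ring

theorem gaussMean_normSq_B (i j : Fin 3) : gaussMean (fun v => ‖v‖ ^ 2 * B i j v) = 0 := by
  have e : (fun v => ‖v‖ ^ 2 * B i j v) = fun v => ‖v‖ ^ 2 * (v i * v j) -
      1 / 3 * delta i j * (‖v‖ ^ 2 * ‖v‖ ^ 2) := by
    ext v; unfold B; ring
  rw [e, gaussMean_sub (PolyGrowth.normSq.mul ((PolyGrowth.coord i).mul (PolyGrowth.coord j)))
    ((PolyGrowth.normSq.mul PolyGrowth.normSq).const_mul _), gaussMean_const_mul,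
    gaussMean_normSq_coord_coord, gaussMean_normSq_sq]
  ring

theorem gaussMean_normSq_sq_B (i j : Fin 3) :
    gaussMean (fun v => ‖v‖ ^ 2 * (‖v‖ ^ 2 * B i j v)) = 0 := by
  have e : (fun v => ‖v‖ ^ 2 * (‖v‖ ^ 2 * B i j v)) = fun v =>
      ‖v‖ ^ 2 * ‖v‖ ^ 2 * (v i * v j) - 1 / 3 * delta i j * (‖v‖ ^ 2 * (‖v‖ ^ 2 * ‖v‖ ^ 2)) := by
    ext v; unfold B; ring
  have n := PolyGrowth.normSq.mul PolyGrowth.normSq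
  rw [e, gaussMean_sub (n.mul ((PolyGrowth.coord i).mul (PolyGrowth.coord j)))
    ((PolyGrowth.normSq.mul n).const_mul _), gaussMean_const_mul,
    gaussMean_normSq_sq_coord_coord, gaussMean_normSq_pow_three]
  ring

theorem gaussMean_coord_coord_B (i j k l : Fin 3) :
    gaussMean (fun v => v l * (v k * B i j v)) =
      delta i k * delta j l + delta i l * delta j k - 2 / 3 * delta i j * delta k l := by
  have e : (fun v : V3 => v l * (v k * B i j v)) = fun v => v i * v j * (v k * v l) -
      1 / 3 * delta i j * (‖v‖ ^ 2 * (v k * v l)) := by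
    ext v; unfold B; ring
  have c := (PolyGrowth.coord k).mul (PolyGrowth.coord l)
  rw [e, gaussMean_sub (((PolyGrowth.coord i).mul (PolyGrowth.coord j)).mul c)
    ((PolyGrowth.normSq.mul c).const_mul _), gaussMean_const_mul, gaussMean_coord4,
    gaussMean_normSq_coord_coord]
  ring

theorem pairM_quadInv_sq_B (a : ℝ) (c : Fin 3 → ℝ) (d : ℝ) (i j : Fin 3) :
    pairM (fun v => quadInv a c d v ^ 2) (B i j) =
      2 * (c i * c j - 1 / 3 * (∑ k, c k * c k) * delta i j) := by
  have hB : ∀ v, B i j (-v) = B i j v := fun v => by simp [B]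
  have o1 : ∀ k : Fin 3, gaussMean (fun v => v k * B i j v) = 0 := fun k =>
    gaussMean_odd fun v => by simp [hB]
  have o2 : ∀ k : Fin 3, gaussMean (fun v => v k * (‖v‖ ^ 2 * B i j v)) = 0 := fun k =>
    gaussMean_odd fun v => by simp [hB]
  rw [pairM_quadInv_sq a c d (polyGrowth_B i j)]
  simp only [o1, o2, gaussMean_B, gaussMean_normSq_B, gaussMean_normSq_sq_B,
    gaussMean_coord_coord_B]
  have e : ∀ k l, c k * c l *
      (delta i k * delta j l + delta i l * delta j k - 2 / 3 * delta i j * delta k l) =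
      delta i k * (delta j l * (c k * c l)) + delta i l * (delta j k * (c k * c l)) -
        2 / 3 * delta i j * (delta k l * (c k * c l)) := fun k l => by ring
  simp only [e, Finset.sum_add_distrib, Finset.sum_sub_distrib, ← Finset.mul_sum, sum_delta_mul]
  simp; ring

/-- The momentum flux of an infinitesimal Maxwellian, decomposed along `B`, `A` and the collision
invariants. -/
theorem coord_mul_quadInv (a : ℝ) (c : Fin 3 → ℝ) (d : ℝ) (j : Fin 3) (v : V3) :
    v j * quadInv a c d v = (∑ l, c l * B j l v) + 2 * d * A j v +
      quadInv 0 (fun l => delta j l * (a + 5 * d)) (1 / 3 * c j) v := by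
  unfold quadInv B A
  have e1 : ∀ l, c l * (v j * v l - 1 / 3 * ‖v‖ ^ 2 * delta j l) =
      v j * (c l * v l) - delta j l * (1 / 3 * ‖v‖ ^ 2 * c l) := fun l => by ring
  have e2 : ∑ l, delta j l * (a + 5 * d) * v l = (a + 5 * d) * v j := by
    simp only [mul_assoc, sum_delta_mul]
  simp only [e1, e2, Finset.sum_sub_distrib, sum_delta_mul, ← Finset.mul_sum]
  ring

/-- Elements of `Ker^⊥ L` only see the components along `A` and `B` of a momentum flux. -/
theorem InKerPerp.pairM_mul_coord (hb : IsCutoffKernel b) {h X : V3 → ℝ} (hX : InKerPerp b X)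
    {a : ℝ} {c : Fin 3 → ℝ} {d : ℝ} (e : h =ᵐ[volume] quadInv a c d) (j : Fin 3) :
    pairM h (fun v => X v * v j) = (∑ l, c l * pairM X (B j l)) + 2 * d * pairM X (A j) := by
  have e1 : pairM h (fun v => X v * v j) = pairM X (fun v => (∑ l, c l * B j l v) +
      2 * d * A j v + quadInv 0 (fun l => delta j l * (a + 5 * d)) (1 / 3 * c j) v) := by
    rw [pairM_congr_left e]
    unfold pairM
    congr 1; ext v
    simp only [← coord_mul_quadInv]
    ring
  have d1 := InDomain.sum hb Finset.univ c fun l => (polyGrowth_B j l).inDomain hb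
  have d2 := ((polyGrowth_A j).inDomain hb).const_mul (2 * d)
  have d3 := (polyGrowth_quadInv 0 (fun l => delta j l * (a + 5 * d)) (1 / 3 * c j)).inDomain hb
  rw [e1, hX.1.pairM_add_right hb (d1.add hb d2) d3, hX.1.pairM_add_right hb d1 d2,
    hX.2 _ (d3.inKer hb (defect_quadInv _ _ _)), pairM_const_mul_right, pairM_comm X,
    InDomain.pairM_sum hb _ _ (fun l => (polyGrowth_B j l).inDomain hb) hX.1]
  simp only [pairM_comm X, add_zero]

/-- `⟨Γ(h,h), X⟩ = ⟨h², L X⟩ / 2` for infinitesimal Maxwellians. -/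
theorem pairM_Gam_of_quadInv (hb : IsCutoffKernel b) {h X F : V3 → ℝ} (hX : InDomain b X)
    (hF : L b X =ᵐ[volume] F) {a : ℝ} {c : Fin 3 → ℝ} {d : ℝ} (e : h =ᵐ[volume] quadInv a c d) :
    pairM (Gam b h) X = 1 / 2 * pairM (fun v => quadInv a c d v ^ 2) F := by
  rw [pairM_congr_left (Gam_of_collisionInvariant hb e (polyGrowth_quadInv a c d)
    (defect_quadInv a c d)), pairM_const_mul_left,
    (((polyGrowth_quadInv a c d).pow 2).inDomain hb).pairM_L_comm hb hX, pairM_congr_right hF]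

theorem pairM_quadInv_one (a : ℝ) (c : Fin 3 → ℝ) (d : ℝ) :
    pairM (quadInv a c d) (fun _ => 1) = a + 3 * d := by
  rw [pairM_quadInv a c d (PolyGrowth.const 1)]
  simp only [mul_one, gaussMean_one, gaussMean_coord, gaussMean_normSq]
  simp; ring

theorem pairM_quadInv_coord (a : ℝ) (c : Fin 3 → ℝ) (d : ℝ) (i : Fin 3) :
    pairM (quadInv a c d) (fun v => v i) = c i := by
  have o : gaussMean (fun v => ‖v‖ ^ 2 * v i) = 0 := gaussMean_odd fun v => by simp
  rw [pairM_quadInv a c d (PolyGrowth.coord i)]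
  have : ∀ k, c k * delta k i = delta i k * c k := fun k => by rw [delta_comm]; ring
  simp only [o, gaussMean_coord, gaussMean_coord_coord, this, sum_delta_mul]
  ring

theorem pairM_quadInv_coord_coord (a : ℝ) (c : Fin 3 → ℝ) (d : ℝ) (i j : Fin 3) :
    pairM (quadInv a c d) (fun v => v i * v j) = (a + 5 * d) * delta i j := by
  have o : ∀ k : Fin 3, gaussMean (fun v => v k * (v i * v j)) = 0 := fun k =>
    gaussMean_odd fun v => by simp
  rw [pairM_quadInv a c d ((PolyGrowth.coord i).mul (PolyGrowth.coord j))]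
  simp only [o, gaussMean_coord_coord, gaussMean_normSq_coord_coord]
  simp; ring

theorem pairM_quadInv_normSq (a : ℝ) (c : Fin 3 → ℝ) (d : ℝ) :
    pairM (quadInv a c d) (fun v => ‖v‖ ^ 2) = 3 * (a + 5 * d) := by
  have o : ∀ k : Fin 3, gaussMean (fun v => v k * ‖v‖ ^ 2) = 0 := fun k =>
    gaussMean_odd fun v => by simp
  rw [pairM_quadInv a c d PolyGrowth.normSq]
  simp only [o, gaussMean_normSq, gaussMean_normSq_sq]
  simp; ring

end

/-! ### Test functions -/

section

variable {b : ℝ → ℝ → ℝ}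

section TestFunctions

variable {E : Type*} [NormedAddCommGroup E] [NormedSpace ℝ E] {U : Opens E}

/-- The product of a test function with a smooth function. -/
def mulTest (m : E → ℝ) (hm : ContDiff ℝ (⊤ : ℕ∞) m) (φ : 𝓓(U, ℝ)) : 𝓓(U, ℝ) :=
  ⟨fun z => m z * φ z, hm.mul φ.contDiff, φ.hasCompactSupport.mul_left,
    (tsupport_mul_subset_right).trans φ.tsupport_subset⟩

theorem hasFDerivAt_test (φ : 𝓓(U, ℝ)) (z : E) : HasFDerivAt φ (fderiv ℝ φ z) z :=
  (φ.contDiff.differentiable (by simp)).differentiableAt.hasFDerivAt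

theorem lineDeriv_test_apply (φ : 𝓓(U, ℝ)) (w z : E) : (∂_{w} φ) z = fderiv ℝ φ z w := by
  rw [TestFunction.lineDerivOp_eq_lineDerivCLM ℝ, TestFunction.lineDerivCLM_apply_of_le (by simp)]
  exact (hasFDerivAt_test φ z).differentiableAt.lineDeriv_eq_fderiv

variable [MeasureSpace E] [BorelSpace E]

theorem integrable_mul_test {F : E → ℝ} (hF : LocallyIntegrableOn F U) (φ : 𝓓(U, ℝ)) :
    Integrable fun z => F z * φ z :=
  φ.integrable_bilin (ContinuousLinearMap.mul ℝ ℝ).flip hF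

theorem integrable_test [IsLocallyFiniteMeasure (volume : Measure E)] (φ : 𝓓(U, ℝ)) :
    Integrable φ :=
  φ.continuous.integrable_of_hasCompactSupport φ.hasCompactSupport

theorem integral_lineDeriv_test [FiniteDimensional ℝ E] [(volume : Measure E).IsAddHaarMeasure]
    (φ : 𝓓(U, ℝ)) (w : E) : ∫ z, (∂_{w} φ) z = 0 := by
  have := integral_bilinear_hasLineDerivAt_right_eq_neg_left_of_integrable
    (μ := (volume : Measure E)) (f := fun _ : E => (1 : ℝ)) (f' := fun _ => 0) (g := φ)
    (g' := fun z => fderiv ℝ φ z w) (v := w) (B := ContinuousLinearMap.mul ℝ ℝ)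
    (by simp) (by
      have h := integrable_test (∂_{w} φ)
      simp only [funext (lineDeriv_test_apply φ w)] at h
      simpa using h) (by simpa using integrable_test φ)
    (fun x _ => by simpa using (hasFDerivAt_const (𝕜 := ℝ) (1 : ℝ) x).hasLineDerivAt w)
    (fun x _ => (hasFDerivAt_test φ x).hasLineDerivAt w)
  simpa [lineDeriv_test_apply] using this

end TestFunctions

instance : (volume : Measure SpaceTime).IsAddHaarMeasure :=
  inferInstanceAs ((volume : Measure ℝ).prod (volume : Measure V3)).IsAddHaarMeasure

instance : (volume : Measure (SpaceTime × V3)).IsAddHaarMeasure :=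
  Measure.prod.instIsAddHaarMeasure (volume : Measure SpaceTime) (volume : Measure V3)

/-- The time direction in space-time. -/
def dt : SpaceTime := (1, 0)

theorem spaceTime_eq_sum (s : ℝ) (v : V3) : ((s, v) : SpaceTime) = s • dt + ∑ j, v j • dx j := by
  have hv : v = ∑ j, v j • EuclideanSpace.single j (1 : ℝ) := by
    ext i
    fin_cases i <;> simp [Fin.sum_univ_three]
  ext1
  · simp [dt, dx, Prod.fst_sum]
  · simp only [dt, dx, Prod.snd_add, Prod.smul_snd, smul_zero, zero_add, Prod.snd_sum]
    exact hv

theorem fderiv_spaceTime (φ' : SpaceTime →L[ℝ] ℝ) (s : ℝ) (v : V3) :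
    φ' (s, v) = s * φ' dt + ∑ j, v j * φ' (dx j) := by
  rw [spaceTime_eq_sum, map_add, map_sum, map_smul]
  simp only [map_smul, smul_eq_mul]

theorem fderiv_phase (φ' : SpaceTime × V3 →L[ℝ] ℝ) (s : ℝ) (v : V3) :
    φ' ((s, v), 0) = s * φ' (dt, 0) + ∑ j, v j * φ' (dx j, 0) :=
  fderiv_spaceTime (φ'.comp (ContinuousLinearMap.inl ℝ SpaceTime V3)) s v

variable {I : Opens ℝ}

/-- The test function `φ ⊗ χ`. -/
def tensorTest (φ : 𝓓(spaceTime I, ℝ)) (χ : V3 → ℝ) (hχ : ContDiff ℝ (⊤ : ℕ∞) χ)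
    (hc : HasCompactSupport χ) : 𝓓(phase I, ℝ) :=
  have hsub : tsupport (fun z : SpaceTime × V3 => φ z.1 * χ z.2) ⊆ tsupport φ ×ˢ tsupport χ := by
    refine closure_minimal (fun z hz => ?_) ((isClosed_tsupport _).prod (isClosed_tsupport _))
    exact ⟨subset_tsupport _ (left_ne_zero_of_mul hz), subset_tsupport _ (right_ne_zero_of_mul hz)⟩
  ⟨fun z => φ z.1 * χ z.2, (φ.contDiff.comp contDiff_fst).mul (hχ.comp contDiff_snd),
    (φ.hasCompactSupport.isCompact.prod hc.isCompact).of_isClosed_subset (isClosed_tsupport _) hsub,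
    hsub.trans (Set.prod_mono φ.tsupport_subset (Set.subset_univ _))⟩

theorem fderiv_tensorTest (φ : 𝓓(spaceTime I, ℝ)) {χ : V3 → ℝ} (hχ : ContDiff ℝ (⊤ : ℕ∞) χ)
    (hc : HasCompactSupport χ) (z : SpaceTime × V3) (w : SpaceTime) :
    fderiv ℝ (tensorTest φ χ hχ hc) z (w, 0) = fderiv ℝ φ z.1 w * χ z.2 := by
  have h1 := (hasFDerivAt_test φ z.1).comp z hasFDerivAt_fst
  have h2 := ((hχ.differentiable (by simp)).differentiableAt.hasFDerivAt (x := z.2)).comp z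
    hasFDerivAt_snd
  have h3 : HasFDerivAt (tensorTest φ χ hχ hc) _ z := h1.mul h2
  rw [h3.fderiv]
  simp [mul_comm]

/-- The product of a test function with a smooth function of the velocity. -/
def velTest (m : V3 → ℝ) (hm : ContDiff ℝ (⊤ : ℕ∞) m) (φ : 𝓓(phase I, ℝ)) : 𝓓(phase I, ℝ) :=
  mulTest (fun z : SpaceTime × V3 => m z.2) (hm.comp contDiff_snd) φ

@[simp]
theorem velTest_apply (m : V3 → ℝ) (hm : ContDiff ℝ (⊤ : ℕ∞) m) (φ : 𝓓(phase I, ℝ))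
    (z : SpaceTime × V3) : velTest m hm φ z = m z.2 * φ z := rfl

theorem fderiv_velTest {m : V3 → ℝ} (hm : ContDiff ℝ (⊤ : ℕ∞) m) (φ : 𝓓(phase I, ℝ))
    (z : SpaceTime × V3) (w : SpaceTime) :
    fderiv ℝ (velTest m hm φ) z (w, 0) = m z.2 * fderiv ℝ φ z (w, 0) := by
  have h2 := ((hm.differentiable (by simp)).differentiableAt.hasFDerivAt (x := z.2)).comp z
    hasFDerivAt_snd
  have h3 : HasFDerivAt (velTest m hm φ) _ z := h2.mul (hasFDerivAt_test φ z)
  rw [h3.fderiv]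
  simp

theorem contDiff_coord (j : Fin 3) : ContDiff ℝ (⊤ : ℕ∞) fun v : V3 => v j :=
  (EuclideanSpace.proj (𝕜 := ℝ) j).contDiff

/-- The free transport operator applied to a test function. -/
def transport (ε : ℝ) (φ : 𝓓(phase I, ℝ)) : 𝓓(phase I, ℝ) :=
  ε • (∂_{((dt, 0) : SpaceTime × V3)} φ) +
    ∑ j : Fin 3, ∂_{((dx j, 0) : SpaceTime × V3)} (velTest (fun v => v j) (contDiff_coord j) φ)

theorem transport_apply' (ε : ℝ) (φ : 𝓓(phase I, ℝ)) (z : SpaceTime × V3) :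
    transport ε φ z = ε * (∂_{((dt, 0) : SpaceTime × V3)} φ) z + ∑ j : Fin 3,
      (∂_{((dx j, 0) : SpaceTime × V3)} (velTest (fun v => v j) (contDiff_coord j) φ)) z := by
  simp only [transport, FunLike.coe_add, FunLike.coe_sum, FunLike.coe_smul, Pi.add_apply,
    Finset.sum_apply, Pi.smul_apply, smul_eq_mul]

theorem transport_apply (ε : ℝ) (φ : 𝓓(phase I, ℝ)) (z : SpaceTime × V3) :
    transport ε φ z = fderiv ℝ φ z ((ε, z.2), 0) := by
  rw [fderiv_phase, transport_apply']
  simp only [lineDeriv_test_apply, fderiv_velTest]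

theorem integral_transport (ε : ℝ) (φ : 𝓓(phase I, ℝ)) : ∫ z, transport ε φ z = 0 := by
  simp only [transport_apply']
  rw [integral_add ((integrable_test _).const_mul ε)
    (integrable_finsetSum _ fun j _ => integrable_test _), integral_const_mul,
    integral_finsetSum _ fun j _ => integrable_test _, integral_lineDeriv_test]
  simp only [integral_lineDeriv_test]
  simp

end

/-! ### Moments in velocity -/

section

variable {b : ℝ → ℝ → ℝ} {I : Opens ℝ}

/-- A property that holds almost everywhere on every compact subset of an open set holds almost
everywhere on this set. -/
theorem ae_mem_of_forall_compact {U : Opens SpaceTime} {P : SpaceTime → Prop}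
    (h : ∀ K : Set SpaceTime, IsCompact K → K ⊆ U → ∀ᵐ y ∂(volume.restrict K), P y) :
    ∀ᵐ y, y ∈ U → P y := by
  rw [ae_iff]
  refine measure_null_of_locally_null _ fun y hy => ?_
  have hyU : y ∈ U := by
    by_contra hn
    exact hy fun h' => absurd h' hn
  obtain ⟨K, hK, hyK, hKU⟩ := exists_compact_subset U.isOpen hyU
  refine ⟨K ∩ {a | ¬(a ∈ U → P a)}, ?_, ?_⟩
  · rw [Set.inter_comm]
    exact inter_mem_nhdsWithin _ (mem_interior_iff_mem_nhds.1 hyK)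
  have := h K hK hKU
  rw [ae_restrict_iff' hK.measurableSet, ae_iff] at this
  refine measure_mono_null ?_ this
  rintro z ⟨h1, h2⟩
  simp only [Set.mem_ofPred_eq, Classical.not_imp] at h2 ⊢
  exact ⟨h1, h2.2⟩

theorem restrict_prod_univ (K : Set SpaceTime) :
    (volume : Measure (SpaceTime × V3)).restrict (K ×ˢ Set.univ) =
      ((volume : Measure SpaceTime).restrict K).prod (volume : Measure V3) := by
  conv_rhs => rw [← Measure.restrict_univ (μ := (volume : Measure V3))]
  rw [Measure.prod_restrict]
  rfl

theorem LocL2.ae_integrable {wt : V3 → ℝ} {h : SpaceTime → V3 → ℝ} (hh : LocL2 b I wt h) :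
    ∀ᵐ y, y ∈ spaceTime I → Integrable fun v => wt v * (1 + freq b v) * h y v ^ 2 * M v := by
  refine ae_mem_of_forall_compact fun K hK hKI => ?_
  have := hh.2 K hK hKI
  rw [IntegrableOn, restrict_prod_univ] at this
  exact this.prod_right_ae

theorem LocL2.measurable_apply {wt : V3 → ℝ} {h : SpaceTime → V3 → ℝ} (hh : LocL2 b I wt h)
    (y : SpaceTime) : Measurable (h y) := hh.1.comp measurable_prodMk_left

theorem LocL2.of_weight (hb : IsCutoffKernel b) {wt : V3 → ℝ} {h : SpaceTime → V3 → ℝ}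
    (hh : LocL2 b I wt h) (hwt : ∀ v, 1 ≤ wt v) : LocL2 b I (fun _ => 1) h := by
  refine ⟨hh.1, fun K hK hKI => (hh.2 K hK hKI).mono' ?_ (ae_of_all _ fun z => ?_)⟩
  · have h1 : Measurable fun z : SpaceTime × V3 => freq b z.2 :=
      (measurable_freq hb).comp measurable_snd
    have h2 : Measurable fun z : SpaceTime × V3 => M z.2 := measurable_M.comp measurable_snd
    exact (((measurable_const.add h1).const_mul 1).mul (hh.1.pow_const 2)).mul h2
      |>.aestronglyMeasurable
  · have h1 := freq_nonneg hb z.2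
    have h2 := M_pos z.2
    have h3 : 0 ≤ (1 + freq b z.2) * h z.1 z.2 ^ 2 * M z.2 := by positivity
    rw [one_mul, Real.norm_of_nonneg h3]
    nlinarith [hwt z.2]

theorem LocL2.ae_inDomain {h : SpaceTime → V3 → ℝ} (hh : LocL2 b I (fun _ => 1) h) :
    ∀ᵐ y, y ∈ spaceTime I → InDomain b (h y) := by
  filter_upwards [hh.ae_integrable] with y hy hyI
  exact ⟨hh.measurable_apply y, by simpa using hy hyI⟩

theorem HasMoment.add {h k : SpaceTime → V3 → ℝ} {ψ : V3 → ℝ} (hh : HasMoment I h ψ)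
    (hk : HasMoment I k ψ) : HasMoment I (fun y v => h y v + k y v) ψ := by
  intro K hK hKI
  refine ((hh K hK hKI).add (hk K hK hKI)).congr (ae_of_all _ fun z => ?_)
  simp only [Pi.add_apply]; ring

theorem HasMoment.const_mul (c : ℝ) {h : SpaceTime → V3 → ℝ} {ψ : V3 → ℝ} (hh : HasMoment I h ψ) :
    HasMoment I (fun y v => c * h y v) ψ := by
  intro K hK hKI
  refine ((hh K hK hKI).const_mul c).congr (ae_of_all _ fun z => ?_)
  ring

theorem HasMoment.integrable {h : SpaceTime → V3 → ℝ} {ψ : V3 → ℝ} (hh : HasMoment I h ψ)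
    (φ : 𝓓(spaceTime I, ℝ)) :
    Integrable fun z : SpaceTime × V3 => h z.1 z.2 * ψ z.2 * M z.2 * φ z.1 := by
  obtain ⟨C, hC⟩ := φ.continuous.bounded_above_of_compact_support φ.hasCompactSupport
  have h1 := hh _ φ.hasCompactSupport.isCompact φ.tsupport_subset
  have h2 : IntegrableOn (fun z : SpaceTime × V3 => h z.1 z.2 * ψ z.2 * M z.2 * φ z.1)
      (tsupport φ ×ˢ Set.univ) :=
    Integrable.mul_bdd (c := C) h1 (φ.continuous.comp continuous_fst).aestronglyMeasurable
      (ae_of_all _ fun z => hC z.1)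
  rwa [integrableOn_iff_integrable_of_support_subset] at h2
  intro z hz
  exact ⟨subset_tsupport _ (right_ne_zero_of_mul hz), trivial⟩

theorem HasMoment.integral_eq {h : SpaceTime → V3 → ℝ} {ψ : V3 → ℝ} (hh : HasMoment I h ψ)
    (φ : 𝓓(spaceTime I, ℝ)) :
    ∫ z : SpaceTime × V3, h z.1 z.2 * ψ z.2 * M z.2 * φ z.1 = ∫ y, moment h ψ y * φ y := by
  rw [Measure.volume_eq_prod, integral_prod _ (hh.integrable φ)]
  simp only [integral_mul_const]
  rfl

/-- Integration in velocity of a kinetic equation in weak form. The weight `ψ M` is not compactly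
supported, but no cutoff is needed: testing with tensor products shows that the equation tested
with `φ` holds for almost every velocity, and this can be integrated against `ψ M`. -/
theorem moment_equation {ε : ℝ} {g S : SpaceTime → V3 → ℝ}
    (hw : ∀ Φ : 𝓓(phase I, ℝ), ∫ z : SpaceTime × V3, (g z.1 z.2 * fderiv ℝ Φ z ((ε, z.2), 0) +
      S z.1 z.2 * Φ z) = 0)
    (h1 : HasMoment I g fun _ => 1) (h1v : ∀ j, HasMoment I g fun v => 1 * v j)
    (hS1 : HasMoment I S fun _ => 1) {ψ : V3 → ℝ} (hψ : HasMoment I g ψ)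
    (hψv : ∀ j, HasMoment I g fun v => ψ v * v j) (hSψ : HasMoment I S ψ)
    (φ : 𝓓(spaceTime I, ℝ)) :
    ε * (∫ y, moment g ψ y * (∂_{dt} φ) y) +
      (∑ j, ∫ y, moment g (fun v => ψ v * v j) y * (∂_{dx j} φ) y) +
      ∫ y, moment S ψ y * φ y = 0 := by
  set H : SpaceTime × V3 → ℝ := fun z => g z.1 z.2 * (ε * (∂_{dt} φ) z.1 +
    ∑ j, z.2 j * (∂_{dx j} φ) z.1) + S z.1 z.2 * φ z.1 with hH
  have eH : ∀ (ψ : V3 → ℝ) z, H z * ψ z.2 * M z.2 =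
      ε * (g z.1 z.2 * ψ z.2 * M z.2 * (∂_{dt} φ) z.1) +
      ∑ j, g z.1 z.2 * (ψ z.2 * z.2 j) * M z.2 * (∂_{dx j} φ) z.1 +
      S z.1 z.2 * ψ z.2 * M z.2 * φ z.1 := by
    intro ψ z
    simp only [hH]
    have : ∑ j, g z.1 z.2 * (ψ z.2 * z.2 j) * M z.2 * (∂_{dx j} φ) z.1 =
        g z.1 z.2 * ψ z.2 * M z.2 * ∑ j, z.2 j * (∂_{dx j} φ) z.1 := by
      rw [Finset.mul_sum]
      exact Finset.sum_congr rfl fun j _ => by ring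
    rw [this]; ring
  have iH : ∀ {ψ : V3 → ℝ}, HasMoment I g ψ → (∀ j, HasMoment I g fun v => ψ v * v j) →
      HasMoment I S ψ → Integrable fun z => H z * ψ z.2 * M z.2 := by
    intro ψ a c d
    simp only [eH]
    exact (((a.integrable _).const_mul ε).add
      (integrable_finsetSum _ fun j _ => (c j).integrable _)).add (d.integrable _)
  have e : ∫ z, H z * ψ z.2 * M z.2 = ε * (∫ y, moment g ψ y * (∂_{dt} φ) y) +
      (∑ j, ∫ y, moment g (fun v => ψ v * v j) y * (∂_{dx j} φ) y) +
      ∫ y, moment S ψ y * φ y := by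
    have i1 := (hψ.integrable (∂_{dt} φ)).const_mul ε
    have i2 := integrable_finsetSum (μ := volume) Finset.univ
      fun j _ => (hψv j).integrable (∂_{dx j} φ)
    simp only [eH]
    rw [integral_add (i1.fun_add i2) (hSψ.integrable φ), integral_add i1 i2, integral_const_mul,
      integral_finsetSum _ fun j _ => (hψv j).integrable (∂_{dx j} φ), hψ.integral_eq,
      hSψ.integral_eq]
    rw [Finset.sum_congr rfl fun j _ => (hψv j).integral_eq (∂_{dx j} φ)]
  rw [← e]
  -- the test functions `φ ⊗ χ M` show that, for almost every velocity, the equation tested with `φ`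
  -- holds
  have i1 := iH h1 h1v hS1
  have hae : ∀ᵐ v, ∫ y, H (y, v) * 1 * M v = 0 := by
    refine ae_eq_zero_of_integral_contDiff_smul_eq_zero
      (f := fun v => ∫ y, H (y, v) * 1 * M v) i1.integral_prod_right.locallyIntegrable ?_
    intro χ hχ hc
    have hχM : ContDiff ℝ (⊤ : ℕ∞) fun v => χ v * M v := hχ.mul contDiff_M
    have h0 := hw (tensorTest φ _ hχM hc.mul_right)
    obtain ⟨C, hC⟩ := hχ.continuous.bounded_above_of_compact_support hc
    have i2 : Integrable fun z : SpaceTime × V3 => H z * 1 * M z.2 * χ z.2 :=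
      i1.mul_bdd (c := C) (hχ.continuous.comp continuous_snd).aestronglyMeasurable
        (ae_of_all _ fun z => hC z.2)
    have h2 : ∫ z : SpaceTime × V3, H z * 1 * M z.2 * χ z.2 = 0 := by
      rw [← h0]
      congr 1; ext z
      rw [fderiv_tensorTest, fderiv_spaceTime, ← lineDeriv_test_apply]
      simp only [← lineDeriv_test_apply, hH]
      change _ = _ + S z.1 z.2 * (φ z.1 * (χ z.2 * M z.2))
      ring
    rw [Measure.volume_eq_prod, integral_prod_symm _ i2] at h2
    simp only [integral_mul_const, smul_eq_mul] at h2 ⊢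
    rw [← h2]
    congr 1; ext v; ring
  have i3 := iH hψ hψv hSψ
  rw [Measure.volume_eq_prod, integral_prod_symm _ i3, ← integral_zero V3 ℝ (μ := volume)]
  refine integral_congr_ae ?_
  filter_upwards [hae] with v hv
  have : ∀ y, H (y, v) * ψ v * M v = ψ v * (H (y, v) * 1 * M v) := fun y => by ring
  simp only [this, integral_const_mul, hv, mul_zero]

end

/-! ### Moments of the collision terms -/

section

variable {b : ℝ → ℝ → ℝ} {I : Opens ℝ}

theorem measurable_kern_apply (hb : IsCutoffKernel b) :
    Measurable fun x : (SpaceTime × V3) × (V3 × S2) => kern b x.1.2 x.2.1 x.2.2 := by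
  have hv : Measurable fun x : (SpaceTime × V3) × (V3 × S2) => x.1.2 - x.2.1 :=
    (measurable_snd.comp measurable_fst).sub (measurable_fst.comp measurable_snd)
  have hω : Measurable fun x : (SpaceTime × V3) × (V3 × S2) => (x.2.2 : V3) :=
    measurable_subtype_coe.comp (measurable_snd.comp measurable_snd)
  exact hb.measurable.comp (hv.norm.prodMk (hv.inner (𝕜 := ℝ) hω).norm)

theorem measurable_Q (hb : IsCutoffKernel b) {f h : SpaceTime → V3 → ℝ}
    (hf : Measurable (Function.uncurry f)) (hh : Measurable (Function.uncurry h)) :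
    Measurable fun z : SpaceTime × V3 => Q b (f z.1) (h z.1) z.2 := by
  have hy : Measurable fun x : (SpaceTime × V3) × (V3 × S2) => x.1.1 :=
    measurable_fst.comp measurable_fst
  have hv : Measurable fun x : (SpaceTime × V3) × (V3 × S2) => x.1.2 :=
    measurable_snd.comp measurable_fst
  have hw : Measurable fun x : (SpaceTime × V3) × (V3 × S2) => x.2.1 :=
    measurable_fst.comp measurable_snd
  have hc : Measurable fun x : (SpaceTime × V3) × (V3 × S2) => coll (x.1.2, x.2) :=
    continuous_coll.measurable.comp (hv.prodMk measurable_snd)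
  have h1 := hf.comp (hy.prodMk (measurable_fst.comp hc))
  have h2 := hh.comp (hy.prodMk ((measurable_fst.comp measurable_snd).comp hc))
  have h3 := hf.comp (hy.prodMk hv)
  have h4 := hh.comp (hy.prodMk hw)
  exact ((((h1.mul h2).sub (h3.mul h4)).mul (measurable_kern_apply hb)).stronglyMeasurable
    |>.integral_prod_right').measurable

theorem measurable_M_snd : Measurable fun z : SpaceTime × V3 => M z.2 :=
  measurable_M.comp measurable_snd

theorem measurable_L (hb : IsCutoffKernel b) {h : SpaceTime → V3 → ℝ}
    (hh : Measurable (Function.uncurry h)) :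
    Measurable fun z : SpaceTime × V3 => L b (h z.1) z.2 := by
  have hM : Measurable (Function.uncurry fun (_ : SpaceTime) (v : V3) => M v) := measurable_M_snd
  have hhM : Measurable (Function.uncurry fun (y : SpaceTime) (v : V3) => h y v * M v) :=
    hh.mul measurable_M_snd
  exact ((measurable_const.div measurable_M_snd).neg).mul
    ((measurable_Q hb hM hhM).add (measurable_Q hb hhM hM))

theorem measurable_Gam (hb : IsCutoffKernel b) {h : SpaceTime → V3 → ℝ}
    (hh : Measurable (Function.uncurry h)) :
    Measurable fun z : SpaceTime × V3 => Gam b (h z.1) z.2 := by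
  have hhM : Measurable (Function.uncurry fun (y : SpaceTime) (v : V3) => h y v * M v) :=
    hh.mul measurable_M_snd
  exact (measurable_const.div measurable_M_snd).mul (measurable_Q hb hhM hhM)

theorem LocL2.integrableOn_integral {wt : V3 → ℝ} {h : SpaceTime → V3 → ℝ} (hh : LocL2 b I wt h)
    {K : Set SpaceTime} (hK : IsCompact K) (hKI : K ⊆ spaceTime I) :
    IntegrableOn (fun y => ∫ v, wt v * (1 + freq b v) * h y v ^ 2 * M v) K := by
  have := hh.2 K hK hKI
  rw [IntegrableOn, restrict_prod_univ] at this
  exact this.integral_prod_left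

/-- Fibrewise integrability with a locally integrable bound of the fibre integrals. -/
theorem hasMoment_of_bound {h : SpaceTime → V3 → ℝ} {ψ : V3 → ℝ}
    (hm : Measurable fun z : SpaceTime × V3 => h z.1 z.2 * ψ z.2 * M z.2) {N : SpaceTime → ℝ}
    (hN : ∀ K : Set SpaceTime, IsCompact K → K ⊆ spaceTime I → IntegrableOn N K)
    (hae : ∀ᵐ y, y ∈ spaceTime I → Integrable (fun v => h y v * ψ v * M v) ∧
      ∫ v, |h y v * ψ v * M v| ≤ N y) : HasMoment I h ψ := by
  intro K hK hKI
  have hae' : ∀ᵐ y ∂(volume.restrict K), Integrable (fun v => h y v * ψ v * M v) ∧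
      ∫ v, |h y v * ψ v * M v| ≤ N y := by
    filter_upwards [ae_restrict_of_ae hae, ae_restrict_mem hK.measurableSet] with y h1 h2
    exact h1 (hKI h2)
  rw [IntegrableOn, restrict_prod_univ, integrable_prod_iff hm.aestronglyMeasurable]
  refine ⟨hae'.mono fun y hy => hy.1, (hN K hK hKI).mono' ?_ ?_⟩
  · exact (hm.norm.stronglyMeasurable.integral_prod_right').aestronglyMeasurable
  · filter_upwards [hae'] with y hy
    rw [Real.norm_of_nonneg (integral_nonneg fun v => norm_nonneg _)]
    exact hy.2

theorem measurable_fiber {h : SpaceTime → V3 → ℝ} (hh : Measurable (Function.uncurry h))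
    {ψ : V3 → ℝ} (hψ : Measurable ψ) :
    Measurable fun z : SpaceTime × V3 => h z.1 z.2 * ψ z.2 * M z.2 :=
  (hh.mul (hψ.comp measurable_snd)).mul measurable_M_snd

/-- A factor `m` with `m² ≤ wt` of the weight function can be absorbed by the weight of `h`. -/
theorem LocL2.hasMoment (hb : IsCutoffKernel b) {wt : V3 → ℝ} {h : SpaceTime → V3 → ℝ}
    (hh : LocL2 b I wt h) {ψ m : V3 → ℝ} (hψ : InDomain b ψ) (hm : Measurable m)
    (hwt : ∀ v, m v ^ 2 ≤ wt v) : HasMoment I h fun v => ψ v * m v := by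
  intro K hK hKI
  have i1 := hh.2 K hK hKI
  have i2 : IntegrableOn (fun z : SpaceTime × V3 => ψ z.2 ^ 2 * M z.2) (K ×ˢ Set.univ) := by
    have := hK.measure_lt_top (μ := (volume : Measure SpaceTime))
    have : IsFiniteMeasure ((volume : Measure SpaceTime).restrict K) := ⟨by simpa using this⟩
    rw [IntegrableOn, restrict_prod_univ]
    exact (hψ.integrable_sq hb).comp_snd _
  refine (i1.add i2).mono' ?_ (ae_of_all _ fun z => ?_)
  · exact (measurable_fiber hh.1 (hψ.1.mul hm)).aestronglyMeasurable
  · have h1 := freq_nonneg hb z.2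
    have h2 := M_pos z.2
    have h3 := hwt z.2
    simp only [Pi.add_apply, Real.norm_eq_abs]
    rw [abs_mul, abs_of_pos h2, ← add_mul]
    refine mul_le_mul_of_nonneg_right ?_ h2.le
    have h4 : wt z.2 * h z.1 z.2 ^ 2 ≤ wt z.2 * (1 + freq b z.2) * h z.1 z.2 ^ 2 := by
      have : 0 ≤ wt z.2 * freq b z.2 * h z.1 z.2 ^ 2 :=
        mul_nonneg (mul_nonneg ((sq_nonneg _).trans h3) h1) (sq_nonneg _)
      nlinarith
    have h5 : m z.2 ^ 2 * h z.1 z.2 ^ 2 ≤ wt z.2 * h z.1 z.2 ^ 2 :=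
      mul_le_mul_of_nonneg_right h3 (sq_nonneg _)
    rw [abs_le]
    constructor <;>
      nlinarith [sq_nonneg (h z.1 z.2 * m z.2 - ψ z.2), sq_nonneg (h z.1 z.2 * m z.2 + ψ z.2)]

theorem LocL2.hasMoment_L (hb : IsCutoffKernel b) {h : SpaceTime → V3 → ℝ}
    (hh : LocL2 b I (fun _ => 1) h) {ψ : V3 → ℝ} (hψ : InDomain b ψ) :
    HasMoment I (fun y => L b (h y)) ψ := by
  refine hasMoment_of_bound (measurable_fiber (h := fun y => L b (h y)) (measurable_L hb hh.1) hψ.1)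
    (N := fun y => 8 * (∫ v, 1 * (1 + freq b v) * h y v ^ 2 * M v) +
      1 / 2 * ∫ v, freq b v * ψ v ^ 2 * M v) ?_ ?_
  · intro K hK hKI
    exact ((hh.integrableOn_integral hK hKI).const_mul 8).add
      (integrableOn_const hK.measure_lt_top.ne)
  · filter_upwards [hh.ae_inDomain] with y hy hyI
    have hd := hy hyI
    refine ⟨hd.integrable_L_mul hb hψ, (hd.integral_abs_L_mul_le hb hψ).trans ?_⟩
    gcongr ?_ + _
    gcongr ?_ * ?_
    refine integral_mono (hd.integrable_freq hb) (by simpa using hd.2) fun v => ?_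
    have := mul_nonneg (sq_nonneg (h y v)) (M_pos v).le
    simp only
    nlinarith

/-- The weight `1 + |v|²` is controlled by the post-collisional ones, as the energy is
conserved. -/
theorem quadDefect_mul_le (h ψ : V3 → ℝ) {C : ℝ} (hψ : ∀ v, |ψ v| ≤ C * (1 + ‖v‖ ^ 2)) (p : Coll) :
    |quadDefect h p * ψ p.1| ≤ C * (((1 + ‖p.1‖ ^ 2) * h p.1) ^ 2 +
      ((1 + ‖(exch p).1‖ ^ 2) * h (exch p).1) ^ 2 + ((1 + ‖(coll p).1‖ ^ 2) * h (coll p).1) ^ 2 +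
      ((1 + ‖(coll (exch p)).1‖ ^ 2) * h (coll (exch p)).1) ^ 2) := by
  have hC : 0 ≤ C := by
    have := (abs_nonneg _).trans (hψ 0)
    simpa using this
  have key : ∀ x y X Y : ℝ, 1 ≤ X → 1 ≤ Y → |x * y| * (X + Y) ≤ (X * x) ^ 2 + (Y * y) ^ 2 := by
    intro x y X Y hX hY
    rw [abs_mul]
    have hx := sq_abs x
    have hy := sq_abs y
    have hX2 : 1 ≤ X ^ 2 := by nlinarith
    have hY2 : 1 ≤ Y ^ 2 := by nlinarith
    nlinarith [sq_nonneg (X * |x| - |y|), sq_nonneg (Y * |y| - |x|),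
      mul_le_mul_of_nonneg_right hX2 (sq_nonneg x), mul_le_mul_of_nonneg_right hY2 (sq_nonneg y)]
  have hE : ‖(coll p).1‖ ^ 2 + ‖(coll (exch p)).1‖ ^ 2 = ‖p.1‖ ^ 2 + ‖(exch p).1‖ ^ 2 := by
    rw [coll_exch_fst]
    exact normSq_post_add_normSq_postStar p.1 p.2.1 p.2.2
  have k1 := key (h (coll p).1) (h (coll (exch p)).1) (1 + ‖(coll p).1‖ ^ 2)
    (1 + ‖(coll (exch p)).1‖ ^ 2) (by nlinarith [sq_nonneg ‖(coll p).1‖])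
    (by nlinarith [sq_nonneg ‖(coll (exch p)).1‖])
  have k2 := key (h p.1) (h (exch p).1) (1 + ‖p.1‖ ^ 2) (1 + ‖(exch p).1‖ ^ 2)
    (by nlinarith [sq_nonneg ‖p.1‖]) (by nlinarith [sq_nonneg ‖(exch p).1‖])
  have hq : |quadDefect h p| ≤ |h (coll p).1 * h (coll (exch p)).1| + |h p.1 * h (exch p).1| :=
    abs_sub _ _
  rw [abs_mul]
  calc |quadDefect h p| * |ψ p.1| ≤ (|h (coll p).1 * h (coll (exch p)).1| +
        |h p.1 * h (exch p).1|) * (C * (1 + ‖p.1‖ ^ 2)) := by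
        gcongr
        exact hψ _
    _ ≤ C * ((|h (coll p).1 * h (coll (exch p)).1| * (1 + ‖(coll p).1‖ ^ 2 +
        (1 + ‖(coll (exch p)).1‖ ^ 2))) + |h p.1 * h (exch p).1| *
          (1 + ‖p.1‖ ^ 2 + (1 + ‖(exch p).1‖ ^ 2))) := by
        have e : 1 + ‖(coll p).1‖ ^ 2 + (1 + ‖(coll (exch p)).1‖ ^ 2) =
          1 + ‖p.1‖ ^ 2 + (1 + ‖(exch p).1‖ ^ 2) := by linarith
        rw [e, ← add_mul, mul_left_comm]
        refine mul_le_mul_of_nonneg_left (mul_le_mul_of_nonneg_left ?_ (by positivity)) hC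
        nlinarith [sq_nonneg ‖(exch p).1‖]
    _ ≤ _ := mul_le_mul_of_nonneg_left (by linarith) hC

theorem integrable_quadDefect_mul (hb : IsCutoffKernel b) {h ψ : V3 → ℝ} (hh : Measurable h)
    (hk : InDomain b fun v => (1 + ‖v‖ ^ 2) * h v) (hψm : Measurable ψ) {C : ℝ}
    (hψ : ∀ v, |ψ v| ≤ C * (1 + ‖v‖ ^ 2)) :
    Integrable (fun p => quadDefect h p * ψ p.1) (collMeasure b) ∧
      ∫ p, |quadDefect h p * ψ p.1| ∂(collMeasure b) ≤
        4 * C * ∫ v, freq b v * ((1 + ‖v‖ ^ 2) * h v) ^ 2 * M v := by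
  have j0 := integrable_collMeasure_fst hb (hk.1.pow_const 2) (hk.integrable_freq hb)
  have j1 := integrable_comp_exch hb j0
  have j2 := integrable_comp_coll hb j0
  have j3 := integrable_comp_exch hb j2
  have j4 := (((j0.fun_add j1).fun_add j2).fun_add j3).const_mul C
  have e0 := integral_collMeasure_fst hb (hk.1.pow_const 2) (hk.integrable_freq hb)
  have e1 := integral_comp_exch hb fun p => ((1 + ‖p.1‖ ^ 2) * h p.1) ^ 2
  have e2 := integral_comp_coll hb fun p => ((1 + ‖p.1‖ ^ 2) * h p.1) ^ 2
  have e3 := integral_comp_exch hb fun p => ((1 + ‖(coll p).1‖ ^ 2) * h (coll p).1) ^ 2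
  have c1 := measurable_fst.comp continuous_coll.measurable
  have c2 : Measurable fun p : Coll => (exch p).1 := measurable_fst.comp continuous_exch.measurable
  have c3 : Measurable fun p : Coll => (coll (exch p)).1 := c1.comp continuous_exch.measurable
  have hq : Measurable (quadDefect h) :=
    ((hh.comp c1).mul (hh.comp c3)).sub ((hh.comp measurable_fst).mul (hh.comp c2))
  have i : Integrable (fun p => quadDefect h p * ψ p.1) (collMeasure b) :=
    j4.mono' (hq.mul (hψm.comp measurable_fst)).aestronglyMeasurable
      (ae_of_all _ fun p => quadDefect_mul_le h ψ hψ p)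
  refine ⟨i, (integral_mono i.abs j4 (quadDefect_mul_le h ψ hψ)).trans_eq ?_⟩
  rw [integral_const_mul, integral_add_four j0 j1 j2 j3, e1, e3, e2, e0]
  ring

theorem InDomain.weighted {h : V3 → ℝ} (hh : Measurable h)
    (hw : Integrable fun v => (1 + ‖v‖ ^ 2) ^ 2 * (1 + freq b v) * h v ^ 2 * M v) :
    InDomain b fun v => (1 + ‖v‖ ^ 2) * h v := by
  refine ⟨by fun_prop, hw.congr (ae_of_all _ fun v => ?_)⟩
  ring

theorem Gam_mul_eq (h ψ : V3 → ℝ) (v : V3) :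
    Gam b h v * ψ v * M v = collAvg b (fun p => quadDefect h p * ψ p.1) v * M v := by
  rw [collAvg_mul_fst, Gam_eq]

/-- Mass, momentum and energy are conserved by collisions. -/
theorem pairM_Gam_eq_zero (hb : IsCutoffKernel b) {h ψ : V3 → ℝ} (hh : Measurable h)
    (hk : InDomain b fun v => (1 + ‖v‖ ^ 2) * h v) (hψm : Measurable ψ) {C : ℝ}
    (hψ : ∀ v, |ψ v| ≤ C * (1 + ‖v‖ ^ 2)) (hψ0 : ∀ p, defect ψ p = 0) :
    pairM (Gam b h) ψ = 0 := by
  have i0 := (integrable_quadDefect_mul hb hh hk hψm hψ).1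
  have i1 := integrable_comp_exch hb i0
  have i2 := integrable_comp_coll hb i0
  have i3 := integrable_comp_exch hb i2
  have e1 := integral_comp_exch hb fun p => quadDefect h p * ψ p.1
  have e2 := integral_comp_coll hb fun p => quadDefect h p * ψ p.1
  have e3 := integral_comp_exch hb fun p => quadDefect h (coll p) * ψ (coll p).1
  rw [e2] at e3
  have q1 : ∀ p, quadDefect h (coll p) = -quadDefect h p := by
    intro p
    simp only [quadDefect, coll_coll, ← coll_exch]
    ring
  have q2 : ∀ p, quadDefect h (exch p) = quadDefect h p := by
    intro p
    simp only [quadDefect, exch_exch]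
    ring
  have hsum : ∀ p, quadDefect h p * ψ p.1 + quadDefect h (exch p) * ψ (exch p).1 +
      quadDefect h (coll p) * ψ (coll p).1 +
      quadDefect h (coll (exch p)) * ψ (coll (exch p)).1 = 0 := by
    intro p
    simp only [q1, q2]
    have := hψ0 p
    rw [show defect ψ p = ψ p.1 + ψ (exch p).1 - ψ (coll p).1 - ψ (coll (exch p)).1 from rfl] at this
    linear_combination quadDefect h p * this
  have h4 := integral_add_four i0 i1 i2 i3
  simp only [hsum, integral_zero] at h4
  rw [e1, e2, e3] at h4
  unfold pairM
  simp only [Gam_mul_eq]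
  rw [← integral_collMeasure hb i0]
  linarith

theorem LocL2.hasMoment_Gam (hb : IsCutoffKernel b) {h : SpaceTime → V3 → ℝ}
    (hh : LocL2 b I (fun v => (1 + ‖v‖ ^ 2) ^ 2) h) {ψ : V3 → ℝ} (hψm : Measurable ψ) {C : ℝ}
    (hψ : ∀ v, |ψ v| ≤ C * (1 + ‖v‖ ^ 2)) : HasMoment I (GamF b h) ψ := by
  have hC : 0 ≤ C := by
    have := (abs_nonneg _).trans (hψ 0)
    simpa using this
  refine hasMoment_of_bound (measurable_fiber (h := GamF b h) (measurable_Gam hb hh.1) hψm)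
    (N := fun y => 4 * C * (∫ v, (1 + ‖v‖ ^ 2) ^ 2 * (1 + freq b v) * h y v ^ 2 * M v)) ?_ ?_
  · intro K hK hKI
    exact (hh.integrableOn_integral hK hKI).const_mul _
  · filter_upwards [hh.ae_integrable] with y hy hyI
    have hd := InDomain.weighted (hh.measurable_apply y) (hy hyI)
    obtain ⟨i, le⟩ := integrable_quadDefect_mul hb (hh.measurable_apply y) hd hψm hψ
    simp only [GamF, Gam_mul_eq]
    refine ⟨integrable_collAvg hb i, (integral_abs_collAvg_le hb i).trans (le.trans ?_)⟩
    gcongr ?_ * ?_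
    refine integral_mono (hd.integrable_freq hb) (hy hyI) fun v => ?_
    have := mul_nonneg (sq_nonneg ((1 + ‖v‖ ^ 2) * h y v)) (M_pos v).le
    simp only
    nlinarith

end

/-! ### The kinetic equation for the fluctuations and its limit -/

section

variable {b : ℝ → ℝ → ℝ} {I : Opens ℝ}

theorem ae_phase {P : SpaceTime × V3 → Prop} (hP : MeasurableSet {z | P z})
    (h : ∀ᵐ y, y ∈ spaceTime I → ∀ᵐ v, P (y, v)) : ∀ᵐ z, z ∈ phase I → P z := by
  have hm : MeasurableSet {z : SpaceTime × V3 | z ∈ phase I → P z} :=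
    ((phase I).isOpen.measurableSet.compl.union hP).congr (by
      ext z; simp [imp_iff_not_or])
  rw [Measure.volume_eq_prod, Measure.ae_prod_iff_ae_ae hm]
  filter_upwards [h] with y hy
  by_cases hyI : y ∈ spaceTime I
  · exact (hy hyI).mono fun v hv _ => hv
  · exact ae_of_all _ fun v hv => absurd hv.1 hyI

theorem contDiff_M_inv : ContDiff ℝ (⊤ : ℕ∞) fun v : V3 => (M v)⁻¹ :=
  contDiff_M.inv fun v => (M_pos v).ne'

theorem test_eq_zero {E : Type*} [NormedAddCommGroup E] [NormedSpace ℝ E] {U : Opens E}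
    (φ : 𝓓(U, ℝ)) {z : E} (hz : z ∉ U) : φ z = 0 := by
  by_contra h
  exact hz (φ.tsupport_subset (subset_tsupport _ h))

/-- The scaled equation for `f = M + e g M`, divided by `e M`. -/
theorem IsWeakSolution.fluctuation (hb : IsCutoffKernel b) {f g : SpaceTime → V3 → ℝ} {ε q e : ℝ}
    (he : e ≠ 0) (hf : ∀ y v, f y v = M v + e * g y v * M v) (hg : LocL2 b I (fun _ => 1) g)
    (hsol : IsWeakSolution b I ε q f) (Φ : 𝓓(phase I, ℝ)) :
    ∫ z : SpaceTime × V3, (g z.1 z.2 * fderiv ℝ Φ z ((ε, z.2), 0) +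
      ε ^ (-q) * (-L b (g z.1) z.2 + e * Gam b (g z.1) z.2) * Φ z) = 0 := by
  obtain ⟨hf1, hQ, hw⟩ := hsol
  set ψ := velTest _ contDiff_M_inv Φ with hψ
  have hwψ := hw ψ
  have eT : ∀ z : SpaceTime × V3, f z.1 z.2 * fderiv ℝ ψ z ((ε, z.2), 0) =
      transport ε Φ z + e * (g z.1 z.2 * transport ε Φ z) := by
    intro z
    rw [hf, hψ, fderiv_velTest, transport_apply]
    have := (M_pos z.2).ne'
    field_simp
  have i1 : Integrable fun z : SpaceTime × V3 => f z.1 z.2 * fderiv ℝ ψ z ((ε, z.2), 0) := by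
    simpa only [transport_apply] using integrable_mul_test hf1 (transport ε ψ)
  have i2 : Integrable (transport ε Φ) := integrable_test _
  have i3 : Integrable fun z : SpaceTime × V3 => g z.1 z.2 * transport ε Φ z := by
    refine ((i1.sub i2).const_mul e⁻¹).congr (ae_of_all _ fun z => ?_)
    simp only [Pi.sub_apply, eT]
    field_simp
    ring
  have eQ : ∀ᵐ z : SpaceTime × V3, Q b (f z.1) (f z.1) z.2 * ψ z =
      e * ((-L b (g z.1) z.2 + e * Gam b (g z.1) z.2) * Φ z) := by
    have hfm : Measurable (Function.uncurry f) := by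
      have : Function.uncurry f = fun z : SpaceTime × V3 =>
        M z.2 + e * Function.uncurry g z * M z.2 := funext fun z => hf z.1 z.2
      rw [this]
      exact measurable_M_snd.add ((hg.1.const_mul e).mul measurable_M_snd)
    have key : ∀ᵐ z : SpaceTime × V3, z ∈ phase I → Q b (f z.1) (f z.1) z.2 =
        e * (M z.2 * (-L b (g z.1) z.2 + e * Gam b (g z.1) z.2)) := by
      refine ae_phase ?_ ?_
      · exact measurableSet_eq_fun (measurable_Q hb hfm hfm) (measurable_const.mul
          (measurable_M_snd.mul ((measurable_L hb hg.1).neg.add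
            (measurable_const.mul (measurable_Gam hb hg.1)))))
      · filter_upwards [hg.ae_inDomain] with y hy hyI
        exact (hy hyI).Q_eq hb (hf y)
    filter_upwards [key] with z hz
    rw [hψ, velTest_apply]
    by_cases hzI : z ∈ phase I
    · rw [hz hzI]
      have := (M_pos z.2).ne'
      field_simp
    · simp [test_eq_zero Φ hzI]
  have i4 : Integrable fun z : SpaceTime × V3 =>
      (-L b (g z.1) z.2 + e * Gam b (g z.1) z.2) * Φ z := by
    refine (((integrable_mul_test hQ ψ).congr eQ).const_mul e⁻¹).congr (ae_of_all _ fun z => ?_)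
    field_simp
  rw [integral_congr_ae eQ, integral_const_mul] at hwψ
  simp only [eT] at hwψ
  rw [integral_add i2 (i3.const_mul e), integral_transport, integral_const_mul] at hwψ
  simp only [← transport_apply, mul_assoc]
  rw [integral_add i3 (i4.const_mul _), integral_const_mul]
  apply mul_left_cancel₀ he
  linear_combination -hwψ

/-- The limit of the fluctuations lies in the kernel of `L`: multiply the equation by `ε^q`. -/
theorem ae_inKer_of_tendsto {g : ℕ → SpaceTime → V3 → ℝ}
    {g₀ : SpaceTime → V3 → ℝ} {ε e : ℕ → ℝ} {q : ℝ} (hq : 0 < q) (hε : ∀ n, 0 < ε n)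
    (hε0 : Tendsto ε atTop (𝓝 0)) (hg₀ : LocL2 b I (fun _ => 1) g₀)
    (hw : ∀ n (Φ : 𝓓(phase I, ℝ)), ∫ z : SpaceTime × V3,
      (g n z.1 z.2 * fderiv ℝ Φ z ((ε n, z.2), 0) +
        (ε n) ^ (-q) * (-L b (g n z.1) z.2 + e n * Gam b (g n z.1) z.2) * Φ z) = 0)
    (hconv : TendstoDist (phase I) (fun n z => g n z.1 z.2) (fun z => g₀ z.1 z.2))
    (hLconv : TendstoDist (phase I) (fun n z => L b (g n z.1) z.2) (fun z => L b (g₀ z.1) z.2))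
    (hGamconv : TendstoDist (phase I) (fun n z => e n * Gam b (g n z.1) z.2) (fun _ => 0)) :
    ∀ᵐ y, y ∈ spaceTime I → InKer b (g₀ y) := by
  have hq0 : Tendsto (fun n => ε n ^ q) atTop (𝓝 0) := by
    have := hε0.rpow_const (p := q) (Or.inr hq.le)
    rwa [Real.zero_rpow hq.ne'] at this
  have hL0 : ∀ Φ : 𝓓(phase I, ℝ), ∫ z : SpaceTime × V3, L b (g₀ z.1) z.2 * Φ z = 0 := by
    intro Φ
    set T := ∂_{((dt, 0) : SpaceTime × V3)} Φ with hT
    have e1 : ∀ n, ∫ z : SpaceTime × V3, L b (g n z.1) z.2 * Φ z =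
        ε n ^ q * (ε n * (∫ z : SpaceTime × V3, g n z.1 z.2 * T z) +
          ∫ z : SpaceTime × V3, g n z.1 z.2 * transport 0 Φ z) +
          ∫ z : SpaceTime × V3, e n * Gam b (g n z.1) z.2 * Φ z := by
      intro n
      have h := hw n Φ
      have i1 : Integrable fun z : SpaceTime × V3 => g n z.1 z.2 * T z :=
        integrable_mul_test (hconv.1 n) T
      have i2 : Integrable fun z : SpaceTime × V3 => g n z.1 z.2 * transport 0 Φ z :=
        integrable_mul_test (hconv.1 n) (transport 0 Φ)
      have i3 : Integrable fun z : SpaceTime × V3 => L b (g n z.1) z.2 * Φ z :=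
        integrable_mul_test (hLconv.1 n) Φ
      have i4 : Integrable fun z : SpaceTime × V3 => e n * Gam b (g n z.1) z.2 * Φ z :=
        integrable_mul_test (hGamconv.1 n) Φ
      have i5 : Integrable fun z : SpaceTime × V3 =>
          e n * Gam b (g n z.1) z.2 * Φ z - L b (g n z.1) z.2 * Φ z := i4.sub i3
      have ez : ∀ z : SpaceTime × V3, g n z.1 z.2 * fderiv ℝ Φ z ((ε n, z.2), 0) +
          (ε n) ^ (-q) * (-L b (g n z.1) z.2 + e n * Gam b (g n z.1) z.2) * Φ z =
          (ε n * (g n z.1 z.2 * T z) + g n z.1 z.2 * transport 0 Φ z) +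
          (ε n) ^ (-q) * (e n * Gam b (g n z.1) z.2 * Φ z - L b (g n z.1) z.2 * Φ z) := by
        intro z
        rw [← transport_apply, transport_apply' (ε n), transport_apply' 0]
        ring
      simp only [ez] at h
      rw [integral_add ((i1.const_mul _).fun_add i2) (i5.const_mul _),
        integral_add (i1.const_mul _) i2, integral_const_mul, integral_const_mul,
        integral_sub i4 i3, Real.rpow_neg (hε n).le] at h
      have := (Real.rpow_pos_of_pos (hε n) q).ne'
      field_simp at h
      linear_combination -h
    have l1 := (hq0.mul ((hε0.mul (hconv.2.2 T)).add (hconv.2.2 (transport 0 Φ)))).add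
      (hGamconv.2.2 Φ)
    have l2 := hLconv.2.2 Φ
    simp only [e1] at l2
    have := tendsto_nhds_unique l2 l1
    simpa using this
  have hae : ∀ᵐ z : SpaceTime × V3, z ∈ phase I → L b (g₀ z.1) z.2 = 0 := by
    refine (phase I).isOpen.ae_eq_zero_of_integral_contDiff_smul_eq_zero hLconv.2.1 ?_
    intro φ hφ hc hsub
    have := hL0 ⟨φ, hφ, hc, hsub⟩
    rw [← this]
    congr 1; ext z
    exact mul_comm _ _
  have hae' := Measure.ae_ae_of_ae_prod (Measure.volume_eq_prod SpaceTime V3 ▸ hae)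
  filter_upwards [hae', hg₀.ae_inDomain] with y h1 h2 hyI
  exact ⟨h2 hyI, h1.mono fun v hv => hv ⟨hyI, trivial⟩⟩

end

/-! ### Moment equations for the fluctuations -/

section

variable {b : ℝ → ℝ → ℝ} {I : Opens ℝ}

section Fluctuation

variable {g : SpaceTime → V3 → ℝ} {ε q e : ℝ}

theorem one_le_weight (v : V3) : (1 : ℝ) ^ 2 ≤ (1 + ‖v‖ ^ 2) ^ 2 := by
  gcongr
  nlinarith [sq_nonneg ‖v‖]

theorem abs_coord_le_norm (v : V3) (i : Fin 3) : |v i| ≤ ‖v‖ := PiLp.norm_apply_le v i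

theorem coord_sq_le_weight (i : Fin 3) (v : V3) : v i ^ 2 ≤ (1 + ‖v‖ ^ 2) ^ 2 := by
  rw [← sq_abs (v i)]
  have h1 := abs_coord_le_norm v i
  have h2 := abs_nonneg (v i)
  have : |v i| ≤ 1 + ‖v‖ ^ 2 := by nlinarith [sq_nonneg (‖v‖ - 1 / 2)]
  gcongr

/-- The equation for the moment `ψ`. -/
theorem moment_fluctuation (hb : IsCutoffKernel b)
    (hg : LocL2 b I (fun v => (1 + ‖v‖ ^ 2) ^ 2) g)
    (hw : ∀ Φ : 𝓓(phase I, ℝ), ∫ z : SpaceTime × V3, (g z.1 z.2 * fderiv ℝ Φ z ((ε, z.2), 0) +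
      ε ^ (-q) * (-L b (g z.1) z.2 + e * Gam b (g z.1) z.2) * Φ z) = 0)
    {ψ : V3 → ℝ} (hψ : InDomain b ψ) (hΓ : HasMoment I (GamF b g) ψ) (φ : 𝓓(spaceTime I, ℝ)) :
    ε * (∫ y, moment g ψ y * (∂_{dt} φ) y) +
      (∑ j, ∫ y, moment g (fun v => ψ v * v j) y * (∂_{dx j} φ) y) +
      ε ^ (-q) * (-(∫ y, moment (fun y => L b (g y)) ψ y * φ y) +
        e * ∫ y, moment (GamF b g) ψ y * φ y) = 0 := by
  have h1 : InDomain b fun _ => 1 := (PolyGrowth.const 1).inDomain hb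
  have hg1 := hg.of_weight hb fun v => by simpa using one_le_weight v
  have hS : ∀ {ψ}, InDomain b ψ → HasMoment I (GamF b g) ψ →
      HasMoment I (fun y v => ε ^ (-q) * (-1 * L b (g y) v + e * GamF b g y v)) ψ := fun d h =>
    (((hg1.hasMoment_L hb d).const_mul (-1)).add (h.const_mul e)).const_mul (ε ^ (-q))
  have hΓ1 : HasMoment I (GamF b g) fun _ => 1 :=
    hg.hasMoment_Gam hb measurable_const (C := 1) fun v => by
      rw [abs_one]; nlinarith [sq_nonneg ‖v‖]
  have h := moment_equation (S := fun y v => ε ^ (-q) * (-1 * L b (g y) v + e * GamF b g y v))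
    (by simpa only [neg_one_mul, GamF] using hw)
    (by simpa using hg.hasMoment hb h1 (measurable_const (a := 1)) one_le_weight)
    (fun j => hg.hasMoment hb h1 (by fun_prop) (coord_sq_le_weight j)) (hS h1 hΓ1)
    (by simpa using hg.hasMoment hb hψ (measurable_const (a := 1)) one_le_weight)
    (fun j => hg.hasMoment hb hψ (by fun_prop) (coord_sq_le_weight j)) (hS hψ hΓ) φ
  rw [← h, ← (hS hψ hΓ).integral_eq, ← hΓ.integral_eq, ← (hg1.hasMoment_L hb hψ).integral_eq]
  congr 1
  have e1 : ∀ z : SpaceTime × V3, ε ^ (-q) * (-1 * L b (g z.1) z.2 + e * GamF b g z.1 z.2) *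
      ψ z.2 * M z.2 * φ z.1 = ε ^ (-q) * (-(L b (g z.1) z.2 * ψ z.2 * M z.2 * φ z.1) +
        e * (GamF b g z.1 z.2 * ψ z.2 * M z.2 * φ z.1)) := fun z => by ring
  simp only [e1]
  rw [integral_const_mul, integral_add ((hg1.hasMoment_L hb hψ).integrable φ).fun_neg
    ((hΓ.integrable φ).const_mul e), integral_const_mul, integral_neg]

/-- Moments of collision invariants are conserved: the equations of mass, momentum and energy. -/
theorem moment_fluctuation_of_invariant (hb : IsCutoffKernel b)
    (hg : LocL2 b I (fun v => (1 + ‖v‖ ^ 2) ^ 2) g)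
    (hw : ∀ Φ : 𝓓(phase I, ℝ), ∫ z : SpaceTime × V3, (g z.1 z.2 * fderiv ℝ Φ z ((ε, z.2), 0) +
      ε ^ (-q) * (-L b (g z.1) z.2 + e * Gam b (g z.1) z.2) * Φ z) = 0)
    {ψ : V3 → ℝ} (hψ : InDomain b ψ) {C : ℝ} (hC : ∀ v, |ψ v| ≤ C * (1 + ‖v‖ ^ 2))
    (hψ0 : ∀ p, defect ψ p = 0) (φ : 𝓓(spaceTime I, ℝ)) :
    ε * (∫ y, moment g ψ y * (∂_{dt} φ) y) +
      (∑ j, ∫ y, moment g (fun v => ψ v * v j) y * (∂_{dx j} φ) y) = 0 := by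
  have h := moment_fluctuation hb hg hw hψ (hg.hasMoment_Gam hb hψ.1 hC) φ
  have hg1 := hg.of_weight hb fun v => by simpa using one_le_weight v
  have e1 : ∫ y, moment (fun y => L b (g y)) ψ y * φ y = 0 := by
    rw [← integral_zero SpaceTime ℝ (μ := volume)]
    refine integral_congr_ae ?_
    filter_upwards [hg1.ae_inDomain] with y hy
    by_cases hyI : y ∈ spaceTime I
    · simp [moment, (hy hyI).pairM_L_eq_zero hb hψ hψ0]
    · simp [test_eq_zero φ hyI]
  have e2 : ∫ y, moment (GamF b g) ψ y * φ y = 0 := by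
    rw [← integral_zero SpaceTime ℝ (μ := volume)]
    refine integral_congr_ae ?_
    filter_upwards [hg.ae_integrable] with y hy
    by_cases hyI : y ∈ spaceTime I
    · simp [moment, GamF, pairM_Gam_eq_zero hb (hg.measurable_apply y)
        (InDomain.weighted (hg.measurable_apply y) (hy hyI)) hψ.1 hC hψ0]
    · simp [test_eq_zero φ hyI]
  rw [e1, e2] at h
  simpa using h

/-- The equation for the moment `X` with `L X = F`, solved for the flux `⟨g, F⟩_M`, which appears in
it as `⟨L g, X⟩_M`. -/
theorem flux_fluctuation (hb : IsCutoffKernel b) (hε : 0 < ε)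
    (hg : LocL2 b I (fun v => (1 + ‖v‖ ^ 2) ^ 2) g)
    (hw : ∀ Φ : 𝓓(phase I, ℝ), ∫ z : SpaceTime × V3, (g z.1 z.2 * fderiv ℝ Φ z ((ε, z.2), 0) +
      ε ^ (-q) * (-L b (g z.1) z.2 + e * Gam b (g z.1) z.2) * Φ z) = 0)
    {X F : V3 → ℝ} (hX : InDomain b X) (hF : L b X =ᵐ[volume] F)
    (hΓ : HasMoment I (GamF b g) X) (φ : 𝓓(spaceTime I, ℝ)) :
    ∫ y, moment g F y * φ y = ε ^ q * (ε * (∫ y, moment g X y * (∂_{dt} φ) y) +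
      ∑ j, ∫ y, moment g (fun v => X v * v j) y * (∂_{dx j} φ) y) +
        e * ∫ y, moment (GamF b g) X y * φ y := by
  have h := moment_fluctuation hb hg hw hX hΓ φ
  have hg1 := hg.of_weight hb fun v => by simpa using one_le_weight v
  have e1 : ∫ y, moment (fun y => L b (g y)) X y * φ y = ∫ y, moment g F y * φ y := by
    refine integral_congr_ae ?_
    filter_upwards [hg1.ae_inDomain] with y hy
    by_cases hyI : y ∈ spaceTime I
    · simp only [moment]
      rw [(hy hyI).pairM_L_comm hb hX, pairM_congr_right hF]
    · simp [test_eq_zero φ hyI]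
  rw [e1, Real.rpow_neg hε.le] at h
  have := (Real.rpow_pos_of_pos hε q).ne'
  field_simp at h
  linear_combination -h

end Fluctuation

end

/-! ### Test functions modulo spatial divergences -/

section

variable {I : Opens ℝ}

/-- Integral of a function along the line through `y` in the direction of `x_i`, for a measure `μ`
on the line: the Lebesgue measure gives the full integral, its restriction to `(-∞, 0]` a
primitive. -/
def lineIntegral (μ : Measure ℝ) (i : Fin 3) (φ : SpaceTime → ℝ) (y : SpaceTime) : ℝ :=
  ∫ s, φ (y + s • dx i) ∂μ

theorem contDiff_lineIntegral (μ : Measure ℝ) [IsLocallyFiniteMeasure μ] (i : Fin 3)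
    {φ : SpaceTime → ℝ} (hφ : ContDiff ℝ (⊤ : ℕ∞) φ) (hc : HasCompactSupport φ) :
    ContDiff ℝ (⊤ : ℕ∞) (lineIntegral μ i φ) := by
  -- this is a convolution with a measure carried by a line
  set T : ℝ → SpaceTime := fun s => -(s • dx i) with hT
  have hTc : Continuous T := by fun_prop
  have hTn : ∀ s, |s| ≤ ‖T s‖ := by
    intro s
    have : ‖dx i‖ = 1 := by simp [dx, Prod.norm_def]
    rw [hT, norm_neg, norm_smul, this, mul_one, Real.norm_eq_abs]
  have : IsFiniteMeasureOnCompacts (μ.map T) := by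
    refine ⟨fun K hK => ?_⟩
    rw [Measure.map_apply hTc.measurable hK.measurableSet]
    obtain ⟨C, hC⟩ := hK.isBounded.exists_norm_le
    refine lt_of_le_of_lt (measure_mono fun s hs => ?_) (isCompact_Icc (a := -C) (b := C)).measure_lt_top
    exact abs_le.1 ((hTn s).trans (hC _ hs))
  have h := hc.contDiff_convolution_right (ContinuousLinearMap.mul ℝ ℝ) (μ := μ.map T)
    (f := fun _ => (1 : ℝ)) (locallyIntegrable_const 1) hφ
  convert h using 1
  ext y
  unfold lineIntegral convolution
  have hφc := hφ.continuous
  rw [integral_map hTc.aemeasurable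
    (Continuous.aestronglyMeasurable (by simp only [ContinuousLinearMap.mul_apply']; fun_prop))]
  simp [hT]

theorem dx_apply_self (i : Fin 3) (y : SpaceTime) (s : ℝ) : (y + s • dx i).2 i = y.2 i + s := by
  simp [dx]

theorem dx_apply_ne {i j : Fin 3} (h : j ≠ i) (y : SpaceTime) (s : ℝ) :
    (y + s • dx i).2 j = y.2 j := by
  simp [dx, h]

theorem dx_fst (i : Fin 3) (y : SpaceTime) (s : ℝ) : (y + s • dx i).1 = y.1 := by
  simp [dx]

theorem lineIntegral_add (i : Fin 3) (φ : SpaceTime → ℝ) (y : SpaceTime) (s : ℝ) :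
    lineIntegral volume i φ (y + s • dx i) = lineIntegral volume i φ y := by
  unfold lineIntegral
  rw [← integral_add_left_eq_self (fun r => φ (y + r • dx i)) s]
  simp only [add_assoc, ← add_smul]

theorem lineIntegral_add_comm (i j : Fin 3) (φ : SpaceTime → ℝ) (y : SpaceTime) (s : ℝ)
    (h : ∀ y, φ (y + s • dx j) = φ y) :
    lineIntegral volume i φ (y + s • dx j) = lineIntegral volume i φ y := by
  unfold lineIntegral
  congr 1; ext r
  rw [add_right_comm, h]

/-- The points on lines parallel to the `x_i` axis through a set, with `|x_i| ≤ c`. -/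
def lineHull (i : Fin 3) (K : Set SpaceTime) (c : ℝ) : Set SpaceTime :=
  (fun p : SpaceTime × ℝ => p.1 + (p.2 - p.1.2 i) • dx i) '' (K ×ˢ Set.Icc (-c) c)

theorem isCompact_lineHull (i : Fin 3) {K : Set SpaceTime} (hK : IsCompact K) (c : ℝ) :
    IsCompact (lineHull i K c) :=
  (hK.prod isCompact_Icc).image (by fun_prop)

theorem lineHull_subset (i : Fin 3) {K : Set SpaceTime} (hK : K ⊆ spaceTime I) (c : ℝ) :
    lineHull i K c ⊆ spaceTime I := by
  rintro _ ⟨⟨k, τ⟩, ⟨hk, -⟩, rfl⟩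
  refine ⟨?_, trivial⟩
  simp only
  rw [dx_fst]
  exact (hK hk).1

theorem mem_lineHull {i : Fin 3} {K : Set SpaceTime} {c : ℝ} {y : SpaceTime} (hy : |y.2 i| ≤ c)
    {s : ℝ} (hs : y + s • dx i ∈ K) : y ∈ lineHull i K c := by
  refine ⟨(y + s • dx i, y.2 i), ⟨hs, abs_le.1 hy⟩, ?_⟩
  simp only
  rw [dx_apply_self, add_assoc, ← add_smul]
  simp

/-- A test function from a smooth function vanishing off a compact subset. -/
def testOfCompact {K : Set SpaceTime} (hK : IsCompact K) (hKI : K ⊆ spaceTime I)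
    (φ : SpaceTime → ℝ) (hφ : ContDiff ℝ (⊤ : ℕ∞) φ) (h0 : ∀ y, y ∉ K → φ y = 0) :
    𝓓(spaceTime I, ℝ) :=
  ⟨φ, hφ, HasCompactSupport.intro hK h0, (closure_minimal (fun y hy => by
    by_contra h; exact hy (h0 y h)) hK.isClosed).trans hKI⟩

theorem integrable_line {φ : SpaceTime → ℝ} (hφ : Continuous φ) (hc : HasCompactSupport φ)
    (i : Fin 3) (y : SpaceTime) : Integrable fun s : ℝ => φ (y + s • dx i) := by
  refine Continuous.integrable_of_hasCompactSupport (by fun_prop) ?_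
  obtain ⟨C, hC⟩ := hc.isCompact.isBounded.exists_norm_le
  refine HasCompactSupport.intro (isCompact_Icc (a := -C - y.2 i) (b := C - y.2 i)) fun s hs => ?_
  by_contra h
  apply hs
  have h1 := hC _ (subset_tsupport _ h)
  have h2 := (abs_coord_le_norm _ i).trans ((norm_snd_le _).trans h1)
  rw [dx_apply_self, abs_le] at h2
  exact ⟨by linarith [h2.1], by linarith [h2.2]⟩

theorem hasDerivAt_lineIntegral_Iic {φ : SpaceTime → ℝ} (hφ : Continuous φ)
    (hc : HasCompactSupport φ) (i : Fin 3) (y : SpaceTime) :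
    HasDerivAt (fun τ : ℝ => lineIntegral (volume.restrict (Set.Iic 0)) i φ (y + τ • dx i))
      (φ y) 0 := by
  have hi := integrable_line hφ hc i y
  have e : ∀ τ : ℝ, lineIntegral (volume.restrict (Set.Iic 0)) i φ (y + τ • dx i) =
      (∫ s in Set.Iic (0 : ℝ), φ (y + s • dx i)) + ∫ s in (0 : ℝ)..τ, φ (y + s • dx i) := by
    intro τ
    rw [← intervalIntegral.integral_Iic_sub_Iic hi.integrableOn hi.integrableOn,
      add_sub_cancel]
    unfold lineIntegral
    have := (measurePreserving_add_left volume τ).setIntegral_preimage_emb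
      (measurableEmbedding_addLeft τ) (fun s => φ (y + s • dx i)) (Set.Iic τ)
    rw [← this]
    congr 1
    · congr 1; ext s; simp
    · ext s; rw [add_assoc, ← add_smul]
  have h := (intervalIntegral.integral_hasDerivAt_right (a := 0) (b := 0)
    (f := fun s : ℝ => φ (y + s • dx i)) hi.intervalIntegrable
    (hi.1.stronglyMeasurableAtFilter) (by fun_prop)).const_add
    (∫ s in Set.Iic (0 : ℝ), φ (y + s • dx i))
  simp only [e]
  simpa using h

/-- A test function is the sum of a derivative in `x_i` and of a multiple of a fixed profile
in `x_i`, the factor being its integral along lines. -/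
theorem exists_lineDeriv_eq_sub {η : ℝ → ℝ} (hη : ContDiff ℝ (⊤ : ℕ∞) η) (hηc : HasCompactSupport η)
    (hη1 : ∫ s, η s = 1) (i : Fin 3) (φ : 𝓓(spaceTime I, ℝ)) :
    ∃ R ψ : 𝓓(spaceTime I, ℝ), (∀ y, R y = η (y.2 i) * lineIntegral volume i φ y) ∧
      ∀ y, φ y = R y + (∂_{dx i} ψ) y := by
  obtain ⟨C₁, hC₁⟩ := φ.hasCompactSupport.isCompact.isBounded.exists_norm_le
  obtain ⟨C₂, hC₂⟩ := hηc.isCompact.isBounded.exists_norm_le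
  set c := max C₁ C₂ with hcdef
  set Φ := lineIntegral volume i φ with hΦ
  have hΦs : ContDiff ℝ (⊤ : ℕ∞) Φ := contDiff_lineIntegral _ i φ.contDiff φ.hasCompactSupport
  have hη0 : ∀ s, c < |s| → η s = 0 := by
    intro s hs
    by_contra h
    have := hC₂ s (subset_tsupport _ h)
    rw [Real.norm_eq_abs] at this
    exact absurd (this.trans (le_max_right C₁ C₂)) (not_le.2 hs)
  have hφ0 : ∀ y : SpaceTime, c < |y.2 i| → φ y = 0 := by
    intro y hs
    by_contra h
    have := hC₁ y (subset_tsupport _ h)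
    have h2 := (abs_coord_le_norm _ i).trans ((norm_snd_le _).trans this)
    exact absurd (h2.trans (le_max_left C₁ C₂)) (not_le.2 hs)
  have hK := isCompact_lineHull i φ.hasCompactSupport.isCompact c
  have hKI := lineHull_subset i φ.tsupport_subset c
  -- off the lines through the support of `φ` everything vanishes
  have hoff : ∀ y : SpaceTime, (∀ s : ℝ, y + s • dx i ∉ tsupport φ) → ∀ s : ℝ, φ (y + s • dx i) = 0 :=
    fun y hy s => image_eq_zero_of_notMem_tsupport (hy s)
  have hoffΦ : ∀ y : SpaceTime, (∀ s : ℝ, y + s • dx i ∉ tsupport φ) → Φ y = 0 := by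
    intro y hy
    rw [hΦ, lineIntegral]
    simp [hoff y hy]
  have hR0 : ∀ y, y ∉ lineHull i (tsupport φ) c → η (y.2 i) * Φ y = 0 := by
    intro y hy
    by_cases h : ∃ s : ℝ, y + s • dx i ∈ tsupport φ
    · obtain ⟨s, hs⟩ := h
      rw [hη0 _ (not_le.1 fun h => hy (mem_lineHull h hs)), zero_mul]
    · push Not at h
      rw [hoffΦ y h, mul_zero]
  have hηi : ContDiff ℝ (⊤ : ℕ∞) fun y : SpaceTime => η (y.2 i) :=
    hη.comp ((contDiff_coord i).comp contDiff_snd)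
  set R : 𝓓(spaceTime I, ℝ) := testOfCompact hK hKI _ (hηi.mul hΦs) hR0 with hR
  have hRa : ∀ y, R y = η (y.2 i) * Φ y := fun y => rfl
  set φ₀ := φ - R with hφ₀
  have hφ₀a : ∀ y, φ₀ y = φ y - η (y.2 i) * Φ y := fun y => rfl
  have hφ₀0 : ∀ y : SpaceTime, c < |y.2 i| → φ₀ y = 0 := by
    intro y hy
    rw [hφ₀a, hφ0 y hy, hη0 _ hy]; ring
  have hφ₀i : ∀ y : SpaceTime, ∫ s : ℝ, φ₀ (y + s • dx i) = 0 := by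
    intro y
    have e : ∀ s : ℝ, φ₀ (y + s • dx i) = φ (y + s • dx i) - η (y.2 i + s) * Φ y := by
      intro s
      rw [hφ₀a, dx_apply_self, hΦ, lineIntegral_add]
    have hηi : Integrable η := hη.continuous.integrable_of_hasCompactSupport hηc
    simp only [e]
    rw [integral_sub (integrable_line φ.continuous φ.hasCompactSupport i y)
      ((hηi.comp_add_left (y.2 i)).mul_const _), integral_mul_const,
      integral_add_left_eq_self, hη1, one_mul]
    exact sub_self _
  have hψ0 : ∀ y, y ∉ lineHull i (tsupport φ) c →
      lineIntegral (volume.restrict (Set.Iic 0)) i φ₀ y = 0 := by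
    intro y hy
    by_cases h : ∃ s : ℝ, y + s • dx i ∈ tsupport φ
    · obtain ⟨s, hs⟩ := h
      have hyc := not_le.1 fun h => hy (mem_lineHull h hs)
      rcases le_or_gt 0 (y.2 i) with h0 | h0
      · rw [abs_of_nonneg h0] at hyc
        have hint := integrable_line φ₀.continuous φ₀.hasCompactSupport i y
        have h1 : ∫ s in Set.Ioi (0 : ℝ), φ₀ (y + s • dx i) = 0 := by
          refine setIntegral_eq_zero_of_forall_eq_zero fun s hs => hφ₀0 _ ?_
          rw [dx_apply_self]
          have := Set.mem_Ioi.1 hs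
          exact lt_of_lt_of_le (by linarith) (le_abs_self _)
        have h2 := integral_add_compl (measurableSet_Iic (a := (0 : ℝ))) hint
        rw [Set.compl_Iic, h1, hφ₀i, add_zero] at h2
        exact h2
      · rw [abs_of_neg h0] at hyc
        refine setIntegral_eq_zero_of_forall_eq_zero fun s hs => hφ₀0 _ ?_
        rw [dx_apply_self]
        have := Set.mem_Iic.1 hs
        exact lt_of_lt_of_le (by linarith) (neg_le_abs _)
    · push Not at h
      refine setIntegral_eq_zero_of_forall_eq_zero fun s _ => ?_
      rw [hφ₀a, hoff y h, hΦ, lineIntegral_add, ← hΦ, hoffΦ y h]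
      ring
  set ψ : 𝓓(spaceTime I, ℝ) := testOfCompact hK hKI _
    (contDiff_lineIntegral (volume.restrict (Set.Iic 0)) i φ₀.contDiff φ₀.hasCompactSupport) hψ0
    with hψ
  refine ⟨R, ψ, hRa, fun y => ?_⟩
  have h1 := hasDerivAt_lineIntegral_Iic φ₀.continuous φ₀.hasCompactSupport i y
  have h2 : HasDerivAt (fun τ : ℝ => ψ (y + τ • dx i)) (fderiv ℝ ψ y (dx i)) 0 := by
    have h3 := hasFDerivAt_test ψ (y + (0 : ℝ) • dx i)
    have h4 : HasDerivAt (fun τ : ℝ => y + τ • dx i) (dx i) 0 := by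
      simpa using ((hasDerivAt_id (0 : ℝ)).smul_const (dx i)).const_add y
    have h5 := h3.comp_hasDerivAt (0 : ℝ) h4
    rw [zero_smul, add_zero] at h5
    exact h5
  rw [lineDeriv_test_apply, h2.unique h1, hφ₀a, hRa]
  ring

end

/-! ### Limits of distributions -/

section Complete

variable {E F : Type*} [NormedAddCommGroup E] [NormedSpace ℝ E] [NormedAddCommGroup F]
  [NormedSpace ℝ F] {K : Compacts E}

instance isCountablyGenerated_uniformity_contDiffMapSupportedIn :
    (uniformity 𝓓_{K}(E, F)).IsCountablyGenerated := by
  have h := (ContDiffMapSupportedIn.isUniformEmbedding_pi_structureMapCLM (E := E) (F := F)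
    (n := ⊤) (K := K) ℝ).isUniformInducing
  rw [← h.comap_uniformity]
  infer_instance

/-- Uniform limits of smooth functions, all derivatives converging uniformly, are smooth. -/
theorem hasFTaylorSeriesUpTo_of_tendstoUniformly {u : ℕ → E → F}
    (hu : ∀ n, ContDiff ℝ (⊤ : ℕ∞) (u n)) {g : E → FormalMultilinearSeries ℝ E F}
    (hg : ∀ i, Continuous fun x => g x i)
    (hD : ∀ i, TendstoUniformly (fun n x => iteratedFDeriv ℝ i (u n) x) (fun x => g x i) atTop) :
    HasFTaylorSeriesUpTo (⊤ : ℕ∞) (fun x => (g x 0).curry0) g := by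
  refine ⟨fun x => rfl, fun m _ x => ?_, fun m _ => hg m⟩
  refine hasFDerivAt_of_tendstoUniformly (l := atTop)
    (f := fun n y => iteratedFDeriv ℝ m (u n) y)
    (f' := fun n y => (iteratedFDeriv ℝ (m + 1) (u n) y).curryLeft)
    (g' := fun y => (g y (m + 1)).curryLeft) ?_ ?_ (fun y => (hD m).tendsto_at y) x
  · exact (continuousMultilinearCurryLeftEquiv ℝ (fun _ : Fin (m + 1) => E) F).isometry
      |>.uniformContinuous.comp_tendstoUniformly (hD (m + 1))
  · intro n y
    exact (hu n).ftaylorSeries.fderiv m (by exact_mod_cast ENat.natCast_lt_top m) y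

/-- Smooth functions with support in a fixed compact set form a complete space. -/
theorem completeSpace_contDiffMapSupportedIn [CompleteSpace F] :
    CompleteSpace 𝓓_{K}(E, F) := by
  have hemb := ContDiffMapSupportedIn.isUniformEmbedding_pi_structureMapCLM (E := E) (F := F)
    (n := ⊤) (K := K) ℝ
  refine UniformSpace.complete_of_cauchySeq_tendsto fun u hu => ?_
  have hcauchy : ∀ i : ℕ, CauchySeq
      fun n => ContDiffMapSupportedIn.structureMapCLM ℝ ⊤ i (u n) := by
    intro i
    have h1 := hemb.isUniformInducing.uniformContinuous.comp_cauchySeq hu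
    exact (Pi.uniformContinuous_proj _ i).comp_cauchySeq h1
  have hg : ∀ i : ℕ, ∃ g, Tendsto
      (fun n => ContDiffMapSupportedIn.structureMapCLM ℝ ⊤ i (u n)) atTop (𝓝 g) := fun i =>
    cauchySeq_tendsto_of_complete (hcauchy i)
  choose g hg using hg
  have hD : ∀ i, TendstoUniformly (fun n x => iteratedFDeriv ℝ i (u n) x) (g i) atTop := by
    intro i
    have := BoundedContinuousFunction.tendsto_iff_tendstoUniformly.1 (hg i)
    simpa only [ContDiffMapSupportedIn.structureMapCLM_top_apply] using this
  have hT := hasFTaylorSeriesUpTo_of_tendstoUniformly (u := fun n => u n)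
    (g := fun x i => g i x) (fun n => (u n).contDiff) (fun i => (g i).continuous) hD
  have h0 : Set.EqOn (fun x => (g 0 x).curry0) 0 (K : Set E)ᶜ := by
    intro x hx
    have h1 : Tendsto (fun n => (iteratedFDeriv ℝ 0 (u n) x).curry0) atTop
        (𝓝 ((g 0 x).curry0)) :=
      (continuousMultilinearCurryFin0 ℝ E F).continuous.tendsto _ |>.comp ((hD 0).tendsto_at x)
    have h2 : ∀ n, (iteratedFDeriv ℝ 0 (u n) x).curry0 = 0 := fun n => (u n).zero_on_compl hx
    simp only [h2] at h1
    exact (tendsto_nhds_unique h1 tendsto_const_nhds)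
  let a : 𝓓_{K}(E, F) := ⟨_, hT.contDiff, h0⟩
  have ha : ∀ i, ContDiffMapSupportedIn.structureMapCLM ℝ ⊤ i a = g i := by
    intro i
    apply DFunLike.coe_injective
    rw [ContDiffMapSupportedIn.structureMapCLM_top_apply]
    ext x : 1
    exact (hT.eq_iteratedFDeriv (by exact_mod_cast le_top) x).symm
  refine ⟨a, hemb.isUniformInducing.isInducing.tendsto_nhds_iff.2 (tendsto_pi_nhds.2 fun i => ?_)⟩
  have := hg i
  rw [← ha i] at this
  exact this

/-- Fréchet spaces are barrelled, by the theorem of Baire. -/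
theorem barrelledSpace_contDiffMapSupportedIn [CompleteSpace F] :
    BarrelledSpace ℝ 𝓓_{K}(E, F) := by
  have := completeSpace_contDiffMapSupportedIn (E := E) (F := F) (K := K)
  let := UniformSpace.pseudoMetricSpace 𝓓_{K}(E, F)
  infer_instance

/-- The pointwise limit of a sequence of distributions is a distribution, by the theorem of Banach
and Steinhaus on each of the spaces of test functions with support in a fixed compact set. -/
theorem exists_distribution_of_tendsto {U : Opens E} (p : ℕ → 𝓓(U, ℝ) →L[ℝ] ℝ)
    (l : 𝓓(U, ℝ) → ℝ) (h : ∀ φ, Tendsto (fun n => p n φ) atTop (𝓝 (l φ))) :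
    ∃ P : 𝓓'(U, ℝ), ∀ φ, P φ = l φ := by
  have hadd : ∀ φ ψ, l (φ + ψ) = l φ + l ψ := fun φ ψ => by
    refine tendsto_nhds_unique (h (φ + ψ)) ?_
    simpa only [map_add] using (h φ).add (h ψ)
  have hsmul : ∀ (c : ℝ) φ, l (c • φ) = c • l φ := fun c φ => by
    refine tendsto_nhds_unique (h (c • φ)) ?_
    simpa only [map_smul] using (h φ).const_smul c
  have hc : ∀ (K : Compacts E) (hK : (K : Set E) ⊆ U),
      Continuous (l ∘ TestFunction.ofSupportedIn hK) := by
    intro K hK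
    have := barrelledSpace_contDiffMapSupportedIn (E := E) (F := ℝ) (K := K)
    refine (continuousLinearMapOfTendsto (l := atTop)
      (fun n => (p n).comp (TestFunction.ofSupportedInCLM ℝ hK))
      (f := l ∘ TestFunction.ofSupportedIn hK) ?_).continuous
    rw [tendsto_pi_nhds]
    exact fun φ => h _
  let P := TestFunction.mkCLM ℝ l hadd hsmul hc
  exact ⟨⟨P.toLinearMap, P.continuous⟩, fun φ => rfl⟩

end Complete

/-! ### Construction of the pressure -/

section

variable {I : Opens ℝ}

/-- Modulo divergences in `x`, a test function is a fixed function of `x` times a function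
of `t`. -/
theorem exists_profile : ∃ χ : V3 → ℝ, Continuous χ ∧ HasCompactSupport χ ∧ ∫ x, χ x = 1 ∧
    ∀ (I : Opens ℝ) (φ : 𝓓(spaceTime I, ℝ)), ∃ (Ψ : ℝ → ℝ) (ψ : Fin 3 → 𝓓(spaceTime I, ℝ)),
      ∀ y, φ y = χ y.2 * Ψ y.1 + ∑ i, (∂_{dx i} (ψ i)) y := by
  let β : ContDiffBump (0 : ℝ) := default
  set η : ℝ → ℝ := β.normed volume with hη
  have hηs : ContDiff ℝ (⊤ : ℕ∞) η := β.contDiff_normed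
  have hηc : HasCompactSupport η := β.hasCompactSupport_normed
  have hη1 : ∫ s, η s = 1 := β.integral_normed
  have hη0 : η 0 ≠ 0 := by
    have := β.nonneg_normed (μ := volume) 0
    rw [hη, ContDiffBump.normed_def]
    refine div_ne_zero ?_ β.integral_pos.ne'
    exact (β.pos_of_mem_ball (by simp [β.rOut_pos])).ne'
  -- integrate along the three axes in turn
  set χ₀ : V3 → ℝ := fun x => η (x 0) * η (x 1) * η (x 2) with hχ₀
  have hηcont := hηs.continuous
  have hχc : Continuous χ₀ := by fun_prop
  obtain ⟨C, hC⟩ := hηc.isCompact.isBounded.exists_norm_le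
  have hχs : HasCompactSupport χ₀ := by
    refine HasCompactSupport.intro (isCompact_closedBall (0 : V3) (Real.sqrt (3 * C ^ 2)))
      fun x hx => ?_
    by_contra h
    simp only [hχ₀, mul_ne_zero_iff] at h
    apply hx
    rw [mem_closedBall_zero_iff]
    refine Real.le_sqrt_of_sq_le ?_
    have hb : ∀ i, η (x i) ≠ 0 → x i ^ 2 ≤ C ^ 2 := fun i hi =>
      sq_le_sq' (abs_le.1 (hC _ (subset_tsupport _ hi))).1 (abs_le.1 (hC _ (subset_tsupport _ hi))).2
    rw [EuclideanSpace.norm_sq_eq, Fin.sum_univ_three]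
    simp only [Real.norm_eq_abs, sq_abs]
    linarith [hb 0 h.1.1, hb 1 h.1.2, hb 2 h.2]
  have hpos : 0 < ∫ x, χ₀ x := by
    refine hχc.integral_pos_of_hasCompactSupport_nonneg_nonzero hχs ?_ (x := 0) ?_
    · intro x
      have := fun s => β.nonneg_normed (μ := volume) s
      exact mul_nonneg (mul_nonneg (this _) (this _)) (this _)
    · simp [hχ₀, hη0]
  set c := ∫ x, χ₀ x with hc
  refine ⟨fun x => c⁻¹ * χ₀ x, by fun_prop, hχs.mul_left, ?_, fun I φ => ?_⟩
  · rw [integral_const_mul, inv_mul_cancel₀ hpos.ne']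
  obtain ⟨R₀, ψ₀, hR₀, e₀⟩ := exists_lineDeriv_eq_sub hηs hηc hη1 0 φ
  obtain ⟨R₁, ψ₁, hR₁, e₁⟩ := exists_lineDeriv_eq_sub hηs hηc hη1 1 R₀
  obtain ⟨R₂, ψ₂, hR₂, e₂⟩ := exists_lineDeriv_eq_sub hηs hηc hη1 2 R₁
  set Φ₀ := lineIntegral volume 0 φ with hΦ₀
  set Φ₁ := lineIntegral volume 1 Φ₀ with hΦ₁
  set Φ₂ := lineIntegral volume 2 Φ₁ with hΦ₂
  have h1 : ∀ y, R₁ y = η (y.2 1) * (η (y.2 0) * Φ₁ y) := by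
    intro y
    rw [hR₁, hΦ₁]
    unfold lineIntegral
    simp only [hR₀, dx_apply_ne (show (0 : Fin 3) ≠ 1 by decide), integral_const_mul]
  have h2 : ∀ y, R₂ y = η (y.2 2) * (η (y.2 1) * (η (y.2 0) * Φ₂ y)) := by
    intro y
    rw [hR₂, hΦ₂]
    unfold lineIntegral
    simp only [h1, dx_apply_ne (show (0 : Fin 3) ≠ 2 by decide),
      dx_apply_ne (show (1 : Fin 3) ≠ 2 by decide), integral_const_mul]
  have i0 : ∀ y (s : ℝ), Φ₂ (y + s • dx 0) = Φ₂ y := fun y s =>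
    lineIntegral_add_comm 2 0 _ y s fun y => lineIntegral_add_comm 1 0 _ y s fun y =>
      lineIntegral_add 0 _ y s
  have i1 : ∀ y (s : ℝ), Φ₂ (y + s • dx 1) = Φ₂ y := fun y s =>
    lineIntegral_add_comm 2 1 _ y s fun y => lineIntegral_add 1 _ y s
  have i2 : ∀ y (s : ℝ), Φ₂ (y + s • dx 2) = Φ₂ y := fun y s => lineIntegral_add 2 _ y s
  -- the triple integral depends on the time only
  have i3 : ∀ y : SpaceTime, Φ₂ y = Φ₂ (y.1, 0) := by
    intro y
    have e : y = ((y.1, 0) : SpaceTime) + y.2 0 • dx 0 + y.2 1 • dx 1 + y.2 2 • dx 2 := by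
      have h := spaceTime_eq_sum y.1 y.2
      have h' := spaceTime_eq_sum y.1 0
      rw [Fin.sum_univ_three] at h
      simp only [PiLp.zero_apply, zero_smul, Finset.sum_const_zero, add_zero] at h'
      rw [h', add_assoc, add_assoc, ← add_assoc (y.2 0 • dx 0)]
      exact h
    conv_lhs => rw [e, i2, i1, i0]
  refine ⟨fun t => c * Φ₂ (t, 0), ![ψ₀, ψ₁, ψ₂], fun y => ?_⟩
  rw [e₀, e₁, e₂, h2, i3, Fin.sum_univ_three]
  simp only [hχ₀, Matrix.cons_val_zero, Matrix.cons_val_one, Matrix.cons_val]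
  field_simp
  ring

/-- The restriction of a test function to a time `t`. -/
def sliceTest (t : ℝ) (φ : 𝓓(spaceTime I, ℝ)) : 𝓓((⊤ : Opens V3), ℝ) :=
  ⟨fun x => φ (t, x), φ.contDiff.comp (contDiff_const.prodMk contDiff_id),
    HasCompactSupport.intro (φ.hasCompactSupport.isCompact.image continuous_snd) fun x hx => by
      by_contra h
      exact hx ⟨_, subset_tsupport _ h, rfl⟩, fun _ _ => trivial⟩

theorem integral_slice_lineDeriv (t : ℝ) (i : Fin 3) (φ : 𝓓(spaceTime I, ℝ)) :
    ∫ x, (∂_{dx i} φ) (t, x) = 0 := by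
  rw [← integral_lineDeriv_test (sliceTest t φ) (EuclideanSpace.single i 1)]
  congr 1; ext x
  rw [lineDeriv_test_apply, lineDeriv_test_apply]
  have h := (hasFDerivAt_test φ (t, x)).comp x ((hasFDerivAt_const t x).prodMk (hasFDerivAt_id x))
  have h' : HasFDerivAt (sliceTest t φ) _ x := h
  rw [h'.fderiv]
  rfl

/-- The average in `x` of a function of `(t, x)`, for the weight `χ`; it is a function of `t`,
considered as a function of `(t, x)`. -/
def average (χ : V3 → ℝ) (P : SpaceTime → ℝ) (y : SpaceTime) : ℝ := ∫ x, P (y.1, x) * χ x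

theorem locallyIntegrableOn_average {χ : V3 → ℝ} (hχ : Continuous χ) (hχc : HasCompactSupport χ)
    {P : SpaceTime → ℝ} (hP : LocallyIntegrableOn P (spaceTime I)) :
    LocallyIntegrableOn (average χ P) (spaceTime I) := by
  rw [locallyIntegrableOn_iff (spaceTime I).isOpen.isLocallyClosed]
  intro K hKI hK
  have hK1 : IsCompact (Prod.fst '' K) := hK.image continuous_fst
  have hK2 : IsCompact (Prod.snd '' K) := hK.image continuous_snd
  have hK1I : Prod.fst '' K ⊆ I := by
    rintro _ ⟨y, hy, rfl⟩
    exact (hKI hy).1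
  obtain ⟨C, hC⟩ := hχ.bounded_above_of_compact_support hχc
  have h1 : IntegrableOn (fun y : SpaceTime => P y * χ y.2) ((Prod.fst '' K) ×ˢ tsupport χ) :=
    Integrable.mul_bdd (c := C) (hP.integrableOn_compact_subset
      (fun y hy => ⟨hK1I hy.1, trivial⟩) (hK1.prod hχc))
      (hχ.comp continuous_snd).aestronglyMeasurable (ae_of_all _ fun y => hC y.2)
  have h2 : IntegrableOn (fun y : SpaceTime => P y * χ y.2) ((Prod.fst '' K) ×ˢ Set.univ) := by
    refine h1.of_forall_sdiff_eq_zero (hK1.measurableSet.prod MeasurableSet.univ) fun y hy => ?_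
    rw [image_eq_zero_of_notMem_tsupport fun h => hy.2 ⟨hy.1.1, h⟩, mul_zero]
  rw [IntegrableOn, Measure.volume_eq_prod, ← Measure.prod_restrict, Measure.restrict_univ] at h2
  have h3 := h2.integral_prod_left
  have : IsFiniteMeasure ((volume : Measure V3).restrict (Prod.snd '' K)) :=
    ⟨by simpa using hK2.measure_lt_top⟩
  have h4 := h3.comp_fst ((volume : Measure V3).restrict (Prod.snd '' K))
  rw [Measure.prod_restrict] at h4
  exact IntegrableOn.mono_set h4 Set.subset_fst_image_prod_snd_image

theorem integral_average_mul_lineDeriv {χ : V3 → ℝ} {P : SpaceTime → ℝ}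
    (hP : LocallyIntegrableOn (average χ P) (spaceTime I)) (i : Fin 3) (φ : 𝓓(spaceTime I, ℝ)) :
    ∫ y, average χ P y * (∂_{dx i} φ) y = 0 := by
  have h := integrable_mul_test hP (∂_{dx i} φ)
  rw [Measure.volume_eq_prod] at h ⊢
  rw [integral_prod _ h]
  have e : ∀ t x, average χ P (t, x) = average χ P (t, 0) := fun t x => rfl
  simp only [e, integral_const_mul, integral_slice_lineDeriv, mul_zero, integral_zero]

theorem integral_average_mul_profile {χ : V3 → ℝ} (hχ1 : ∫ x, χ x = 1) {P : SpaceTime → ℝ}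
    {Ψ : ℝ → ℝ} (h1 : Integrable fun y : SpaceTime => P y * (χ y.2 * Ψ y.1))
    (h2 : Integrable fun y : SpaceTime => average χ P y * (χ y.2 * Ψ y.1)) :
    ∫ y, average χ P y * (χ y.2 * Ψ y.1) = ∫ y, P y * (χ y.2 * Ψ y.1) := by
  rw [Measure.volume_eq_prod] at h1 h2 ⊢
  rw [integral_prod _ h1, integral_prod _ h2]
  congr 1; ext t
  have e : ∀ x, average χ P (t, x) * (χ x * Ψ t) = average χ P (t, 0) * Ψ t * χ x := fun x => by
    rw [show average χ P (t, x) = average χ P (t, 0) from rfl]; ring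
  simp only [e, integral_const_mul, hχ1, mul_one, ← mul_assoc, integral_mul_const]
  rfl

theorem IsPeriodic.average {Lam : Set V3} {P : SpaceTime → ℝ} (χ : V3 → ℝ) :
    IsPeriodic I Lam (average χ P) := fun _ _ _ _ _ => rfl

theorem IsPeriodic.integral_mul_eq {Lam : Set V3} {W : SpaceTime → ℝ} (hW : IsPeriodic I Lam W)
    {k : V3} (hk : k ∈ Lam) {φ ψ : 𝓓(spaceTime I, ℝ)} (h : ∀ t x, ψ (t, x) = φ (t, x + k)) :
    ∫ y, W y * ψ y = ∫ y, W y * φ y := by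
  rw [← integral_add_right_eq_self (fun y => W y * φ y) ((0, k) : SpaceTime)]
  congr 1; ext ⟨t, x⟩
  simp only [Prod.mk_add_mk, add_zero, h]
  by_cases ht : t ∈ I
  · rw [hW k hk t ht]
  · rw [test_eq_zero φ (z := (t, x + k)) fun h => ht h.1, mul_zero, mul_zero]

/-- If the gradients in `x` of periodic functions converge in the sense of distributions, the
limit is the gradient of a periodic distribution. The functions themselves converge, once their
averages in `x` have been subtracted, as test functions are of the form `χ(x) Ψ(t)` modulo
divergences. -/
theorem exists_distribution_of_tendsto_gradient {Lam : Set V3} {P : ℕ → SpaceTime → ℝ}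
    (hP : ∀ n, LocallyIntegrableOn (P n) (spaceTime I)) (hper : ∀ n, IsPeriodic I Lam (P n))
    {T : Fin 3 → 𝓓(spaceTime I, ℝ) → ℝ}
    (hT : ∀ i φ, Tendsto (fun n => ∫ y, P n y * (∂_{dx i} φ) y) atTop (𝓝 (T i φ))) :
    ∃ p, IsPeriodicDist I Lam p ∧ ∀ i φ, (∂_{dx i} p) φ = -T i φ := by
  obtain ⟨χ, hχ, hχc, hχ1, hdec⟩ := exists_profile
  have hA := fun n => locallyIntegrableOn_average hχ hχc (hP n)
  set W : ℕ → SpaceTime → ℝ := fun n y => P n y - average χ (P n) y with hWdef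
  have hW : ∀ n, LocallyIntegrableOn (W n) (spaceTime I) := fun n => (hP n).sub (hA n)
  have hWper : ∀ n, IsPeriodic I Lam (W n) := by
    intro n k hk t ht x
    simp only [hWdef, hper n k hk t ht x, IsPeriodic.average (I := I) χ k hk t ht x]
  have hWφ : ∀ n (φ : 𝓓(spaceTime I, ℝ)), ∫ y, W n y * φ y =
      (∫ y, P n y * φ y) - ∫ y, average χ (P n) y * φ y := by
    intro n φ
    rw [← integral_sub (integrable_mul_test (hP n) φ) (integrable_mul_test (hA n) φ)]
    simp only [hWdef, sub_mul]
  have hWi : ∀ n i (φ : 𝓓(spaceTime I, ℝ)), ∫ y, W n y * (∂_{dx i} φ) y = ∫ y, P n y * (∂_{dx i} φ) y := by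
    intro n i φ
    rw [hWφ, integral_average_mul_lineDeriv (hA n), sub_zero]
  -- `W n` annihilates the profiles `χ(x) Ψ(t)`, so only the divergence part of a test
  -- function counts
  choose Ψ ψ hψ using hdec I
  have hlim : ∀ φ, Tendsto (fun n => ∫ y, W n y * φ y) atTop (𝓝 (∑ i, T i (ψ φ i))) := by
    intro φ
    have e : ∀ n, ∫ y, W n y * φ y = ∑ i, ∫ y, P n y * (∂_{dx i} (ψ φ i)) y := by
      intro n
      have hG : ∀ y : SpaceTime, χ y.2 * Ψ φ y.1 = (φ - ∑ i, ∂_{dx i} (ψ φ i)) y := by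
        intro y
        have := hψ φ y
        simp only [FunLike.coe_sub, FunLike.coe_sum, Pi.sub_apply, Finset.sum_apply]
        linarith
      have g1 := integrable_mul_test (hP n) (φ - ∑ i, ∂_{dx i} (ψ φ i))
      have g2 := integrable_mul_test (hA n) (φ - ∑ i, ∂_{dx i} (ψ φ i))
      simp only [← hG] at g1 g2
      have e1 := integral_average_mul_profile hχ1 g1 g2
      have g3 : Integrable fun y => W n y * (χ y.2 * Ψ φ y.1) := by
        simp only [hWdef, sub_mul]
        exact g1.sub g2
      have e2 : ∫ y, W n y * (χ y.2 * Ψ φ y.1) = 0 := by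
        simp only [hWdef, sub_mul]
        rw [integral_sub g1 g2, e1, sub_self]
      have e3 : ∀ y, W n y * φ y = W n y * (χ y.2 * Ψ φ y.1) +
          ∑ i, W n y * (∂_{dx i} (ψ φ i)) y := by
        intro y
        rw [hψ φ y, mul_add, Finset.mul_sum]
      simp only [e3]
      rw [integral_add g3 (integrable_finsetSum _ fun i _ => integrable_mul_test (hW n) _), e2,
        zero_add, integral_finsetSum _ fun i _ => integrable_mul_test (hW n) _]
      exact Finset.sum_congr rfl fun i _ => hWi n i _
    simp only [e]
    exact tendsto_finsetSum _ fun i _ => hT i _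
  have hB : ∀ n (φ : 𝓓(spaceTime I, ℝ)), TestFunction.integralAgainstBilinCLM (Ω := spaceTime I) (n := ⊤)
      (ContinuousLinearMap.mul ℝ ℝ) volume (W n) φ = ∫ y, W n y * φ y := by
    intro n φ
    rw [TestFunction.integralAgainstBilinCLM_eq_integral (hW n)]
    simp only [ContinuousLinearMap.mul_apply', mul_comm]
  obtain ⟨p, hp⟩ := exists_distribution_of_tendsto
    (fun n => TestFunction.integralAgainstBilinCLM (Ω := spaceTime I) (n := ⊤)
      (ContinuousLinearMap.mul ℝ ℝ) volume (W n)) _ fun φ => by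
        simpa only [hB] using hlim φ
  have hplim : ∀ φ, Tendsto (fun n => ∫ y, W n y * φ y) atTop (𝓝 (p φ)) := fun φ => by
    rw [hp]; exact hlim φ
  refine ⟨p, fun k hk φ ψ h => ?_, fun i φ => ?_⟩
  · refine tendsto_nhds_unique (hplim ψ) ?_
    refine (hplim φ).congr fun n => ?_
    exact ((hWper n).integral_mul_eq hk h).symm
  · rw [Distribution.lineDerivOp_apply_apply]
    rw [map_neg, neg_inj]
    exact tendsto_nhds_unique (hplim _) ((hT i φ).congr fun n => (hWi n i φ).symm)

end

/-! ### The macroscopic fields -/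

section

variable {b : ℝ → ℝ → ℝ} {I : Opens ℝ}

section Fields

theorem FieldL2.integrableOn_mul {F G : SpaceTime → ℝ} (hF : FieldL2 I F) (hG : FieldL2 I G)
    {K : Set SpaceTime} (hK : IsCompact K) (hKI : K ⊆ spaceTime I) :
    IntegrableOn (fun y => F y * G y) K := by
  refine ((hF.2 K hK hKI).add (hG.2 K hK hKI)).mono' (hF.1.mul hG.1).aestronglyMeasurable
    (ae_of_all _ fun y => ?_)
  simp only [Pi.add_apply, Real.norm_eq_abs]
  rw [abs_le]
  constructor <;> nlinarith [sq_nonneg (F y + G y), sq_nonneg (F y - G y)]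

theorem locallyIntegrableOn_of_compact {F : SpaceTime → ℝ}
    (h : ∀ K : Set SpaceTime, IsCompact K → K ⊆ spaceTime I → IntegrableOn F K) :
    LocallyIntegrableOn F (spaceTime I) :=
  (locallyIntegrableOn_iff (spaceTime I).isOpen.isLocallyClosed).2 fun K hKI hK => h K hK hKI

theorem FieldL2.locallyIntegrableOn_mul {F G : SpaceTime → ℝ} (hF : FieldL2 I F)
    (hG : FieldL2 I G) : LocallyIntegrableOn (fun y => F y * G y) (spaceTime I) :=
  locallyIntegrableOn_of_compact fun _ hK hKI => hF.integrableOn_mul hG hK hKI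

theorem FieldL2.locallyIntegrableOn {F : SpaceTime → ℝ} (hF : FieldL2 I F) :
    LocallyIntegrableOn F (spaceTime I) := by
  have h1 : FieldL2 I fun _ => 1 :=
    ⟨measurable_const, fun K hK _ => integrableOn_const hK.measure_lt_top.ne⟩
  simpa using hF.locallyIntegrableOn_mul h1

theorem HasMoment.locallyIntegrableOn {h : SpaceTime → V3 → ℝ} {ψ : V3 → ℝ}
    (hh : HasMoment I h ψ) : LocallyIntegrableOn (moment h ψ) (spaceTime I) := by
  refine locallyIntegrableOn_of_compact fun K hK hKI => ?_
  have := hh K hK hKI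
  rw [IntegrableOn, restrict_prod_univ] at this
  exact this.integral_prod_left

theorem integral_mul_test_congr {F G : SpaceTime → ℝ} (h : ∀ᵐ y, y ∈ spaceTime I → F y = G y)
    (φ : 𝓓(spaceTime I, ℝ)) : ∫ y, F y * φ y = ∫ y, G y * φ y := by
  refine integral_congr_ae ?_
  filter_upwards [h] with y hy
  by_cases hyI : y ∈ spaceTime I
  · rw [hy hyI]
  · simp [test_eq_zero φ hyI]

theorem HasMoment.integral_moment_lin {h : SpaceTime → V3 → ℝ} {ψ χ : V3 → ℝ}
    (hψ : HasMoment I h ψ) (hχ : HasMoment I h χ) (c d : ℝ) (φ : 𝓓(spaceTime I, ℝ)) :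
    ∫ y, moment h (fun v => c * ψ v + d * χ v) y * φ y =
      c * (∫ y, moment h ψ y * φ y) + d * ∫ y, moment h χ y * φ y := by
  have hlin : HasMoment I h fun v => c * ψ v + d * χ v := by
    intro K hK hKI
    refine (((hψ K hK hKI).const_mul c).add ((hχ K hK hKI).const_mul d)).congr
      (ae_of_all _ fun z => ?_)
    simp only [Pi.add_apply]; ring
  rw [← hlin.integral_eq, ← hψ.integral_eq, ← hχ.integral_eq, ← integral_const_mul,
    ← integral_const_mul, ← integral_add ((hψ.integrable φ).const_mul c)
      ((hχ.integrable φ).const_mul d)]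
  congr 1; ext z; ring

theorem HasMoment.integral_moment_sum {h : SpaceTime → V3 → ℝ} {ψ : Fin 3 → V3 → ℝ}
    (hψ : ∀ i, HasMoment I h (ψ i)) (φ : 𝓓(spaceTime I, ℝ)) :
    ∫ y, moment h (fun v => ∑ i, ψ i v) y * φ y = ∑ i, ∫ y, moment h (ψ i) y * φ y := by
  have hsum : HasMoment I h fun v => ∑ i, ψ i v := by
    intro K hK hKI
    refine (integrable_finsetSum Finset.univ fun i _ => hψ i K hK hKI).congr
      (ae_of_all _ fun z => ?_)
    simp only [Finset.mul_sum, Finset.sum_mul]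
  rw [← hsum.integral_eq, Finset.sum_congr rfl fun i _ => ((hψ i).integral_eq φ).symm,
    ← integral_finsetSum _ fun i _ => (hψ i).integrable φ]
  simp only [Finset.mul_sum, Finset.sum_mul]

/-- A weak form of the Cauchy–Schwarz inequality; the summand `1` spares the case of a vanishing
`ψ`. -/
theorem sq_pairM_le {h ψ : V3 → ℝ} (hh : Integrable fun v => h v ^ 2 * M v)
    (hψ : Integrable fun v => ψ v ^ 2 * M v) (hhψ : Integrable fun v => h v * ψ v * M v) :
    pairM h ψ ^ 2 ≤ (∫ v, h v ^ 2 * M v) * ((∫ v, ψ v ^ 2 * M v) + 1) := by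
  set N := ∫ v, h v ^ 2 * M v
  set P := ∫ v, ψ v ^ 2 * M v
  have hP : 0 ≤ P := integral_nonneg fun v => mul_nonneg (sq_nonneg _) (M_pos v).le
  have key : ∀ s : ℝ, 0 ≤ N - 2 * s * pairM h ψ + s ^ 2 * P := by
    intro s
    have e : N - 2 * s * pairM h ψ + s ^ 2 * P = ∫ v, (h v - s * ψ v) ^ 2 * M v := by
      unfold pairM
      have i1 : Integrable fun v => h v ^ 2 * M v - 2 * s * (h v * ψ v * M v) :=
        hh.sub (hhψ.const_mul _)
      rw [← integral_const_mul, ← integral_const_mul, ← integral_sub hh (hhψ.const_mul _),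
        ← integral_add i1 (hψ.const_mul _)]
      congr 1; ext v; ring
    rw [e]
    exact integral_nonneg fun v => mul_nonneg (sq_nonneg _) (M_pos v).le
  have h1 := key (pairM h ψ / (P + 1))
  have hP1 : 0 < P + 1 := by linarith
  have e : N - 2 * (pairM h ψ / (P + 1)) * pairM h ψ + (pairM h ψ / (P + 1)) ^ 2 * P =
      (N * (P + 1) ^ 2 - pairM h ψ ^ 2 * (P + 2)) / (P + 1) ^ 2 := by
    field_simp
    ring
  rw [e] at h1
  have h2 : 0 ≤ N * (P + 1) ^ 2 - pairM h ψ ^ 2 * (P + 2) := by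
    rcases (div_nonneg_iff.1 h1) with h | h
    · exact h.1
    · exact absurd h.2 (not_le.2 (by positivity))
  have h3 : pairM h ψ ^ 2 * (P + 1) ≤ N * (P + 1) * (P + 1) := by
    nlinarith [sq_nonneg (pairM h ψ)]
  exact le_of_mul_le_mul_right h3 hP1

theorem LocL2.fieldL2_moment (hb : IsCutoffKernel b) {h : SpaceTime → V3 → ℝ}
    (hh : LocL2 b I (fun _ => 1) h) {ψ : V3 → ℝ} (hψ : InDomain b ψ) :
    FieldL2 I (moment h ψ) := by
  have hm : Measurable (moment h ψ) :=
    ((measurable_fiber hh.1 hψ.1).stronglyMeasurable.integral_prod_right').measurable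
  refine ⟨hm, fun K hK hKI => ?_⟩
  refine ((hh.integrableOn_integral hK hKI).mul_const
    ((∫ v, ψ v ^ 2 * M v) + 1)).mono' (hm.pow_const 2).aestronglyMeasurable ?_
  filter_upwards [ae_restrict_of_ae hh.ae_inDomain, ae_restrict_mem hK.measurableSet] with y h1 h2
  have hd := h1 (hKI h2)
  rw [Real.norm_of_nonneg (sq_nonneg _)]
  refine (sq_pairM_le (hd.integrable_sq hb) (hψ.integrable_sq hb) (hd.integrable_mul hb hψ)).trans ?_
  have hP : 0 ≤ ∫ v, ψ v ^ 2 * M v := integral_nonneg fun v =>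
    mul_nonneg (sq_nonneg _) (M_pos v).le
  refine mul_le_mul_of_nonneg_right (integral_mono (hd.integrable_sq hb) (by simpa using hd.2)
    fun v => ?_) (by linarith)
  have := mul_nonneg (mul_nonneg (freq_nonneg hb v) (sq_nonneg (h y v))) (M_pos v).le
  simp only
  nlinarith

theorem IsPeriodic.moment {Lam : Set V3} {h : SpaceTime → V3 → ℝ} (hh : IsPeriodic I Lam h)
    (ψ : V3 → ℝ) : IsPeriodic I Lam (moment h ψ) := by
  intro k hk t ht x
  simp only [StationaryLimit.moment, hh k hk t ht x]

/-- The velocity field `⟨h, v⟩_M`. -/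
def velocity (h : SpaceTime → V3 → ℝ) (y : SpaceTime) : V3 :=
  WithLp.toLp 2 fun i => moment h (fun v => v i) y

/-- The temperature field `⟨h, |v|²/3 - 1⟩_M`. -/
def temperature (h : SpaceTime → V3 → ℝ) (y : SpaceTime) : ℝ :=
  moment h (fun v => 1 / 3 * ‖v‖ ^ 2 + -1 * 1) y

@[simp]
theorem velocity_apply (h : SpaceTime → V3 → ℝ) (y : SpaceTime) (i : Fin 3) :
    velocity h y i = moment h (fun v => v i) y := rfl

theorem polyGrowth_temperature : PolyGrowth fun v : V3 => 1 / 3 * ‖v‖ ^ 2 + -1 * 1 :=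
  (PolyGrowth.normSq.const_mul _).add ((PolyGrowth.const 1).const_mul _)

/-- Elements of the kernel of `L` are determined by their density, velocity and temperature. -/
theorem InKer.eq_quadInv (hb : IsCutoffKernel b) {g : SpaceTime → V3 → ℝ} {y : SpaceTime}
    (hg : InKer b (g y)) : g y =ᵐ[volume] quadInv
      (moment g (fun _ => 1) y - 3 / 2 * temperature g y) (velocity g y)
      (1 / 2 * temperature g y) := by
  obtain ⟨a, c, d, e⟩ := hg.exists_quadInv hb
  have hq := (polyGrowth_quadInv a c d).inDomain hb
  have h1 : moment g (fun _ => 1) y = a + 3 * d := by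
    rw [moment, pairM_congr_left e, pairM_quadInv_one]
  have h2 : ∀ i, velocity g y i = c i := fun i => by
    rw [velocity_apply, moment, pairM_congr_left e, pairM_quadInv_coord]
  have h3 : temperature g y = 2 * d := by
    rw [temperature, moment, pairM_congr_left e, hq.pairM_add_right hb
      ((PolyGrowth.normSq.const_mul _).inDomain hb)
      (((PolyGrowth.const 1).const_mul _).inDomain hb), pairM_const_mul_right,
      pairM_const_mul_right, pairM_quadInv_normSq, pairM_quadInv_one]
    ring
  have h4 : quadInv (moment g (fun _ => 1) y - 3 / 2 * temperature g y) (velocity g y)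
      (1 / 2 * temperature g y) = quadInv a c d := by
    ext v
    unfold quadInv
    simp only [h1, h2, h3]
    ring
  rw [h4]
  exact e

end Fields

theorem lineDeriv_test_comm {E : Type*} [NormedAddCommGroup E] [NormedSpace ℝ E] {U : Opens E}
    (φ : 𝓓(U, ℝ)) (v w z : E) : (∂_{v} (∂_{w} φ)) z = (∂_{w} (∂_{v} φ)) z := by
  have hd : ContDiff ℝ 1 (fderiv ℝ φ) := φ.contDiff.fderiv_right (m := 1) (by norm_cast)
  have key : ∀ w v, (∂_{v} (∂_{w} φ)) z = fderiv ℝ (fderiv ℝ φ) z v w := by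
    intro w v
    rw [lineDeriv_test_apply]
    have e : ⇑(∂_{w} φ : 𝓓(U, ℝ)) = fun z => fderiv ℝ φ z w := funext (lineDeriv_test_apply φ w)
    rw [e, fderiv_clm_apply (hd.differentiable (by simp)).differentiableAt
      (differentiableAt_const w)]
    simp
  rw [key, key]
  exact (φ.contDiff.contDiffAt.isSymmSndFDerivAt (by simp; norm_cast)) v w

end

/-! ### The fluid limit -/

section

variable {b : ℝ → ℝ → ℝ} {I : Opens ℝ}

/-- The data of the limit: fluctuations `g n` about the Maxwellian that solve the scaled kinetic
equation in weak form, and converge together with their moments to `g₀`, which takes its values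
in the kernel of `L`. -/
structure FluidLimit (b : ℝ → ℝ → ℝ) (I : Opens ℝ) (q r : ℝ) (ε : ℕ → ℝ)
    (g : ℕ → SpaceTime → V3 → ℝ) (g₀ : SpaceTime → V3 → ℝ) : Prop where
  kernel : IsCutoffKernel b
  pos : ∀ n, 0 < ε n
  tendsto_zero : Tendsto ε atTop (𝓝 0)
  locL2 : ∀ n, LocL2 b I (fun v => (1 + ‖v‖ ^ 2) ^ 2) (g n)
  locL2_limit : LocL2 b I (fun _ => 1) g₀
  equation : ∀ n (Φ : 𝓓(phase I, ℝ)), ∫ z : SpaceTime × V3,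
    (g n z.1 z.2 * fderiv ℝ Φ z ((ε n, z.2), 0) +
      (ε n) ^ (-q) * (-L b (g n z.1) z.2 + (ε n) ^ r * Gam b (g n z.1) z.2) * Φ z) = 0
  inKer : ∀ᵐ y, y ∈ spaceTime I → InKer b (g₀ y)
  moment_one : MomentTendsto I g g₀ (fun _ => 1)
  moment_coord : ∀ i, MomentTendsto I g g₀ (fun v => v i)
  moment_coord_coord : ∀ i j, MomentTendsto I g g₀ (fun v => v i * v j)

/-- The convergence of the moments related to a solution `X` of `L X = F`. -/
structure FluxLimit (b : ℝ → ℝ → ℝ) (I : Opens ℝ) (ε : ℕ → ℝ) (g : ℕ → SpaceTime → V3 → ℝ)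
    (g₀ : SpaceTime → V3 → ℝ) (X F : V3 → ℝ) : Prop where
  inKerPerp : InKerPerp b X
  L_eq : L b X =ᵐ[volume] F
  moment_coord : ∀ j, MomentTendsto I g g₀ (fun v => X v * v j)
  hasMoment_Gam : ∀ n, HasMoment I (GamF b (g n)) X
  moment_Gam : MomentTendsto I (fun n => GamF b (g n)) (GamF b g₀) X
  moment_small : TendstoDist (spaceTime I) (fun n y => ε n * moment (g n) X y) (fun _ => 0)

namespace FluidLimit

variable {q r : ℝ} {ε : ℕ → ℝ} {g : ℕ → SpaceTime → V3 → ℝ} {g₀ : SpaceTime → V3 → ℝ}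

theorem hasMoment (h : FluidLimit b I q r ε g g₀) (n : ℕ) {ψ : V3 → ℝ} (hψ : InDomain b ψ) :
    HasMoment I (g n) ψ := by
  simpa using (h.locL2 n).hasMoment h.kernel hψ (measurable_const (a := 1)) one_le_weight

theorem fieldL2 (h : FluidLimit b I q r ε g g₀) {ψ : V3 → ℝ} (hψ : PolyGrowth ψ) :
    FieldL2 I (moment g₀ ψ) :=
  h.locL2_limit.fieldL2_moment h.kernel (hψ.inDomain h.kernel)

theorem fieldL2_velocity (h : FluidLimit b I q r ε g g₀) (i : Fin 3) :
    FieldL2 I fun y => velocity g₀ y i := h.fieldL2 (PolyGrowth.coord i)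

theorem fieldL2_temperature (h : FluidLimit b I q r ε g g₀) : FieldL2 I (temperature g₀) :=
  h.fieldL2 polyGrowth_temperature

theorem tendsto_rpow_one_sub (h : FluidLimit b I q r ε g g₀) {s : ℝ} (hs : s < 1) :
    Tendsto (fun n => ε n ^ (-s) * ε n) atTop (𝓝 0) := by
  have h1 := h.tendsto_zero.rpow_const (p := 1 - s) (Or.inr (by linarith))
  rw [Real.zero_rpow (by linarith)] at h1
  refine h1.congr fun n => ?_
  rw [Real.rpow_sub (h.pos n), Real.rpow_one, Real.rpow_neg (h.pos n).le]
  ring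

/-- The limit of the rescaled fluxes. -/
theorem tendsto_flux (h : FluidLimit b I q r ε g g₀) {X F : V3 → ℝ}
    (hX : FluxLimit b I ε g g₀ X F) {s c₁ c₂ : ℝ}
    (hc₁ : Tendsto (fun n => ε n ^ (q - s)) atTop (𝓝 c₁))
    (hc₂ : Tendsto (fun n => ε n ^ (r - s)) atTop (𝓝 c₂)) (φ : 𝓓(spaceTime I, ℝ)) :
    Tendsto (fun n => ε n ^ (-s) * ∫ y, moment (g n) F y * φ y) atTop
      (𝓝 (c₁ * (∑ k, ∫ y, moment g₀ (fun v => X v * v k) y * (∂_{dx k} φ) y) +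
        c₂ * ∫ y, moment (GamF b g₀) X y * φ y)) := by
  have h1 : ∀ n, ε n ^ (-s) * ∫ y, moment (g n) F y * φ y =
      ε n ^ (q - s) * ((∫ y, ε n * moment (g n) X y * (∂_{dt} φ) y) +
        ∑ k, ∫ y, moment (g n) (fun v => X v * v k) y * (∂_{dx k} φ) y) +
      ε n ^ (r - s) * ∫ y, moment (GamF b (g n)) X y * φ y := by
    intro n
    rw [flux_fluctuation h.kernel (h.pos n) (h.locL2 n) (h.equation n) hX.inKerPerp.1 hX.L_eq
      (hX.hasMoment_Gam n) φ, Real.rpow_sub (h.pos n), Real.rpow_sub (h.pos n),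
      Real.rpow_neg (h.pos n).le]
    simp only [mul_assoc, integral_const_mul]
    ring
  simp only [h1]
  have l0 := hX.moment_small.2.2 (∂_{dt} φ)
  simp only [zero_mul, integral_zero] at l0
  have l1 := tendsto_finsetSum Finset.univ fun k _ => (hX.moment_coord k).2.2 (∂_{dx k} φ)
  have l := (hc₁.mul (l0.add l1)).add (hc₂.mul (hX.moment_Gam.2.2 φ))
  rwa [zero_add] at l

/-- Conservation of mass, in the limit. -/
theorem divFree (h : FluidLimit b I q r ε g g₀) : DivFree I (velocity g₀) := by
  intro φ
  have h1 : ∀ n, ε n * (∫ y, moment (g n) (fun _ => 1) y * (∂_{dt} φ) y) +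
      ∑ j, ∫ y, moment (g n) (fun v => v j) y * (∂_{dx j} φ) y = 0 := by
    intro n
    simpa only [one_mul] using moment_fluctuation_of_invariant h.kernel (h.locL2 n) (h.equation n)
      ((PolyGrowth.const 1).inDomain h.kernel) (C := 1)
      (fun v => by rw [abs_one]; nlinarith [sq_nonneg ‖v‖]) defect_one φ
  have l := (h.tendsto_zero.mul (h.moment_one.2.2 (∂_{dt} φ))).add
    (tendsto_finsetSum Finset.univ fun j _ => (h.moment_coord j).2.2 (∂_{dx j} φ))
  simp only [h1, zero_mul, zero_add] at l
  have e := tendsto_nhds_unique tendsto_const_nhds l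
  rw [integral_finsetSum _ fun j _ =>
    integrable_mul_test (h.fieldL2_velocity j).locallyIntegrableOn _, neg_eq_zero]
  exact e.symm

theorem coord_fluctuation (h : FluidLimit b I q r ε g g₀) (i : Fin 3) (n : ℕ)
    (φ : 𝓓(spaceTime I, ℝ)) :
    ε n * (∫ y, moment (g n) (fun v => v i) y * (∂_{dt} φ) y) +
      ∑ j, ∫ y, moment (g n) (fun v => v i * v j) y * (∂_{dx j} φ) y = 0 :=
  moment_fluctuation_of_invariant h.kernel (h.locL2 n) (h.equation n)
    ((PolyGrowth.coord i).inDomain h.kernel) (C := 1) (fun v => by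
      have := abs_coord_le_norm v i
      nlinarith [sq_nonneg (‖v‖ - 1 / 2)]) (defect_coord i) φ

theorem ae_eq_quadInv (h : FluidLimit b I q r ε g g₀) : ∀ᵐ y, y ∈ spaceTime I →
    g₀ y =ᵐ[volume] quadInv (moment g₀ (fun _ => 1) y - 3 / 2 * temperature g₀ y)
      (velocity g₀ y) (1 / 2 * temperature g₀ y) := by
  filter_upwards [h.inKer] with y hy hyI
  exact (hy hyI).eq_quadInv h.kernel

/-- The Boussinesq relation: conservation of momentum, in the limit. -/
theorem gradZero (h : FluidLimit b I q r ε g g₀) :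
    GradZero I fun y => moment g₀ (fun _ => 1) y + temperature g₀ y := by
  intro i φ
  have l := (h.tendsto_zero.mul ((h.moment_coord i).2.2 (∂_{dt} φ))).add
    (tendsto_finsetSum Finset.univ fun j _ => (h.moment_coord_coord i j).2.2 (∂_{dx j} φ))
  simp only [h.coord_fluctuation, zero_mul, zero_add] at l
  have e := tendsto_nhds_unique tendsto_const_nhds l
  have h2 : ∀ j, ∫ y, moment g₀ (fun v => v i * v j) y * (∂_{dx j} φ) y =
      delta i j * ∫ y, (moment g₀ (fun _ => 1) y + temperature g₀ y) * (∂_{dx j} φ) y := by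
    intro j
    rw [← integral_const_mul, integral_mul_test_congr
      (G := fun y => delta i j * (moment g₀ (fun _ => 1) y + temperature g₀ y))]
    · simp only [mul_assoc]
    · filter_upwards [h.ae_eq_quadInv] with y hy hyI
      rw [moment, pairM_congr_left (hy hyI), pairM_quadInv_coord_coord]
      ring
  simp only [h2, sum_delta_mul] at e
  rw [← e, neg_zero]

section Heat

variable {Ahat : Fin 3 → V3 → ℝ}

/-- The moment `(|v|² - 5)/2` of the kinetic equation has the flux `A`, which is a combination of
`⟨g, Â ⊗ v⟩` and `⟨Γ(g,g), Â⟩`. -/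
theorem heatEq (h : FluidLimit b I q r ε g g₀) (hX : ∀ i, FluxLimit b I ε g g₀ (Ahat i) (A i))
    {κ : ℝ} (hκ : ∀ i j, pairM (Ahat i) (A j) = 5 / 2 * κ * delta i j)
    {s c₁ c₂ : ℝ} (hs : s < 1) (hc₁ : Tendsto (fun n => ε n ^ (q - s)) atTop (𝓝 c₁))
    (hc₂ : Tendsto (fun n => ε n ^ (r - s)) atTop (𝓝 c₂)) :
    HeatEq I c₂ (c₁ * κ) (velocity g₀) (temperature g₀) := by
  have hA : ∀ i, InKerPerp b (Ahat i) ∧ L b (Ahat i) =ᵐ[volume] A i := fun i =>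
    ⟨(hX i).inKerPerp, (hX i).L_eq⟩
  intro φ
  -- the flux of the moment `E` is `E(v) v = A`
  set E : V3 → ℝ := fun v => 1 / 2 * ‖v‖ ^ 2 + -5 / 2 * 1 with hE
  have hE1 : InDomain b fun _ => 1 := (PolyGrowth.const 1).inDomain h.kernel
  have hE2 : InDomain b fun v => ‖v‖ ^ 2 := PolyGrowth.normSq.inDomain h.kernel
  have hEq : E = quadInv (-5 / 2) 0 (1 / 2) := by
    ext v; simp only [hE, quadInv, Pi.zero_apply, zero_mul, Finset.sum_const_zero]; ring
  have hEA : ∀ j, (fun v => E v * v j) = A j := by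
    intro j; ext v; simp only [hE, A]; ring
  have h1 : ∀ n, ε n ^ (-s) * ε n * (∫ y, moment (g n) E y * (∂_{dt} φ) y) +
      ∑ j, ε n ^ (-s) * ∫ y, moment (g n) (A j) y * (∂_{dx j} φ) y = 0 := by
    intro n
    have := moment_fluctuation_of_invariant h.kernel (h.locL2 n) (h.equation n) (ψ := E)
      (by rw [hEq]; exact (polyGrowth_quadInv _ _ _).inDomain h.kernel) (C := 5 / 2)
      (fun v => by
        rw [hE, abs_le]
        constructor <;> nlinarith [sq_nonneg ‖v‖]) (by rw [hEq]; exact defect_quadInv _ _ _) φ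
    simp only [hEA] at this
    rw [← Finset.mul_sum, mul_assoc, ← mul_add, this, mul_zero]
  have h2 : Tendsto (fun n => ∫ y, moment (g n) E y * (∂_{dt} φ) y) atTop
      (𝓝 (1 / 2 * (∑ i, ∫ y, moment g₀ (fun v => v i * v i) y * (∂_{dt} φ) y) +
        -5 / 2 * ∫ y, moment g₀ (fun _ => 1) y * (∂_{dt} φ) y)) := by
    have e : ∀ n, ∫ y, moment (g n) E y * (∂_{dt} φ) y =
        1 / 2 * (∑ i, ∫ y, moment (g n) (fun v => v i * v i) y * (∂_{dt} φ) y) +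
          -5 / 2 * ∫ y, moment (g n) (fun _ => 1) y * (∂_{dt} φ) y := by
      intro n
      rw [hE, (h.hasMoment n hE2).integral_moment_lin (h.hasMoment n hE1),
        ← HasMoment.integral_moment_sum fun i =>
          h.hasMoment n (((PolyGrowth.coord i).mul (PolyGrowth.coord i)).inDomain h.kernel)]
      have : (fun v : V3 => ‖v‖ ^ 2) = fun v => ∑ i, v i * v i := by
        ext v
        rw [EuclideanSpace.norm_sq_eq]
        simp only [Real.norm_eq_abs, sq_abs]
        exact Finset.sum_congr rfl fun i _ => sq _
      rw [this]
    simp only [e]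
    exact ((tendsto_finsetSum _ fun i _ => (h.moment_coord_coord i i).2.2 _).const_mul _).add
      ((h.moment_one.2.2 _).const_mul _)
  have l := ((h.tendsto_rpow_one_sub hs).mul h2).add (tendsto_finsetSum Finset.univ fun j _ =>
    h.tendsto_flux (hX j) hc₁ hc₂ (∂_{dx j} φ))
  simp only [h1, zero_mul, zero_add] at l
  have e := tendsto_nhds_unique tendsto_const_nhds l
  have e1 : ∀ i k, ∫ y, moment g₀ (fun v => Ahat i v * v k) y * (∂_{dx k} (∂_{dx i} φ)) y =
      delta i k * (5 / 2 * κ * ∫ y, temperature g₀ y * (∂_{dx k} (∂_{dx i} φ)) y) := by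
    intro i k
    rw [← integral_const_mul, ← integral_const_mul, integral_mul_test_congr
      (G := fun y => delta i k * (5 / 2 * κ * temperature g₀ y))]
    · simp only [mul_assoc]
    · filter_upwards [h.ae_eq_quadInv] with y hy hyI
      rw [moment, (hX i).inKerPerp.pairM_mul_coord h.kernel (hy hyI), hκ]
      simp only [pairM_Ahat_B h.kernel hA, mul_zero, Finset.sum_const_zero]
      ring
  have e2 : ∀ i, ∫ y, moment (GamF b g₀) (Ahat i) y * (∂_{dx i} φ) y =
      5 / 2 * ∫ y, velocity g₀ y i * temperature g₀ y * (∂_{dx i} φ) y := by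
    intro i
    rw [← integral_const_mul, integral_mul_test_congr
      (G := fun y => 5 / 2 * (velocity g₀ y i * temperature g₀ y))]
    · simp only [mul_assoc]
    · filter_upwards [h.ae_eq_quadInv] with y hy hyI
      rw [moment, GamF, pairM_Gam_of_quadInv h.kernel (hX i).inKerPerp.1 (hX i).L_eq (hy hyI),
        pairM_quadInv_sq_A]
      ring
  simp only [e1, e2, sum_delta_mul] at e
  rw [integral_finsetSum _ fun j _ => integrable_mul_test
    ((h.fieldL2_velocity j).locallyIntegrableOn_mul h.fieldL2_temperature) _]
  have e3 : ∫ y, temperature g₀ y * lap φ y =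
      ∑ j, ∫ y, temperature g₀ y * (∂_{dx j} (∂_{dx j} φ)) y := by
    rw [← integral_finsetSum _ fun j _ =>
      integrable_mul_test h.fieldL2_temperature.locallyIntegrableOn _]
    simp only [lap, FunLike.coe_sum, Finset.sum_apply, Finset.mul_sum]
  rw [e3]
  simp only [Finset.sum_add_distrib, ← Finset.mul_sum] at e
  linear_combination (2 / 5) * e

end Heat

section Momentum

variable {Bhat : Fin 3 → Fin 3 → V3 → ℝ}

/-- The gradients of the rescaled second moments `ε^{-s} ⟨g, |v|²/3⟩` converge, although the moments
themselves need not. The isotropic part `|u|²/3` of the quadratic flux is put into the pressure. -/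
theorem tendsto_pressure (h : FluidLimit b I q r ε g g₀)
    (hX : ∀ i j, FluxLimit b I ε g g₀ (Bhat i j) (B i j)) {ν : ℝ}
    (hν : ∀ i j k l, pairM (Bhat i j) (B k l) =
      ν * (delta i k * delta j l + delta i l * delta j k - 2 / 3 * delta i j * delta k l))
    (hBA : ∀ i j k, pairM (Bhat i j) (A k) = 0)
    {s c₁ c₂ : ℝ} (hs : s < 1) (hc₁ : Tendsto (fun n => ε n ^ (q - s)) atTop (𝓝 c₁))
    (hc₂ : Tendsto (fun n => ε n ^ (r - s)) atTop (𝓝 c₂)) (i : Fin 3) (φ : 𝓓(spaceTime I, ℝ)) :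
    Tendsto (fun n => ∫ y, (ε n ^ (-s) * moment (g n) (fun v => 1 / 3 * ‖v‖ ^ 2) y -
      c₂ / 3 * ∑ k, velocity g₀ y k * velocity g₀ y k) * (∂_{dx i} φ) y) atTop
      (𝓝 (-(c₁ * ν * (∫ y, velocity g₀ y i * lap φ y) +
        c₂ * ∫ y, ∑ j, velocity g₀ y i * velocity g₀ y j * (∂_{dx j} φ) y))) := by
  have hN : InDomain b fun v => 1 / 3 * ‖v‖ ^ 2 :=
    (PolyGrowth.normSq.const_mul _).inDomain h.kernel
  have hBd : ∀ i j, InDomain b (B i j) := fun i j => (polyGrowth_B i j).inDomain h.kernel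
  have hu := h.fieldL2_velocity
  have h1 : ∀ n, ε n ^ (-s) * (∫ y, moment (g n) (fun v => 1 / 3 * ‖v‖ ^ 2) y * (∂_{dx i} φ) y) =
      -(ε n ^ (-s) * ε n * (∫ y, moment (g n) (fun v => v i) y * (∂_{dt} φ) y) +
        ∑ j, ε n ^ (-s) * ∫ y, moment (g n) (B i j) y * (∂_{dx j} φ) y) := by
    intro n
    have e1 : ∀ j, ∫ y, moment (g n) (fun v => v i * v j) y * (∂_{dx j} φ) y =
        (∫ y, moment (g n) (B i j) y * (∂_{dx j} φ) y) +
          delta i j * ∫ y, moment (g n) (fun v => 1 / 3 * ‖v‖ ^ 2) y * (∂_{dx j} φ) y := by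
      intro j
      have e : (fun v : V3 => v i * v j) =
          fun v => 1 * B i j v + delta i j * (1 / 3 * ‖v‖ ^ 2) := by
        ext v; unfold B; ring
      rw [e, (h.hasMoment n (hBd i j)).integral_moment_lin (h.hasMoment n hN), one_mul]
    have e2 := h.coord_fluctuation i n φ
    simp only [e1, Finset.sum_add_distrib, sum_delta_mul] at e2
    rw [← Finset.mul_sum]
    linear_combination ε n ^ (-s) * e2
  have hP : ∀ n, ∫ y, (ε n ^ (-s) * moment (g n) (fun v => 1 / 3 * ‖v‖ ^ 2) y -
      c₂ / 3 * ∑ k, velocity g₀ y k * velocity g₀ y k) * (∂_{dx i} φ) y =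
      ε n ^ (-s) * (∫ y, moment (g n) (fun v => 1 / 3 * ‖v‖ ^ 2) y * (∂_{dx i} φ) y) -
        c₂ / 3 * ∑ k, ∫ y, velocity g₀ y k * velocity g₀ y k * (∂_{dx i} φ) y := by
    intro n
    have i1 := integrable_mul_test (h.hasMoment n hN).locallyIntegrableOn (∂_{dx i} φ)
    have i2 := fun k => integrable_mul_test ((hu k).locallyIntegrableOn_mul (hu k)) (∂_{dx i} φ)
    rw [← integral_finsetSum _ fun k _ => i2 k, ← integral_const_mul, ← integral_const_mul,
      ← integral_sub (i1.const_mul _) ((integrable_finsetSum _ fun k _ => i2 k).const_mul _)]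
    congr 1; ext y
    rw [← Finset.sum_mul]
    ring
  simp only [hP, h1]
  have l := (((h.tendsto_rpow_one_sub hs).mul ((h.moment_coord i).2.2 (∂_{dt} φ))).add
    (tendsto_finsetSum Finset.univ fun j _ =>
      h.tendsto_flux (hX i j) hc₁ hc₂ (∂_{dx j} φ))).neg.sub_const
    (c₂ / 3 * ∑ k, ∫ y, velocity g₀ y k * velocity g₀ y k * (∂_{dx i} φ) y)
  rw [zero_mul, zero_add] at l
  convert l using 2
  set J : Fin 3 → Fin 3 → Fin 3 → ℝ :=
    fun l k j => ∫ y, velocity g₀ y l * (∂_{dx k} (∂_{dx j} φ)) y with hJ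
  have iJ : ∀ l k j, Integrable fun y => velocity g₀ y l * (∂_{dx k} (∂_{dx j} φ)) y :=
    fun l k j => integrable_mul_test (hu l).locallyIntegrableOn _
  have e1 : ∀ j k, ∫ y, moment g₀ (fun v => Bhat i j v * v k) y * (∂_{dx k} (∂_{dx j} φ)) y =
      ν * (delta i k * J j k j + delta j k * J i k j - 2 / 3 * (delta i j * J k k j)) := by
    intro j k
    rw [integral_mul_test_congr (G := fun y => ν * (delta i k * velocity g₀ y j +
      delta j k * velocity g₀ y i - 2 / 3 * (delta i j * velocity g₀ y k)))]
    · rw [hJ]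
      simp only [← integral_const_mul]
      rw [← integral_add ((iJ _ _ _).const_mul _) ((iJ _ _ _).const_mul _),
        ← integral_sub (((iJ _ _ _).const_mul _).fun_add ((iJ _ _ _).const_mul _))
          (((iJ _ _ _).const_mul _).const_mul _), ← integral_const_mul]
      congr 1; ext y; ring
    · filter_upwards [h.ae_eq_quadInv] with y hy hyI
      rw [moment, (hX i j).inKerPerp.pairM_mul_coord h.kernel (hy hyI), hBA]
      have e : ∀ l, velocity g₀ y l * pairM (Bhat i j) (B k l) =
          ν * delta i k * (delta j l * velocity g₀ y l) +
            ν * delta j k * (delta i l * velocity g₀ y l) -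
            ν * (2 / 3) * delta i j * (delta k l * velocity g₀ y l) := fun l => by
        rw [hν]; ring
      simp only [e, Finset.sum_add_distrib, Finset.sum_sub_distrib, ← Finset.mul_sum,
        sum_delta_mul]
      ring
  have e2 : ∀ j, ∫ y, moment (GamF b g₀) (Bhat i j) y * (∂_{dx j} φ) y =
      (∫ y, velocity g₀ y i * velocity g₀ y j * (∂_{dx j} φ) y) -
        1 / 3 * (delta i j * ∑ k, ∫ y, velocity g₀ y k * velocity g₀ y k * (∂_{dx j} φ) y) := by
    intro j
    have i2 := fun k l =>
      integrable_mul_test ((hu k).locallyIntegrableOn_mul (hu l)) (∂_{dx j} φ)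
    rw [integral_mul_test_congr (G := fun y => velocity g₀ y i * velocity g₀ y j -
      1 / 3 * (delta i j * ∑ k, velocity g₀ y k * velocity g₀ y k))]
    · rw [← integral_finsetSum _ fun k _ => i2 k k, ← integral_const_mul, ← integral_const_mul,
        ← integral_sub (i2 i j)
          (((integrable_finsetSum _ fun k _ => i2 k k).const_mul _).const_mul _)]
      congr 1; ext y
      rw [← Finset.sum_mul]
      ring
    · filter_upwards [h.ae_eq_quadInv] with y hy hyI
      rw [moment, GamF, pairM_Gam_of_quadInv h.kernel (hX i j).inKerPerp.1 (hX i j).L_eq (hy hyI),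
        pairM_quadInv_sq_B]
      ring
  -- two of the three terms of the divergence of the viscous stress vanish as `div u = 0`
  have d1 : ∑ k, J k k i = 0 := by
    have := h.divFree (∂_{dx i} φ)
    rwa [neg_eq_zero, integral_finsetSum _ fun k _ => iJ k k i] at this
  have d2 : ∑ j, J j i j = 0 := by
    rw [← d1]
    refine Finset.sum_congr rfl fun j _ => ?_
    rw [hJ]
    simp only [lineDeriv_test_comm φ (dx i) (dx j)]
  have e3 : ∫ y, velocity g₀ y i * lap φ y = ∑ j, J i j j := by
    rw [hJ, ← integral_finsetSum _ fun j _ => iJ i j j]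
    simp only [lap, FunLike.coe_sum, Finset.sum_apply, Finset.mul_sum]
  have e4 : ∀ j, ∑ k, ν * (delta i k * J j k j + delta j k * J i k j -
      2 / 3 * (delta i j * J k k j)) = ν * J j i j + ν * J i j j -
        delta i j * (ν * (2 / 3) * ∑ k, J k k j) := by
    intro j
    rw [← Finset.mul_sum, Finset.sum_sub_distrib, Finset.sum_add_distrib, sum_delta_mul,
      sum_delta_mul, ← Finset.mul_sum, ← Finset.mul_sum]
    ring
  rw [integral_finsetSum _ fun j _ => integrable_mul_test ((hu i).locallyIntegrableOn_mul (hu j)) _,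
    e3]
  simp only [e1, e2, e4]
  simp only [Finset.sum_add_distrib, Finset.sum_sub_distrib, ← Finset.mul_sum, sum_delta_mul, d1, d2]
  ring

/-- The exponent `s < 1` is the rate at which the fluxes vanish; the factors `c₁` of the viscous and
`c₂` of the convective terms depend on the regime. -/
theorem momentumEq (h : FluidLimit b I q r ε g g₀) {Lam : Set V3}
    (hgper : ∀ n, IsPeriodic I Lam (g n)) (hg₀per : IsPeriodic I Lam g₀)
    (hX : ∀ i j, FluxLimit b I ε g g₀ (Bhat i j) (B i j)) {ν : ℝ}
    (hν : ∀ i j k l, pairM (Bhat i j) (B k l) =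
      ν * (delta i k * delta j l + delta i l * delta j k - 2 / 3 * delta i j * delta k l))
    (hBA : ∀ i j k, pairM (Bhat i j) (A k) = 0)
    {s c₁ c₂ : ℝ} (hs : s < 1) (hc₁ : Tendsto (fun n => ε n ^ (q - s)) atTop (𝓝 c₁))
    (hc₂ : Tendsto (fun n => ε n ^ (r - s)) atTop (𝓝 c₂)) :
    ∃ p, IsPeriodicDist I Lam p ∧ MomentumEq I c₂ (c₁ * ν) (velocity g₀) p := by
  have hu := h.fieldL2_velocity
  set P : ℕ → SpaceTime → ℝ := fun n y => ε n ^ (-s) * moment (g n) (fun v => 1 / 3 * ‖v‖ ^ 2) y -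
    c₂ / 3 * ∑ k, velocity g₀ y k * velocity g₀ y k with hPdef
  have hP : ∀ n, LocallyIntegrableOn (P n) (spaceTime I) := by
    intro n
    have h1 := (h.hasMoment n
      ((PolyGrowth.normSq.const_mul (1 / 3)).inDomain h.kernel)).locallyIntegrableOn
    refine locallyIntegrableOn_of_compact fun K hK hKI => ?_
    exact ((h1.integrableOn_compact_subset hKI hK).const_mul _).sub
      ((integrable_finsetSum _ fun k _ => (hu k).integrableOn_mul (hu k) hK hKI).const_mul _)
  have hPper : ∀ n, IsPeriodic I Lam (P n) := by
    intro n k hk t ht x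
    simp only [hPdef, velocity_apply, (hgper n).moment _ k hk t ht x,
      hg₀per.moment _ k hk t ht x]
  obtain ⟨p, hp, e⟩ := exists_distribution_of_tendsto_gradient hP hPper
    (h.tendsto_pressure hX hν hBA hs hc₁ hc₂)
  refine ⟨p, hp, fun i φ => ?_⟩
  rw [e]
  ring

end Momentum

end FluidLimit

theorem quadInv_eq_fluid (ρ θ : ℝ) (u v : V3) :
    quadInv (ρ - 3 / 2 * θ) u (1 / 2 * θ) v =
      ρ + inner ℝ u v + 1 / 2 * (‖v‖ ^ 2 - 3) * θ := by
  have : inner ℝ u v = ∑ i, u i * v i := by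
    rw [PiLp.inner_apply]
    exact Finset.sum_congr rfl fun i _ => by simp [mul_comm]
  rw [this]
  unfold quadInv
  ring

theorem FluidLimit.ae_eq_fluid {q r : ℝ} {ε : ℕ → ℝ} {g : ℕ → SpaceTime → V3 → ℝ}
    {g₀ : SpaceTime → V3 → ℝ} (h : FluidLimit b I q r ε g g₀) :
    ∀ᵐ z : SpaceTime × V3, z ∈ phase I → g₀ z.1 z.2 = moment g₀ (fun _ => 1) z.1 +
      inner ℝ (velocity g₀ z.1) z.2 + 1 / 2 * (‖z.2‖ ^ 2 - 3) * temperature g₀ z.1 := by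
  simp only [← quadInv_eq_fluid]
  refine ae_phase ?_ h.ae_eq_quadInv
  have hρ : Measurable fun z : SpaceTime × V3 => moment g₀ (fun _ => 1) z.1 :=
    (h.fieldL2 (PolyGrowth.const 1)).1.comp measurable_fst
  have hθ : Measurable fun z : SpaceTime × V3 => temperature g₀ z.1 :=
    h.fieldL2_temperature.1.comp measurable_fst
  have hu : ∀ i, Measurable fun z : SpaceTime × V3 => velocity g₀ z.1 i := fun i =>
    (h.fieldL2_velocity i).1.comp measurable_fst
  have hv : ∀ i, Measurable fun z : SpaceTime × V3 => z.2 i := fun i => by fun_prop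
  refine measurableSet_eq_fun h.locL2_limit.1 ?_
  exact ((hρ.sub (hθ.const_mul _)).add (Finset.measurable_fun_sum _ fun i _ => (hu i).mul (hv i))).add
    ((hθ.const_mul _).mul (measurable_snd.norm.pow_const 2))

end

end StationaryLimit

end

open StationaryLimit

theorem theorem3p1
    -- the collision kernel and the solutions `Â`, `B̂` of `L Â = A`, `L B̂ = B` in `Ker^⊥ L`
    (b : ℝ → ℝ → ℝ) (hb : IsCutoffKernel b)
    (Ahat : Fin 3 → V3 → ℝ) (Bhat : Fin 3 → Fin 3 → V3 → ℝ)
    (hA : ∀ i, InKerPerp b (Ahat i) ∧ L b (Ahat i) =ᵐ[volume] A i)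
    (hB : ∀ i j, InKerPerp b (Bhat i j) ∧ L b (Bhat i j) =ᵐ[volume] B i j)
    -- the time set, the spatial domain and the scaling
    (I : Opens ℝ) (Lam : Set V3) (hLam : IsPeriodLattice Lam)
    (q r : ℝ) (hq : 0 < q) (hr : 0 < r)
    (ε : ℕ → ℝ) (hε : ∀ n, 0 < ε n) (hε0 : Tendsto ε atTop (𝓝 0))
    -- the nonnegative solutions `f = M + ε^r g M` and the limit of the `g`
    (f g : ℕ → SpaceTime → V3 → ℝ) (g₀ : SpaceTime → V3 → ℝ)
    (hf : ∀ n y v, f n y v = M v + ε n ^ r * g n y v * M v)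
    (hf0 : ∀ n, ∀ᵐ z : SpaceTime × V3, z ∈ phase I → 0 ≤ f n z.1 z.2)
    (hgper : ∀ n, IsPeriodic I Lam (g n)) (hg₀per : IsPeriodic I Lam g₀)
    (hgL2 : ∀ n, LocL2 b I (fun v => (1 + ‖v‖ ^ 2) ^ 2) (g n))
    (hg₀L2 : LocL2 b I (fun _ => 1) g₀)
    (hsol : ∀ n, IsWeakSolution b I (ε n) q (f n))
    -- convergence in the sense of distributions, compatible with the collision operator
    (hconv : TendstoDist (phase I) (fun n z => g n z.1 z.2) (fun z => g₀ z.1 z.2))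
    (hLconv : TendstoDist (phase I) (fun n z => L b (g n z.1) z.2) (fun z => L b (g₀ z.1) z.2))
    (hGamconv : TendstoDist (phase I) (fun n z => ε n ^ r * Gam b (g n z.1) z.2) (fun _ => 0))
    -- convergence of the moments
    (hm1 : MomentTendsto I g g₀ (fun _ => 1))
    (hmv : ∀ i, MomentTendsto I g g₀ (fun v => v i))
    (hmvv : ∀ i j, MomentTendsto I g g₀ (fun v => v i * v j))
    (hmv3 : ∀ i, MomentTendsto I g g₀ (fun v => v i * ‖v‖ ^ 2))
    (hmA : ∀ i j, MomentTendsto I g g₀ (fun v => Ahat i v * v j))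
    (hmB : ∀ i j k, MomentTendsto I g g₀ (fun v => Bhat i j v * v k))
    (hGA : ∀ n i, HasMoment I (GamF b (g n)) (Ahat i))
    (hGB : ∀ n i j, HasMoment I (GamF b (g n)) (Bhat i j))
    (hmGA : ∀ i, MomentTendsto I (fun n => GamF b (g n)) (GamF b g₀) (Ahat i))
    (hmGB : ∀ i j, MomentTendsto I (fun n => GamF b (g n)) (GamF b g₀) (Bhat i j))
    (hmA0 : ∀ i, TendstoDist (spaceTime I) (fun n y => ε n * moment (g n) (Ahat i) y) (fun _ => 0))
    (hmB0 : ∀ i j,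
      TendstoDist (spaceTime I) (fun n y => ε n * moment (g n) (Bhat i j) y) (fun _ => 0)) :
    -- the heat conductivity and the viscosity
    ∃ κ ν : ℝ, 0 < κ ∧ 0 < ν ∧
      (∀ i j, pairM (Ahat i) (A j) = 5 / 2 * κ * delta i j) ∧
      (∀ i j k l, pairM (Bhat i j) (B k l) =
        ν * (delta i k * delta j l + delta i l * delta j k - 2 / 3 * delta i j * delta k l)) ∧
      -- the form of the limit
      ∃ (ρ θ : SpaceTime → ℝ) (u : SpaceTime → V3),
        FieldL2 I ρ ∧ FieldL2 I θ ∧ (∀ i, FieldL2 I (fun y => u y i)) ∧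
        IsPeriodic I Lam ρ ∧ IsPeriodic I Lam θ ∧ IsPeriodic I Lam u ∧
        (∀ᵐ z : SpaceTime × V3, z ∈ phase I →
          g₀ z.1 z.2 = ρ z.1 + inner ℝ (u z.1) z.2 + 1 / 2 * (‖z.2‖ ^ 2 - 3) * θ z.1) ∧
        DivFree I u ∧ GradZero I (fun y => ρ y + θ y) ∧
        -- the three regimes
        (r = q → q < 1 →
          (∃ p, IsPeriodicDist I Lam p ∧ MomentumEq I 1 ν u p) ∧ HeatEq I 1 κ u θ) ∧
        (q < min 1 r →
          (∃ p, IsPeriodicDist I Lam p ∧ MomentumEq I 0 ν u p) ∧ HeatEq I 0 κ u θ) ∧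
        (r < min 1 q →
          (∃ p, IsPeriodicDist I Lam p ∧ MomentumEq I 1 0 u p) ∧ HeatEq I 1 0 u θ) := by
  obtain ⟨κ, hκ0, hκ⟩ := exists_conductivity hb hA
  obtain ⟨ν, hν0, hν⟩ := exists_viscosity hb hB
  have hw := fun n (Φ : 𝓓(phase I, ℝ)) => (hsol n).fluctuation hb
    (Real.rpow_pos_of_pos (hε n) r).ne' (hf n)
    ((hgL2 n).of_weight hb fun v => by simpa using one_le_weight v) Φ
  have h : FluidLimit b I q r ε g g₀ :=
    ⟨hb, hε, hε0, hgL2, hg₀L2, hw,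
      ae_inKer_of_tendsto hq hε hε0 hg₀L2 hw hconv hLconv hGamconv, hm1, hmv, hmvv⟩
  have hXA : ∀ i, FluxLimit b I ε g g₀ (Ahat i) (A i) := fun i =>
    ⟨(hA i).1, (hA i).2, hmA i, fun n => hGA n i, hmGA i, hmA0 i⟩
  have hXB : ∀ i j, FluxLimit b I ε g g₀ (Bhat i j) (B i j) := fun i j =>
    ⟨(hB i j).1, (hB i j).2, hmB i j, fun n => hGB n i j, hmGB i j, hmB0 i j⟩
  have hBA : ∀ i j k, pairM (Bhat i j) (A k) = 0 := fun i j k => pairM_Bhat_A hb hA hB i j k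
  have hzero : ∀ {s : ℝ}, 0 < s → Tendsto (fun n => ε n ^ s) atTop (𝓝 0) := fun {s} hs => by
    simpa [Real.zero_rpow hs.ne'] using hε0.rpow_const (p := s) (Or.inr hs.le)
  have hone : ∀ s : ℝ, Tendsto (fun n => ε n ^ (s - s)) atTop (𝓝 1) := fun s => by
    simp
  refine ⟨κ, ν, hκ0, hν0, hκ, hν, moment g₀ (fun _ => 1), temperature g₀, velocity g₀,
    h.fieldL2 (PolyGrowth.const 1), h.fieldL2_temperature, h.fieldL2_velocity, hg₀per.moment _,
    hg₀per.moment _, fun k hk t ht x => ?_, h.ae_eq_fluid, h.divFree, h.gradZero,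
    fun hrq hq1 => ?_, fun hqr => ?_, fun hrq => ?_⟩
  · ext i
    exact hg₀per.moment _ k hk t ht x
  -- in each regime the equations are rescaled by `ε ^ (-min q r)`
  · subst hrq
    have hm := h.momentumEq hgper hg₀per hXB hν hBA hq1 (hone r) (hone r)
    have hh := h.heatEq hXA hκ hq1 (hone r) (hone r)
    rw [one_mul] at hm hh
    exact ⟨hm, hh⟩
  · have hs := hqr.trans_le (min_le_left 1 r)
    have hc := hzero (sub_pos.2 (hqr.trans_le (min_le_right 1 r)))
    have hm := h.momentumEq hgper hg₀per hXB hν hBA hs (hone q) hc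
    have hh := h.heatEq hXA hκ hs (hone q) hc
    rw [one_mul] at hm hh
    exact ⟨hm, hh⟩
  · have hs := hrq.trans_le (min_le_left 1 q)
    have hc := hzero (sub_pos.2 (hrq.trans_le (min_le_right 1 q)))
    have hm := h.momentumEq hgper hg₀per hXB hν hBA hs hc (hone r)
    have hh := h.heatEq hXA hκ hs hc (hone r)
    rw [zero_mul] at hm hh
    exact ⟨hm, hh⟩
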